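/- Let $K$ be a field; all vector spaces are over $K$, and all brackets and all maps denoted $l$, $\phi$, $J$, $F$ below are linear in each argument. The categories $\mathbf{2Term\text{-}L_\infty}$ and $\mathbf{Lie2Triple}$ defined below are equivalent. More precisely, there is an equivalence $\Phi:\mathbf{2Term\text{-}L_\infty}\to\mathbf{Lie2Triple}$ with quasi-inverse $\Psi$ lying over the usual correspondence between 2-term complexes and 2-vector spaces: up to natural isomorphism, the underlying 2-vector space of $\Phi(\mathcal V)$ is the one of the underlying complex $\mathrm d:V_1\to V_0$ of $\mathcal V$ (objects $V_0$, morphisms $V_0\oplus V_1$, $s(x+u)=x$, $t(x+u)=x+\mathrm du$), and the underlying complex of $\Psi(L)$ is $t:\ker(s)\to L_0$. **2-term $L_\infty$-triple algebras.** Such an object consists of a linear map $\mathrm d:V_1\to V_0$, bilinear brackets $[\cdot,\cdot]:V_i\times V_j\to V_{i+j}$ ($i+j\le1$), trilinear brackets $[\cdot,\cdot,\cdot]:V_i\times V_j\times V_k\to V_{i+j+k}$ ($i+j+k\le 1$; brackets with more than one argument in $V_1$ are zero), and multilinear maps $l_3:V_0^3\to V_1$, $\widehat l_4,\widetilde l_4:V_0^4\to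 V_1$, $l_5:V_0^5\to V_1$, such that for $x,x_i,y_i,z_i\in V_0$ and $u,w\in V_1$: * $[x_1,x_2]=-[x_2,x_1]$, $[x,u]=-[u,x]$, $[x_1,x_2,x_3]=-[x_2,x_1,x_3]$, $[x_1,x_2,u]=-[x_2,x_1,u]$, $[u,x_1,x_2]=-[x_1,u,x_2]$; * $\mathrm d[x,u]=[x,\mathrm du]$, $[\mathrm du,w]=[u,\mathrm dw]$, $\mathrm d[x_1,x_2,u]=[x_1,x_2,\mathrm du]$, $\mathrm d[u,x_1,x_2]=[\mathrm du,x_1,x_2]$, $[\mathrm du,w,x]=[u,\mathrm dw,x]$, $[x,\mathrm du,w]=[x,u,\mathrm dw]$; * put $E_3(a_1,a_2,a_3)=[[a_1,a_2],a_3]+[[a_2,a_3],a_1]+[[a_3,a_1],a_2]+[a_1,a_2,a_3]+[a_2,a_3,a_1]+[a_3,a_1,a_2]$, $\widehat E_4(a_1,a_2,a_3,b)=[[a_1,a_2],a_3,b]+[[a_2,a_3],a_1,b]+[[a_3,a_1],a_2,b]$, $\widetilde E_4(a_1,a_2,b_1,b_2)=-[a_1,a_2,[b_1,b_2]]+[[a_1,a_2,b_1],b_2]+[b_1,[a_1,a_2,b_2]]$,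 $E_5(a_1,a_2,b_1,b_2,b_3)=-[a_1,a_2,[b_1,b_2,b_3]]+[[a_1,a_2,b_1],b_2,b_3]+[b_1,[a_1,a_2,b_2],b_3]+[b_1,b_2,[a_1,a_2,b_3]]$. For each pair $(l,E)$ among $(l_3,E_3),(\widehat l_4,\widehat E_4),(\widetilde l_4,\widetilde E_4),(l_5,E_5)$ we have $\mathrm d\,l=E$ on $V_0$, and, for every position $i$, if the $i$-th argument of $l$ is $\mathrm du$ with $u\in V_1$ and the other arguments are in $V_0$, then $l(\dots,\mathrm du,\dots)=E(\dots,u,\dots)$; * with $X=(x_1,x_2)$, $Y=(y_1,y_2)$, $[X,z]=[x_1,x_2,z]$, and $X,Y$ abbreviating pairs of arguments: $$\begin{aligned}&[X,l_3(y_1,y_2,y_3)]+\widetilde l_4(X,[y_1,y_2],y_3)+\widetilde l_4(X,y_2,[y_1,y_3])+[\widetilde l_4(X,y_1,y_2),y_3]+[y_2,\widetilde l_4(X,y_1,y_3)]+l_5(X,y_1,y_2,y_3)+l_5(X,y_3,y_1,y_2)\\&=\widetilde l_4(X,y_1,[y_2,y_3])+[y_1,\widetilde l_4(X,y_2,y_3)]+l_3([X,y_1],y_2,y_3)+l_3(y_1,[X,y_2],y_3)+l_3(y_1,y_2,[X,y_3])+l_5(X,y_3,y_2,y_1),\end{aligned}$$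 $$\begin{aligned}&[X,\widehat l_4(y_1,y_2,y_3,z)]+l_5(X,[y_1,y_2],y_3,z)+l_5(X,y_2,[y_1,y_3],z)+[\widetilde l_4(X,y_1,y_2),y_3,z]+[y_2,\widetilde l_4(X,y_1,y_3),z]\\&=l_5(X,y_1,[y_2,y_3],z)+\widehat l_4([X,y_1],y_2,y_3,z)+[y_1,\widetilde l_4(X,y_2,y_3),z]+\widehat l_4(y_1,y_2,y_3,[X,z])+\widehat l_4(y_1,[X,y_2],y_3,z)+\widehat l_4(y_1,y_2,[X,y_3],z),\end{aligned}$$ $$\begin{aligned}&[X,\widetilde l_4(Y,z_1,z_2)]+\widetilde l_4(X,[Y,z_1],z_2)+\widetilde l_4(X,z_1,[Y,z_2])+[l_5(X,Y,z_1),z_2]+[z_1,l_5(X,Y,z_2)]\\&=l_5(X,Y,[z_1,z_2])+[Y,\widetilde l_4(X,z_1,z_2)]+\widetilde l_4([X,y_1],y_2,z_1,z_2)+\widetilde l_4(y_1,[X,y_2],z_1,z_2)+\widetilde l_4(Y,[X,z_1],z_2)+\widetilde l_4(Y,z_1,[X,z_2]),\end{aligned}$$ $$\begin{aligned}&[l_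5(X,Y,z_1),z_2,z_3]+[z_1,l_5(X,Y,z_2),z_3]+[z_1,z_2,l_5(X,Y,z_3)]+[X,l_5(Y,z_1,z_2,z_3)]\\&\quad+l_5(X,[Y,z_1],z_2,z_3)+l_5(X,z_1,[Y,z_2],z_3)+l_5(X,z_1,z_2,[Y,z_3])\\&=[Y,l_5(X,z_1,z_2,z_3)]+l_5([X,y_1],y_2,z_1,z_2,z_3)+l_5(y_1,[X,y_2],z_1,z_2,z_3)+l_5(Y,[X,z_1],z_2,z_3)\\&\quad+l_5(Y,z_1,[X,z_2],z_3)+l_5(Y,z_1,z_2,[X,z_3])+l_5(X,Y,[z_1,z_2,z_3]).\end{aligned}$$ A morphism $\mathcal V\to\mathcal V'$ consists of a chain map $\phi_0:V_0\to V_0'$, $\phi_1:V_1\to V_1'$, a bilinear $\phi_2:V_0^2\to V_1'$ and a trilinear $\phi_3:V_0^3\to V_1'$ such that $\mathrm d'\phi_2(x,y)=\phi_0[x,y]-[\phi_0x,\phi_0y]'$, $\mathrm d'\phi_3(x,y,z)=\phi_0[x,y,z]-[\phi_0x,\phi_0y,\phi_0z]'$; if one argument of $\phi_2$ (resp. $\phi_3$),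 in any position, is $\mathrm du$, then $\phi_2$ (resp. $\phi_3$) equals the difference of the same form with $u$ in place of $\mathrm du$ and $\phi_1$ applied to $u$ and to the bracket containing $u$, e.g. $\phi_2(x,\mathrm du)=\phi_1[x,u]-[\phi_0x,\phi_1u]'$; and $$\begin{aligned}&[\phi_0x,\phi_2(y,z)]'+\phi_2(x,[y,z])+\phi_3(z,y,x)+\phi_1l_3(x,y,z)\\&=l_3'(\phi_0x,\phi_0y,\phi_0z)+[\phi_2(x,y),\phi_0z]'+[\phi_0y,\phi_2(x,z)]'+\phi_2([x,y],z)+\phi_2(y,[x,z])+\phi_3(x,y,z)+\phi_3(z,x,y),\end{aligned}$$ $$\begin{aligned}&[\phi_0x_1,\phi_0x_2,\phi_3(y_1,y_2,y_3)]'+\phi_3(X,[y_1,y_2,y_3])+\phi_1l_5(X,y_1,y_2,y_3)\\&=l_5'(\phi_0x_1,\phi_0x_2,\phi_0y_1,\phi_0y_2,\phi_0y_3)+[\phi_3(X,y_1),\phi_0y_2,\phi_0y_3]'+[\phi_0y_1,\phi_3(X,y_2),\phi_0y_3]'+[\phi_0y_1,\phi_0y_2,\phi_3(X,y_3)]'\\&\quad+\phi_3([X,y_1],y_2,y_3)+\phi_3(y_1,[X,y_2],y_3)+\phi_3(y_1,y_2,[X,y_3]).\end{aligned}$$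 The composite of $\phi$ followed by $\psi$ has components $\psi_0\phi_0$, $\psi_1\phi_1$, $\psi_2(\phi_0x,\phi_0y)+\psi_1\phi_2(x,y)$, $\psi_3(\phi_0x,\phi_0y,\phi_0z)+\psi_1\phi_3(x,y,z)$; identities have $\phi_2=0$, $\phi_3=0$. **Lie triple 2-algebras.** A 2-vector space is a category internal to vector spaces: vector spaces $L_0$ of objects and $L_1$ of morphisms, with linear source $s$, target $t$, identities and composition. Composition is written from left to right (first $f$, then $g$, in $fg$), and $1$ denotes an identity morphism on the appropriate object, which in brackets is written as that object. A Lie triple 2-algebra is a 2-vector space $L$ with a bilinear functor $[\cdot,\cdot]:L\times L\to L$ and a trilinear functor $[\cdot,\cdot,\cdot]:L\times L\times L\to L$, both skew-symmetric in the first two arguments (on objects and on morphisms), and multilinear natural isomorphisms $$\begin{aligned}J_{x_1,x_2,x_3}&:[x_1,[x_2,x_3]]+[x_3,x_2,x_1]\to[[x_1,x_2],x_3]+[x_2,[x_1,x_3]]+[x_1,x_2,x_3]+[x_3,x_1,x_2],\\\widehat J_{x_1,x_2,x_3,y}&:[x_1,[x_2,x_3],y]\to[[x_1,x_2],x_3,y]+[x_2,[x_1,x_3],y],\\\widetilde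 J_{X,y_1,y_2}&:[X,[y_1,y_2]]\to[[X,y_1],y_2]+[y_1,[X,y_2]],\\J_{X,y_1,y_2,y_3}&:[X,[y_1,y_2,y_3]]\to[[X,y_1],y_2,y_3]+[y_1,[X,y_2],y_3]+[y_1,y_2,[X,y_3]],\end{aligned}$$ satisfying (identity morphisms on remaining summands are collected in $1$) $$(J_1)\quad\begin{aligned}&[X,J_{y_1,y_2,y_3}]\,(\widetilde J_{X,[y_1,y_2],y_3}+\widetilde J_{X,y_2,[y_1,y_3]}+J_{X,y_1,y_2,y_3}+J_{X,y_3,y_1,y_2})\,([\widetilde J_{X,y_1,y_2},y_3]+[y_2,\widetilde J_{X,y_1,y_3}]+1)\\&=(\widetilde J_{X,y_1,[y_2,y_3]}+1)\,(1+[y_1,\widetilde J_{X,y_2,y_3}]+J_{X,y_3,y_2,y_1})\,(J_{[X,y_1],y_2,y_3}+J_{y_1,[X,y_2],y_3}+J_{y_1,y_2,[X,y_3]}),\end{aligned}$$ $$(J_2)\quad\begin{aligned}&[X,\widehat J_{y_1,y_2,y_3,z}]\,(J_{X,[y_1,y_2],y_3,z}+J_{X,y_2,[y_1,y_3],z})\,([\widetilde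 J_{X,y_1,y_2},y_3,z]+[y_2,\widetilde J_{X,y_1,y_3},z]+1)\\&=J_{X,y_1,[y_2,y_3],z}\,(\widehat J_{[X,y_1],y_2,y_3,z}+[y_1,\widetilde J_{X,y_2,y_3},z]+\widehat J_{y_1,y_2,y_3,[X,z]})\,(\widehat J_{y_1,[X,y_2],y_3,z}+\widehat J_{y_1,y_2,[X,y_3],z}+1),\end{aligned}$$ $$(J_3)\quad\begin{aligned}&[X,\widetilde J_{Y,z_1,z_2}]\,(\widetilde J_{X,[Y,z_1],z_2}+\widetilde J_{X,z_1,[Y,z_2]})\,([J_{X,Y,z_1},z_2]+[z_1,J_{X,Y,z_2}]+1)\\&=J_{X,Y,[z_1,z_2]}\,(1+[Y,\widetilde J_{X,z_1,z_2}])\,(\widetilde J_{[X,y_1],y_2,z_1,z_2}+\widetilde J_{y_1,[X,y_2],z_1,z_2}+\widetilde J_{Y,[X,z_1],z_2}+\widetilde J_{Y,z_1,[X,z_2]}),\end{aligned}$$ $$(J_4)\quad\begin{aligned}&[X,J_{Y,z_1,z_2,z_3}]\,(J_{X,[Y,z_1],z_2,z_3}+J_{X,z_1,[Y,z_2],z_3}+J_{X,z_1,z_2,[Y,z_3]})\\&\quad([J_{X,Y,z_1},z_2,z_3]+[z_1,J_{X,Y,z_2},z_3]+[z_1,z_2,J_{X,Y,z_3}]+1)\\&=J_{X,Y,[z_1,z_2,z_3]}\,(1+[Y,J_{X,z_1,z_2,z_3}])\,(J_{[X,y_1],y_2,z_1,z_2,z_3}+J_{y_1,[X,y_2],z_1,z_2,z_3}\\&\quad+J_{Y,[X,z_1],z_2,z_3}+J_{Y,z_1,[X,z_2],z_3}+J_{Y,z_1,z_2,[X,z_3]}).\end{aligned}$$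 A morphism $L\to L'$ consists of a linear functor $(F_0,F_1)$, a bilinear natural transformation $F_2(x,y):[F_0x,F_0y]'\to F_0[x,y]$ and a trilinear natural transformation $F_3(x,y,z):[F_0x,F_0y,F_0z]'\to F_0[x,y,z]$ with $$\begin{aligned}&([F_0x,F_2(y,z)]'+1)\,(F_2(x,[y,z])+F_3(z,y,x))\,F_1(J_{x,y,z})\\&=J'_{F_0x,F_0y,F_0z}\,([F_2(x,y),F_0z]'+[F_0y,F_2(x,z)]'+1)\,(F_2([x,y],z)+F_2(y,[x,z])+F_3(x,y,z)+F_3(z,x,y)),\end{aligned}$$ $$\begin{aligned}&[F_0x_1,F_0x_2,F_3(y_1,y_2,y_3)]'\,F_3(X,[y_1,y_2,y_3])\,F_1(J_{X,y_1,y_2,y_3})\\&=J'_{F_0x_1,F_0x_2,F_0y_1,F_0y_2,F_0y_3}\,([F_3(X,y_1),F_0y_2,F_0y_3]'+[F_0y_1,F_3(X,y_2),F_0y_3]'+[F_0y_1,F_0y_2,F_3(X,y_3)]')\\&\quad(F_3([X,y_1],y_2,y_3)+F_3(y_1,[X,y_2],y_3)+F_3(y_1,y_2,[X,y_3])).\end{aligned}$$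 The composite of $F$ followed by $G$ is the composite linear functor together with $G_2(F_0x,F_0y)\,G_1(F_2(x,y))$ and $G_3(F_0x,F_0y,F_0z)\,G_1(F_3(x,y,z))$; for the identity morphism $F_2$ and $F_3$ are identity transformations. -/

import Mathlib

open CategoryTheory

universe u v

noncomputable section

/-! ## 2-vector spaces -/

/-- A 2-vector space: a category internal to `K`-vector spaces. Composition is written in
diagrammatic order (first `f`, then `g`) and is a linear map on the space of composable pairs
`{(f, g) | t f = s g}`. -/
structure TwoVectorSpace (K : Type u) [Field K] where
  Obj : Type v
  Mor : Type v
  [objGroup : AddCommGroup Obj]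
  [objModule : Module K Obj]
  [morGroup : AddCommGroup Mor]
  [morModule : Module K Mor]
  /-- source -/
  s : Mor →ₗ[K] Obj
  /-- target -/
  t : Mor →ₗ[K] Obj
  /-- identity morphisms -/
  one : Obj →ₗ[K] Mor
  /-- composition -/
  comp : LinearMap.eqLocus (t ∘ₗ LinearMap.fst K Mor Mor) (s ∘ₗ LinearMap.snd K Mor Mor) →ₗ[K] Mor
  s_one : ∀ x, s (one x) = x
  t_one : ∀ x, t (one x) = x
  s_comp : ∀ (f g : Mor) (h : t f = s g), s (comp ⟨(f, g), h⟩) = s f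
  t_comp : ∀ (f g : Mor) (h : t f = s g), t (comp ⟨(f, g), h⟩) = t g
  one_comp : ∀ f : Mor, comp ⟨(one (s f), f), t_one (s f)⟩ = f
  comp_one : ∀ f : Mor, comp ⟨(f, one (t f)), (s_one (t f)).symm⟩ = f
  assoc : ∀ (f g k : Mor) (hfg : t f = s g) (hgk : t g = s k),
    comp ⟨(comp ⟨(f, g), hfg⟩, k), (t_comp f g hfg).trans hgk⟩ =
      comp ⟨(f, comp ⟨(g, k), hgk⟩), hfg.trans (s_comp g k hgk).symm⟩

attribute [instance] TwoVectorSpace.objGroup TwoVectorSpace.objModule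
  TwoVectorSpace.morGroup TwoVectorSpace.morModule

namespace TwoVectorSpace

variable {K : Type u} [Field K] (C : TwoVectorSpace.{u, v} K)

/-- The composite "first `f`, then `g`" of two composable morphisms. -/
def vcomp (f g : C.Mor) (h : C.t f = C.s g) : C.Mor := C.comp ⟨(f, g), h⟩

@[simp] theorem s_vcomp (f g : C.Mor) (h : C.t f = C.s g) : C.s (C.vcomp f g h) = C.s f :=
  C.s_comp f g h

@[simp] theorem t_vcomp (f g : C.Mor) (h : C.t f = C.s g) : C.t (C.vcomp f g h) = C.t g :=
  C.t_comp f g h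

/-- The square with sides `f₁, f₂` and `g₁, g₂` commutes: `f₁ f₂ = g₁ g₂`
(diagrammatic order; both sides are composable). -/
def CommSq (f₁ f₂ g₁ g₂ : C.Mor) : Prop :=
  ∃ (hf : C.t f₁ = C.s f₂) (hg : C.t g₁ = C.s g₂), C.vcomp f₁ f₂ hf = C.vcomp g₁ g₂ hg

/-- The hexagon with sides `f₁, f₂, f₃` and `g₁, g₂, g₃` commutes: `f₁ f₂ f₃ = g₁ g₂ g₃`
(diagrammatic order; both sides are composable). -/
def CommHex (f₁ f₂ f₃ g₁ g₂ g₃ : C.Mor) : Prop :=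
  ∃ (hf : C.t f₁ = C.s f₂) (hf' : C.t f₂ = C.s f₃) (hg : C.t g₁ = C.s g₂) (hg' : C.t g₂ = C.s g₃),
    C.vcomp (C.vcomp f₁ f₂ hf) f₃ ((C.t_vcomp f₁ f₂ hf).trans hf') =
      C.vcomp (C.vcomp g₁ g₂ hg) g₃ ((C.t_vcomp g₁ g₂ hg).trans hg')

attribute [simp] s_one t_one

theorem vcomp_eq (f g : C.Mor) (h : C.t f = C.s g) :
    C.vcomp f g h = f + g - C.one (C.t f) := by
  have h1 : (⟨(f, g), h⟩ : LinearMap.eqLocus (C.t ∘ₗ LinearMap.fst K C.Mor C.Mor)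
      (C.s ∘ₗ LinearMap.snd K C.Mor C.Mor)) =
      ⟨(f, C.one (C.t f)), (C.s_one (C.t f)).symm⟩ +
      (⟨(C.one (C.s g), g), C.t_one (C.s g)⟩ -
        ⟨(C.one (C.s g), C.one (C.t (C.one (C.s g)))), (C.s_one _).symm⟩) := by
    ext <;> simp [h]
  rw [vcomp, h1, map_add, map_sub, C.comp_one, C.one_comp, C.comp_one, h]
  abel

/-- Every morphism of a 2-vector space is invertible; in particular every natural transformation
with values in a 2-vector space is a natural isomorphism. -/
theorem exists_inverse (f : C.Mor) : ∃ (g : C.Mor) (h : C.t f = C.s g) (h' : C.t g = C.s f),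
    C.vcomp f g h = C.one (C.s f) ∧ C.vcomp g f h' = C.one (C.t f) := by
  refine ⟨C.one (C.s f) + C.one (C.t f) - f, by simp, by simp, ?_, ?_⟩
  · rw [vcomp_eq]; abel
  · rw [vcomp_eq]; simp

theorem commSq_iff (f₁ f₂ g₁ g₂ : C.Mor) : C.CommSq f₁ f₂ g₁ g₂ ↔
    C.t f₁ = C.s f₂ ∧ C.t g₁ = C.s g₂ ∧
      f₁ + f₂ - C.one (C.t f₁) = g₁ + g₂ - C.one (C.t g₁) := by
  simp only [CommSq, vcomp_eq, exists_prop]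

theorem commHex_iff (f₁ f₂ f₃ g₁ g₂ g₃ : C.Mor) : C.CommHex f₁ f₂ f₃ g₁ g₂ g₃ ↔
    C.t f₁ = C.s f₂ ∧ C.t f₂ = C.s f₃ ∧ C.t g₁ = C.s g₂ ∧ C.t g₂ = C.s g₃ ∧
      f₁ + f₂ + f₃ - C.one (C.t f₁) - C.one (C.t f₂) =
        g₁ + g₂ + g₃ - C.one (C.t g₁) - C.one (C.t g₂) := by
  constructor
  · rintro ⟨a, b, c, d, h⟩
    refine ⟨a, b, c, d, ?_⟩
    simp only [vcomp_eq, map_sub, map_add, t_one, a, c] at h ⊢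
    calc _ = _ := by abel
      _ = _ := h
      _ = _ := by abel
  · rintro ⟨a, b, c, d, h⟩
    refine ⟨a, b, c, d, ?_⟩
    simp only [vcomp_eq, map_sub, map_add, t_one, a, c] at h ⊢
    calc _ = _ := by abel
      _ = _ := h
      _ = _ := by abel

end TwoVectorSpace

/-- A linear functor between 2-vector spaces. -/
@[ext]
structure LinearFunctor {K : Type u} [Field K] (C D : TwoVectorSpace.{u, v} K) where
  F₀ : C.Obj →ₗ[K] D.Obj
  F₁ : C.Mor →ₗ[K] D.Mor
  s_F₁ : ∀ f, D.s (F₁ f) = F₀ (C.s f)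
  t_F₁ : ∀ f, D.t (F₁ f) = F₀ (C.t f)
  F₁_one : ∀ x, F₁ (C.one x) = D.one (F₀ x)
  F₁_comp : ∀ (f g : C.Mor) (h : C.t f = C.s g),
    F₁ (C.vcomp f g h) =
      D.vcomp (F₁ f) (F₁ g) ((t_F₁ f).trans ((congrArg F₀ h).trans (s_F₁ g).symm))

namespace LinearFunctor

variable {K : Type u} [Field K]

def id (C : TwoVectorSpace.{u, v} K) : LinearFunctor C C where
  F₀ := LinearMap.id
  F₁ := LinearMap.id
  s_F₁ _ := rfl
  t_F₁ _ := rfl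
  F₁_one _ := rfl
  F₁_comp _ _ _ := rfl

/-- The composite "first `F`, then `G`". -/
def comp {C D E : TwoVectorSpace.{u, v} K} (F : LinearFunctor C D) (G : LinearFunctor D E) :
    LinearFunctor C E where
  F₀ := G.F₀ ∘ₗ F.F₀
  F₁ := G.F₁ ∘ₗ F.F₁
  s_F₁ f := by simp [G.s_F₁, F.s_F₁]
  t_F₁ f := by simp [G.t_F₁, F.t_F₁]
  F₁_one x := by simp [G.F₁_one, F.F₁_one]
  F₁_comp f g h := by simp [G.F₁_comp, F.F₁_comp]

end LinearFunctor

/-- The category of 2-vector spaces and linear functors. -/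
instance twoVectorSpaceCategory (K : Type u) [Field K] : Category (TwoVectorSpace.{u, v} K) where
  Hom C D := LinearFunctor C D
  id C := LinearFunctor.id C
  comp F G := LinearFunctor.comp F G

/-! ## 2-vector spaces and 2-term complexes

A 2-term complex of vector spaces `d : V₁ → V₀` is an object of `Arrow (ModuleCat K)`, and a chain
map is a morphism there (a commutative square). -/

/-- The 2-vector space of a linear map `d : V₁ → V₀`: objects `V₀`, morphisms `V₀ ⊕ V₁`, with
`s (x, u) = x`, `t (x, u) = x + d u`, `1_x = (x, 0)` and `(x, u) (x + d u, w) = (x, u + w)`. -/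
def TwoVectorSpace.ofLinearMap {K : Type u} [Field K] {V₁ V₀ : Type v} [AddCommGroup V₁]
    [Module K V₁] [AddCommGroup V₀] [Module K V₀] (d : V₁ →ₗ[K] V₀) : TwoVectorSpace.{u, v} K where
  Obj := V₀
  Mor := V₀ × V₁
  s := LinearMap.fst K V₀ V₁
  t := LinearMap.fst K V₀ V₁ + d ∘ₗ LinearMap.snd K V₀ V₁
  one := LinearMap.inl K V₀ V₁
  comp := {
    toFun := fun p => (p.1.1.1, p.1.1.2 + p.1.2.2)
    map_add' := by
      intro p q
      ext
      · simp
      · simp only [Submodule.coe_add, Prod.snd_add, Prod.fst_add]; abel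
    map_smul' := by intro c p; ext <;> simp }
  s_one x := rfl
  t_one x := by simp
  s_comp f g h := rfl
  t_comp f g h := by
    have h' : f.1 + d f.2 = g.1 := h
    simp [← h', add_assoc]
  one_comp f := by ext <;> simp
  comp_one f := by ext <;> simp
  assoc f g k _ _ := by ext <;> simp [add_assoc]

/-- The functor from 2-term complexes to 2-vector spaces. -/
def twoVectorSpaceOfComplex (K : Type u) [Field K] :
    Arrow (ModuleCat.{v} K) ⥤ TwoVectorSpace.{u, v} K where
  obj V := TwoVectorSpace.ofLinearMap V.hom.hom
  map {V W} φ :=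
    { F₀ := φ.right.hom
      F₁ := LinearMap.prodMap φ.right.hom φ.left.hom
      s_F₁ := fun _ => rfl
      t_F₁ := by
        rintro ⟨x, m⟩
        have h := congrArg (fun g => g.hom m) φ.w
        simp only [ModuleCat.hom_comp, LinearMap.comp_apply] at h
        change φ.right.hom x + W.hom.hom (φ.left.hom m) = φ.right.hom (x + V.hom.hom m)
        rw [map_add]
        congr 1
      F₁_one := by
        intro x
        change (φ.right.hom x, φ.left.hom 0) = (φ.right.hom x, 0)
        rw [map_zero]
      F₁_comp := by
        intro f g h
        change (φ.right.hom f.1, φ.left.hom (f.2 + g.2)) =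
          (φ.right.hom f.1, φ.left.hom f.2 + φ.left.hom g.2)
        rw [map_add] }
  map_id V := rfl
  map_comp φ ψ := rfl

/-- The functor from 2-vector spaces to 2-term complexes, `L ↦ (t : ker s → L₀)`. -/
def complexOfTwoVectorSpace (K : Type u) [Field K] :
    TwoVectorSpace.{u, v} K ⥤ Arrow (ModuleCat.{v} K) where
  obj C := Arrow.mk (ModuleCat.ofHom (C.t ∘ₗ (LinearMap.ker C.s).subtype))
  map {C D} F := Arrow.homMk
    (ModuleCat.ofHom (F.F₁.restrict (p := LinearMap.ker C.s) (q := LinearMap.ker D.s) (by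
      intro f hf
      rw [LinearMap.mem_ker] at hf ⊢
      rw [F.s_F₁, hf, map_zero])))
    (ModuleCat.ofHom F.F₀) (by
      ext f
      exact F.t_F₁ f.1)
  map_id C := rfl
  map_comp F G := rfl

/-! ## Lie triple 2-algebras -/

/-- A bilinear functor `C × C → C` on a 2-vector space: a functor which is bilinear on objects and
on morphisms. -/
structure BilinearFunctor {K : Type u} [Field K] (C : TwoVectorSpace.{u, v} K) where
  obj : C.Obj →ₗ[K] C.Obj →ₗ[K] C.Obj
  mor : C.Mor →ₗ[K] C.Mor →ₗ[K] C.Mor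
  s_mor : ∀ f g, C.s (mor f g) = obj (C.s f) (C.s g)
  t_mor : ∀ f g, C.t (mor f g) = obj (C.t f) (C.t g)
  mor_one : ∀ x y, mor (C.one x) (C.one y) = C.one (obj x y)
  mor_comp : ∀ (f f' g g' : C.Mor) (hf : C.t f = C.s f') (hg : C.t g = C.s g'),
    mor (C.vcomp f f' hf) (C.vcomp g g' hg) =
      C.vcomp (mor f g) (mor f' g') (by rw [t_mor, s_mor, hf, hg])

/-- A trilinear functor `C × C × C → C` on a 2-vector space: a functor which is trilinear on
objects and on morphisms. -/
structure TrilinearFunctor {K : Type u} [Field K] (C : TwoVectorSpace.{u, v} K) where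
  obj : C.Obj →ₗ[K] C.Obj →ₗ[K] C.Obj →ₗ[K] C.Obj
  mor : C.Mor →ₗ[K] C.Mor →ₗ[K] C.Mor →ₗ[K] C.Mor
  s_mor : ∀ f g k, C.s (mor f g k) = obj (C.s f) (C.s g) (C.s k)
  t_mor : ∀ f g k, C.t (mor f g k) = obj (C.t f) (C.t g) (C.t k)
  mor_one : ∀ x y z, mor (C.one x) (C.one y) (C.one z) = C.one (obj x y z)
  mor_comp : ∀ (f f' g g' k k' : C.Mor) (hf : C.t f = C.s f') (hg : C.t g = C.s g')
    (hk : C.t k = C.s k'),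
    mor (C.vcomp f f' hf) (C.vcomp g g' hg) (C.vcomp k k' hk) =
      C.vcomp (mor f g k) (mor f' g' k') (by rw [t_mor, s_mor, hf, hg, hk])

/-- A 2-vector space with a skew-symmetric bilinear functor `[·,·]` and a trilinear functor
`[·,·,·]` that is skew-symmetric in its first two arguments. -/
structure BracketTwoVectorSpace (K : Type u) [Field K] extends TwoVectorSpace.{u, v} K where
  br : BilinearFunctor toTwoVectorSpace
  tr : TrilinearFunctor toTwoVectorSpace
  br_obj_skew : ∀ x y, br.obj x y = - br.obj y x
  br_mor_skew : ∀ f g, br.mor f g = - br.mor g f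
  tr_obj_skew : ∀ x y z, tr.obj x y z = - tr.obj y x z
  tr_mor_skew : ∀ f g k, tr.mor f g k = - tr.mor g f k

namespace BracketTwoVectorSpace

variable {K : Type u} [Field K] (L : BracketTwoVectorSpace.{u, v} K)

/-- `[x, y]` on objects -/
abbrev o₂ (x y : L.Obj) : L.Obj := L.br.obj x y
/-- `[x, y, z]` on objects -/
abbrev o₃ (x y z : L.Obj) : L.Obj := L.tr.obj x y z
/-- `[f, g]` on morphisms -/
abbrev m₂ (f g : L.Mor) : L.Mor := L.br.mor f g
/-- `[f, g, k]` on morphisms -/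
abbrev m₃ (f g k : L.Mor) : L.Mor := L.tr.mor f g k

section Types

/-- Maps assigning a morphism to three objects, trilinearly; similarly below. -/
abbrev Tri := L.Obj →ₗ[K] L.Obj →ₗ[K] L.Obj →ₗ[K] L.Mor
abbrev Quadri := L.Obj →ₗ[K] L.Obj →ₗ[K] L.Obj →ₗ[K] L.Obj →ₗ[K] L.Mor
abbrev Quinque := L.Obj →ₗ[K] L.Obj →ₗ[K] L.Obj →ₗ[K] L.Obj →ₗ[K] L.Obj →ₗ[K] L.Mor

end Types

/-- `J` is a natural transformation, with components
`J x₁ x₂ x₃ : [x₁,[x₂,x₃]] + [x₃,x₂,x₁] ⟶ [[x₁,x₂],x₃] + [x₂,[x₁,x₃]] + [x₁,x₂,x₃] + [x₃,x₁,x₂]`. -/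
structure IsNaturalJ₃ (J : L.Tri) : Prop where
  source : ∀ x₁ x₂ x₃, L.s (J x₁ x₂ x₃) = L.o₂ x₁ (L.o₂ x₂ x₃) + L.o₃ x₃ x₂ x₁
  target : ∀ x₁ x₂ x₃, L.t (J x₁ x₂ x₃) =
    L.o₂ (L.o₂ x₁ x₂) x₃ + L.o₂ x₂ (L.o₂ x₁ x₃) + L.o₃ x₁ x₂ x₃ + L.o₃ x₃ x₁ x₂
  natural : ∀ f₁ f₂ f₃ : L.Mor, L.CommSq
    (L.m₂ f₁ (L.m₂ f₂ f₃) + L.m₃ f₃ f₂ f₁)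
    (J (L.t f₁) (L.t f₂) (L.t f₃))
    (J (L.s f₁) (L.s f₂) (L.s f₃))
    (L.m₂ (L.m₂ f₁ f₂) f₃ + L.m₂ f₂ (L.m₂ f₁ f₃) + L.m₃ f₁ f₂ f₃ + L.m₃ f₃ f₁ f₂)

/-- `Ĵ` is a natural transformation, with components
`Ĵ x₁ x₂ x₃ y₁ : [x₁,[x₂,x₃],y₁] ⟶ [[x₁,x₂],x₃,y₁] + [x₂,[x₁,x₃],y₁]`. -/
structure IsNaturalJhat (J : L.Quadri) : Prop where
  source : ∀ x₁ x₂ x₃ y₁, L.s (J x₁ x₂ x₃ y₁) = L.o₃ x₁ (L.o₂ x₂ x₃) y₁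
  target : ∀ x₁ x₂ x₃ y₁, L.t (J x₁ x₂ x₃ y₁) =
    L.o₃ (L.o₂ x₁ x₂) x₃ y₁ + L.o₃ x₂ (L.o₂ x₁ x₃) y₁
  natural : ∀ f₁ f₂ f₃ g₁ : L.Mor, L.CommSq
    (L.m₃ f₁ (L.m₂ f₂ f₃) g₁)
    (J (L.t f₁) (L.t f₂) (L.t f₃) (L.t g₁))
    (J (L.s f₁) (L.s f₂) (L.s f₃) (L.s g₁))
    (L.m₃ (L.m₂ f₁ f₂) f₃ g₁ + L.m₃ f₂ (L.m₂ f₁ f₃) g₁)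

/-- `J̃` is a natural transformation, with components
`J̃ x₁ x₂ y₁ y₂ : [x₁,x₂,[y₁,y₂]] ⟶ [[x₁,x₂,y₁],y₂] + [y₁,[x₁,x₂,y₂]]`. -/
structure IsNaturalJtilde (J : L.Quadri) : Prop where
  source : ∀ x₁ x₂ y₁ y₂, L.s (J x₁ x₂ y₁ y₂) = L.o₃ x₁ x₂ (L.o₂ y₁ y₂)
  target : ∀ x₁ x₂ y₁ y₂, L.t (J x₁ x₂ y₁ y₂) =
    L.o₂ (L.o₃ x₁ x₂ y₁) y₂ + L.o₂ y₁ (L.o₃ x₁ x₂ y₂)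
  natural : ∀ f₁ f₂ g₁ g₂ : L.Mor, L.CommSq
    (L.m₃ f₁ f₂ (L.m₂ g₁ g₂))
    (J (L.t f₁) (L.t f₂) (L.t g₁) (L.t g₂))
    (J (L.s f₁) (L.s f₂) (L.s g₁) (L.s g₂))
    (L.m₂ (L.m₃ f₁ f₂ g₁) g₂ + L.m₂ g₁ (L.m₃ f₁ f₂ g₂))

/-- `J` is a natural transformation, with components
`J x₁ x₂ y₁ y₂ y₃ : [x₁,x₂,[y₁,y₂,y₃]] ⟶
  [[x₁,x₂,y₁],y₂,y₃] + [y₁,[x₁,x₂,y₂],y₃] + [y₁,y₂,[x₁,x₂,y₃]]`. -/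
structure IsNaturalJ₅ (J : L.Quinque) : Prop where
  source : ∀ x₁ x₂ y₁ y₂ y₃, L.s (J x₁ x₂ y₁ y₂ y₃) = L.o₃ x₁ x₂ (L.o₃ y₁ y₂ y₃)
  target : ∀ x₁ x₂ y₁ y₂ y₃, L.t (J x₁ x₂ y₁ y₂ y₃) =
    L.o₃ (L.o₃ x₁ x₂ y₁) y₂ y₃ + L.o₃ y₁ (L.o₃ x₁ x₂ y₂) y₃ + L.o₃ y₁ y₂ (L.o₃ x₁ x₂ y₃)
  natural : ∀ f₁ f₂ g₁ g₂ g₃ : L.Mor, L.CommSq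
    (L.m₃ f₁ f₂ (L.m₃ g₁ g₂ g₃))
    (J (L.t f₁) (L.t f₂) (L.t g₁) (L.t g₂) (L.t g₃))
    (J (L.s f₁) (L.s f₂) (L.s g₁) (L.s g₂) (L.s g₃))
    (L.m₃ (L.m₃ f₁ f₂ g₁) g₂ g₃ + L.m₃ g₁ (L.m₃ f₁ f₂ g₂) g₃ + L.m₃ g₁ g₂ (L.m₃ f₁ f₂ g₃))

variable (J₃ : L.Tri) (Jhat Jtilde : L.Quadri) (J₅ : L.Quinque)

/-- The first coherence law: two composites out of
`[x₁,x₂,[y₁,[y₂,y₃]]] + [x₁,x₂,[y₃,y₂,y₁]]` agree. -/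
def Coherence₁ : Prop := ∀ x₁ x₂ y₁ y₂ y₃ : L.Obj, L.CommHex
  (L.m₃ (L.one x₁) (L.one x₂) (J₃ y₁ y₂ y₃))
  (Jtilde x₁ x₂ (L.o₂ y₁ y₂) y₃ + Jtilde x₁ x₂ y₂ (L.o₂ y₁ y₃)
    + J₅ x₁ x₂ y₁ y₂ y₃ + J₅ x₁ x₂ y₃ y₁ y₂)
  (L.m₂ (Jtilde x₁ x₂ y₁ y₂) (L.one y₃)
    + L.one (L.o₂ (L.o₂ y₁ y₂) (L.o₃ x₁ x₂ y₃))
    + L.one (L.o₂ (L.o₃ x₁ x₂ y₂) (L.o₂ y₁ y₃))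
    + L.m₂ (L.one y₂) (Jtilde x₁ x₂ y₁ y₃)
    + L.one (L.o₃ (L.o₃ x₁ x₂ y₁) y₂ y₃ + L.o₃ y₁ (L.o₃ x₁ x₂ y₂) y₃
      + L.o₃ y₁ y₂ (L.o₃ x₁ x₂ y₃))
    + L.one (L.o₃ (L.o₃ x₁ x₂ y₃) y₁ y₂ + L.o₃ y₃ (L.o₃ x₁ x₂ y₁) y₂
      + L.o₃ y₃ y₁ (L.o₃ x₁ x₂ y₂)))
  (Jtilde x₁ x₂ y₁ (L.o₂ y₂ y₃) + L.one (L.o₃ x₁ x₂ (L.o₃ y₃ y₂ y₁)))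
  (L.one (L.o₂ (L.o₃ x₁ x₂ y₁) (L.o₂ y₂ y₃)) + L.m₂ (L.one y₁) (Jtilde x₁ x₂ y₂ y₃)
    + J₅ x₁ x₂ y₃ y₂ y₁)
  (J₃ (L.o₃ x₁ x₂ y₁) y₂ y₃ + J₃ y₁ (L.o₃ x₁ x₂ y₂) y₃ + J₃ y₁ y₂ (L.o₃ x₁ x₂ y₃))

/-- The second coherence law: two composites out of `[x₁,x₂,[y₁,[y₂,y₃],z]]` agree. -/
def Coherence₂ : Prop := ∀ x₁ x₂ y₁ y₂ y₃ z : L.Obj, L.CommHex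
  (L.m₃ (L.one x₁) (L.one x₂) (Jhat y₁ y₂ y₃ z))
  (J₅ x₁ x₂ (L.o₂ y₁ y₂) y₃ z + J₅ x₁ x₂ y₂ (L.o₂ y₁ y₃) z)
  (L.m₃ (Jtilde x₁ x₂ y₁ y₂) (L.one y₃) (L.one z)
    + L.one (L.o₃ (L.o₂ y₁ y₂) (L.o₃ x₁ x₂ y₃) z)
    + L.one (L.o₃ (L.o₂ y₁ y₂) y₃ (L.o₃ x₁ x₂ z))
    + L.one (L.o₃ (L.o₃ x₁ x₂ y₂) (L.o₂ y₁ y₃) z)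
    + L.m₃ (L.one y₂) (Jtilde x₁ x₂ y₁ y₃) (L.one z)
    + L.one (L.o₃ y₂ (L.o₂ y₁ y₃) (L.o₃ x₁ x₂ z)))
  (J₅ x₁ x₂ y₁ (L.o₂ y₂ y₃) z)
  (Jhat (L.o₃ x₁ x₂ y₁) y₂ y₃ z + L.m₃ (L.one y₁) (Jtilde x₁ x₂ y₂ y₃) (L.one z)
    + Jhat y₁ y₂ y₃ (L.o₃ x₁ x₂ z))
  (L.one (L.o₃ (L.o₂ (L.o₃ x₁ x₂ y₁) y₂) y₃ z)
    + L.one (L.o₃ y₂ (L.o₂ (L.o₃ x₁ x₂ y₁) y₃) z)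
    + Jhat y₁ (L.o₃ x₁ x₂ y₂) y₃ z + Jhat y₁ y₂ (L.o₃ x₁ x₂ y₃) z
    + L.one (L.o₃ (L.o₂ y₁ y₂) y₃ (L.o₃ x₁ x₂ z))
    + L.one (L.o₃ y₂ (L.o₂ y₁ y₃) (L.o₃ x₁ x₂ z)))

/-- The third coherence law: two composites out of `[x₁,x₂,[y₁,y₂,[z₁,z₂]]]` agree. -/
def Coherence₃ : Prop := ∀ x₁ x₂ y₁ y₂ z₁ z₂ : L.Obj, L.CommHex
  (L.m₃ (L.one x₁) (L.one x₂) (Jtilde y₁ y₂ z₁ z₂))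
  (Jtilde x₁ x₂ (L.o₃ y₁ y₂ z₁) z₂ + Jtilde x₁ x₂ z₁ (L.o₃ y₁ y₂ z₂))
  (L.m₂ (J₅ x₁ x₂ y₁ y₂ z₁) (L.one z₂)
    + L.one (L.o₂ (L.o₃ y₁ y₂ z₁) (L.o₃ x₁ x₂ z₂))
    + L.one (L.o₂ (L.o₃ x₁ x₂ z₁) (L.o₃ y₁ y₂ z₂))
    + L.m₂ (L.one z₁) (J₅ x₁ x₂ y₁ y₂ z₂))
  (J₅ x₁ x₂ y₁ y₂ (L.o₂ z₁ z₂))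
  (L.one (L.o₃ (L.o₃ x₁ x₂ y₁) y₂ (L.o₂ z₁ z₂))
    + L.one (L.o₃ y₁ (L.o₃ x₁ x₂ y₂) (L.o₂ z₁ z₂))
    + L.m₃ (L.one y₁) (L.one y₂) (Jtilde x₁ x₂ z₁ z₂))
  (Jtilde (L.o₃ x₁ x₂ y₁) y₂ z₁ z₂ + Jtilde y₁ (L.o₃ x₁ x₂ y₂) z₁ z₂
    + Jtilde y₁ y₂ (L.o₃ x₁ x₂ z₁) z₂ + Jtilde y₁ y₂ z₁ (L.o₃ x₁ x₂ z₂))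

/-- The fourth coherence law: two composites out of `[x₁,x₂,[y₁,y₂,[z₁,z₂,z₃]]]` agree. -/
def Coherence₄ : Prop := ∀ x₁ x₂ y₁ y₂ z₁ z₂ z₃ : L.Obj, L.CommHex
  (L.m₃ (L.one x₁) (L.one x₂) (J₅ y₁ y₂ z₁ z₂ z₃))
  (J₅ x₁ x₂ (L.o₃ y₁ y₂ z₁) z₂ z₃ + J₅ x₁ x₂ z₁ (L.o₃ y₁ y₂ z₂) z₃
    + J₅ x₁ x₂ z₁ z₂ (L.o₃ y₁ y₂ z₃))
  (L.m₃ (J₅ x₁ x₂ y₁ y₂ z₁) (L.one z₂) (L.one z₃)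
    + L.one (L.o₃ (L.o₃ y₁ y₂ z₁) (L.o₃ x₁ x₂ z₂) z₃)
    + L.one (L.o₃ (L.o₃ y₁ y₂ z₁) z₂ (L.o₃ x₁ x₂ z₃))
    + L.one (L.o₃ (L.o₃ x₁ x₂ z₁) (L.o₃ y₁ y₂ z₂) z₃)
    + L.m₃ (L.one z₁) (J₅ x₁ x₂ y₁ y₂ z₂) (L.one z₃)
    + L.one (L.o₃ z₁ (L.o₃ y₁ y₂ z₂) (L.o₃ x₁ x₂ z₃))
    + L.one (L.o₃ (L.o₃ x₁ x₂ z₁) z₂ (L.o₃ y₁ y₂ z₃))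
    + L.one (L.o₃ z₁ (L.o₃ x₁ x₂ z₂) (L.o₃ y₁ y₂ z₃))
    + L.m₃ (L.one z₁) (L.one z₂) (J₅ x₁ x₂ y₁ y₂ z₃))
  (J₅ x₁ x₂ y₁ y₂ (L.o₃ z₁ z₂ z₃))
  (L.one (L.o₃ (L.o₃ x₁ x₂ y₁) y₂ (L.o₃ z₁ z₂ z₃))
    + L.one (L.o₃ y₁ (L.o₃ x₁ x₂ y₂) (L.o₃ z₁ z₂ z₃))
    + L.m₃ (L.one y₁) (L.one y₂) (J₅ x₁ x₂ z₁ z₂ z₃))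
  (J₅ (L.o₃ x₁ x₂ y₁) y₂ z₁ z₂ z₃ + J₅ y₁ (L.o₃ x₁ x₂ y₂) z₁ z₂ z₃
    + J₅ y₁ y₂ (L.o₃ x₁ x₂ z₁) z₂ z₃ + J₅ y₁ y₂ z₁ (L.o₃ x₁ x₂ z₂) z₃
    + J₅ y₁ y₂ z₁ z₂ (L.o₃ x₁ x₂ z₃))

end BracketTwoVectorSpace

/-- A Lie triple 2-algebra. The natural transformations `J₃, Jhat, Jtilde, J₅` are automatically
isomorphisms (`TwoVectorSpace.exists_inverse`). -/
structure LieTriple2Algebra (K : Type u) [Field K] extends BracketTwoVectorSpace.{u, v} K where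
  J₃ : toBracketTwoVectorSpace.Tri
  Jhat : toBracketTwoVectorSpace.Quadri
  Jtilde : toBracketTwoVectorSpace.Quadri
  J₅ : toBracketTwoVectorSpace.Quinque
  isNatural_J₃ : toBracketTwoVectorSpace.IsNaturalJ₃ J₃
  isNatural_Jhat : toBracketTwoVectorSpace.IsNaturalJhat Jhat
  isNatural_Jtilde : toBracketTwoVectorSpace.IsNaturalJtilde Jtilde
  isNatural_J₅ : toBracketTwoVectorSpace.IsNaturalJ₅ J₅
  coherence₁ : toBracketTwoVectorSpace.Coherence₁ J₃ Jtilde J₅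
  coherence₂ : toBracketTwoVectorSpace.Coherence₂ Jhat Jtilde J₅
  coherence₃ : toBracketTwoVectorSpace.Coherence₃ Jtilde J₅
  coherence₄ : toBracketTwoVectorSpace.Coherence₄ J₅

/-- A homomorphism of Lie triple 2-algebras: a linear functor `(F₀, F₁)` with a bilinear natural
transformation `F₂ x y : [F₀ x, F₀ y] ⟶ F₀ [x, y]` and a trilinear natural transformation
`F₃ x y z : [F₀ x, F₀ y, F₀ z] ⟶ F₀ [x, y, z]`, compatible with `J₃` and `J₅`. -/
@[ext]
structure LieTriple2Hom {K : Type u} [Field K] (L M : LieTriple2Algebra.{u, v} K) extends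
    LinearFunctor L.toTwoVectorSpace M.toTwoVectorSpace where
  F₂ : L.Obj →ₗ[K] L.Obj →ₗ[K] M.Mor
  F₃ : L.Obj →ₗ[K] L.Obj →ₗ[K] L.Obj →ₗ[K] M.Mor
  s_F₂ : ∀ x y, M.s (F₂ x y) = M.o₂ (F₀ x) (F₀ y)
  t_F₂ : ∀ x y, M.t (F₂ x y) = F₀ (L.o₂ x y)
  natural_F₂ : ∀ f g : L.Mor, M.CommSq
    (M.m₂ (F₁ f) (F₁ g)) (F₂ (L.t f) (L.t g))
    (F₂ (L.s f) (L.s g)) (F₁ (L.m₂ f g))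
  s_F₃ : ∀ x y z, M.s (F₃ x y z) = M.o₃ (F₀ x) (F₀ y) (F₀ z)
  t_F₃ : ∀ x y z, M.t (F₃ x y z) = F₀ (L.o₃ x y z)
  natural_F₃ : ∀ f g k : L.Mor, M.CommSq
    (M.m₃ (F₁ f) (F₁ g) (F₁ k)) (F₃ (L.t f) (L.t g) (L.t k))
    (F₃ (L.s f) (L.s g) (L.s k)) (F₁ (L.m₃ f g k))
  /-- the two composites `[F₀x,[F₀y,F₀z]] + [F₀z,F₀y,F₀x] ⟶
  F₀([[x,y],z] + [y,[x,z]] + [x,y,z] + [z,x,y])` agree -/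
  compat_J₃ : ∀ x y z, M.CommHex
    (M.m₂ (M.one (F₀ x)) (F₂ y z) + M.one (M.o₃ (F₀ z) (F₀ y) (F₀ x)))
    (F₂ x (L.o₂ y z) + F₃ z y x)
    (F₁ (L.J₃ x y z))
    (M.J₃ (F₀ x) (F₀ y) (F₀ z))
    (M.m₂ (F₂ x y) (M.one (F₀ z)) + M.m₂ (M.one (F₀ y)) (F₂ x z)
      + M.one (M.o₃ (F₀ x) (F₀ y) (F₀ z)) + M.one (M.o₃ (F₀ z) (F₀ x) (F₀ y)))
    (F₂ (L.o₂ x y) z + F₂ y (L.o₂ x z) + F₃ x y z + F₃ z x y)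
  /-- the two composites `[F₀x₁,F₀x₂,[F₀y₁,F₀y₂,F₀y₃]] ⟶
  F₀([[x₁,x₂,y₁],y₂,y₃] + [y₁,[x₁,x₂,y₂],y₃] + [y₁,y₂,[x₁,x₂,y₃]])` agree -/
  compat_J₅ : ∀ x₁ x₂ y₁ y₂ y₃, M.CommHex
    (M.m₃ (M.one (F₀ x₁)) (M.one (F₀ x₂)) (F₃ y₁ y₂ y₃))
    (F₃ x₁ x₂ (L.o₃ y₁ y₂ y₃))
    (F₁ (L.J₅ x₁ x₂ y₁ y₂ y₃))
    (M.J₅ (F₀ x₁) (F₀ x₂) (F₀ y₁) (F₀ y₂) (F₀ y₃))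
    (M.m₃ (F₃ x₁ x₂ y₁) (M.one (F₀ y₂)) (M.one (F₀ y₃))
      + M.m₃ (M.one (F₀ y₁)) (F₃ x₁ x₂ y₂) (M.one (F₀ y₃))
      + M.m₃ (M.one (F₀ y₁)) (M.one (F₀ y₂)) (F₃ x₁ x₂ y₃))
    (F₃ (L.o₃ x₁ x₂ y₁) y₂ y₃ + F₃ y₁ (L.o₃ x₁ x₂ y₂) y₃ + F₃ y₁ y₂ (L.o₃ x₁ x₂ y₃))

namespace LieTriple2Hom

variable {K : Type u} [Field K]

/-- The identity homomorphism; `F₂` and `F₃` are identity transformations. -/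
def id (L : LieTriple2Algebra.{u, v} K) : LieTriple2Hom L L where
  toLinearFunctor := LinearFunctor.id L.toTwoVectorSpace
  F₂ := L.br.obj.compr₂ L.one
  F₃ := (LinearMap.compRight K (LinearMap.compRight K L.one)) ∘ₗ L.tr.obj
  s_F₂ _ _ := L.s_one _
  t_F₂ _ _ := L.t_one _
  natural_F₂ f g := by
    rw [TwoVectorSpace.commSq_iff]
    simp [LinearFunctor.id, L.br.s_mor, L.br.t_mor]
  s_F₃ _ _ _ := L.s_one _
  t_F₃ _ _ _ := L.t_one _
  natural_F₃ f g k := by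
    rw [TwoVectorSpace.commSq_iff]
    simp [LinearFunctor.id, L.tr.s_mor, L.tr.t_mor]
  compat_J₃ x y z := by
    rw [TwoVectorSpace.commHex_iff]
    simp [LinearFunctor.id, L.br.mor_one, L.isNatural_J₃.source, L.isNatural_J₃.target]
    abel
  compat_J₅ x₁ x₂ y₁ y₂ y₃ := by
    rw [TwoVectorSpace.commHex_iff]
    simp [LinearFunctor.id, L.tr.mor_one, L.isNatural_J₅.source, L.isNatural_J₅.target]
    abel

variable {L M N : LieTriple2Algebra.{u, v} K}

set_option linter.unusedSimpArgs false in
set_option maxHeartbeats 1600000 in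
/-- The composite "first `F`, then `G`": its `F₂` is the vertical composite
`[G₀F₀x, G₀F₀y] ⟶ G₀[F₀x, F₀y] ⟶ G₀F₀[x, y]` of `G₂ (F₀ x) (F₀ y)` and `G₁ (F₂ x y)`, and similarly
for `F₃`. -/
def comp (F : LieTriple2Hom L M) (G : LieTriple2Hom M N) : LieTriple2Hom L N where
  toLinearFunctor := LinearFunctor.comp F.toLinearFunctor G.toLinearFunctor
  F₂ := LinearMap.mk₂ K
    (fun x y => N.vcomp (G.F₂ (F.F₀ x) (F.F₀ y)) (G.F₁ (F.F₂ x y))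
      (by rw [G.t_F₂, G.s_F₁, F.s_F₂]))
    (by intros; simp only [TwoVectorSpace.vcomp_eq, map_add, LinearMap.add_apply]; abel)
    (by
      intros
      simp only [TwoVectorSpace.vcomp_eq, map_smul, LinearMap.smul_apply, smul_add, smul_sub])
    (by intros; simp only [TwoVectorSpace.vcomp_eq, map_add]; abel)
    (by intros; simp only [TwoVectorSpace.vcomp_eq, map_smul, smul_add, smul_sub])
  F₃ :=
    { toFun := fun x => LinearMap.mk₂ K
        (fun y z => N.vcomp (G.F₃ (F.F₀ x) (F.F₀ y) (F.F₀ z)) (G.F₁ (F.F₃ x y z))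
          (by rw [G.t_F₃, G.s_F₁, F.s_F₃]))
        (by intros; simp only [TwoVectorSpace.vcomp_eq, map_add, LinearMap.add_apply]; abel)
        (by
          intros
          simp only [TwoVectorSpace.vcomp_eq, map_smul, LinearMap.smul_apply, smul_add, smul_sub])
        (by intros; simp only [TwoVectorSpace.vcomp_eq, map_add]; abel)
        (by intros; simp only [TwoVectorSpace.vcomp_eq, map_smul, smul_add, smul_sub])
      map_add' := by
        intros; ext
        simp only [TwoVectorSpace.vcomp_eq, map_add, LinearMap.add_apply, LinearMap.mk₂_apply]
        abel
      map_smul' := by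
        intros; ext
        simp only [TwoVectorSpace.vcomp_eq, map_smul, LinearMap.smul_apply, LinearMap.mk₂_apply,
          smul_add, smul_sub, RingHom.id_apply] }
  s_F₂ x y := by simp [G.s_F₂, LinearFunctor.comp]
  t_F₂ x y := by simp [G.t_F₁, F.t_F₂, LinearFunctor.comp]
  natural_F₂ f g := by
    have h := F.natural_F₂ f g
    have h' := G.natural_F₂ (F.F₁ f) (F.F₁ g)
    rw [TwoVectorSpace.commSq_iff] at h h' ⊢
    obtain ⟨h1, h2, h3⟩ := h
    obtain ⟨h1', h2', h3'⟩ := h'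
    have h3 := congrArg G.F₁ h3
    simp only [BracketTwoVectorSpace.o₂, BracketTwoVectorSpace.o₃,
      BracketTwoVectorSpace.m₂, BracketTwoVectorSpace.m₃, LinearFunctor.comp,
      LinearMap.mk₂_apply, LinearMap.comp_apply,
      TwoVectorSpace.s_vcomp, TwoVectorSpace.t_vcomp, TwoVectorSpace.vcomp_eq, map_add, map_sub,
      N.br.t_mor, M.br.t_mor, L.br.t_mor, N.br.s_mor, M.br.s_mor, L.br.s_mor, F.s_F₁, F.t_F₁,
      G.s_F₁, G.t_F₁, G.F₁_one, F.s_F₂, F.t_F₂, G.s_F₂, G.t_F₂, N.t_one, N.s_one] at h3 h3' ⊢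
    refine ⟨by abel, by abel, ?_⟩
    linear_combination (norm := abel) h3 + h3'
  s_F₃ x y z := by simp [G.s_F₃, LinearFunctor.comp]
  t_F₃ x y z := by simp [G.t_F₁, F.t_F₃, LinearFunctor.comp]
  natural_F₃ f g k := by
    have h := F.natural_F₃ f g k
    have h' := G.natural_F₃ (F.F₁ f) (F.F₁ g) (F.F₁ k)
    rw [TwoVectorSpace.commSq_iff] at h h' ⊢
    obtain ⟨h1, h2, h3⟩ := h
    obtain ⟨h1', h2', h3'⟩ := h'
    have h3 := congrArg G.F₁ h3
    simp only [BracketTwoVectorSpace.o₂, BracketTwoVectorSpace.o₃,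
      BracketTwoVectorSpace.m₂, BracketTwoVectorSpace.m₃, LinearFunctor.comp,
      LinearMap.mk₂_apply, LinearMap.comp_apply, LinearMap.coe_mk,
      AddHom.coe_mk,
      TwoVectorSpace.s_vcomp, TwoVectorSpace.t_vcomp, TwoVectorSpace.vcomp_eq, map_add, map_sub,
      N.tr.t_mor, M.tr.t_mor, L.tr.t_mor, N.tr.s_mor, M.tr.s_mor, L.tr.s_mor, F.s_F₁, F.t_F₁,
      G.s_F₁, G.t_F₁, G.F₁_one, F.s_F₃, F.t_F₃, G.s_F₃, G.t_F₃, N.t_one, N.s_one] at h3 h3' ⊢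
    refine ⟨by abel, by abel, ?_⟩
    linear_combination (norm := abel) h3 + h3'
  compat_J₃ x y z := by
    have h := F.compat_J₃ x y z
    have h' := G.compat_J₃ (F.F₀ x) (F.F₀ y) (F.F₀ z)
    have e1 := G.natural_F₂ (M.one (F.F₀ x)) (F.F₂ y z)
    have e2 := G.natural_F₂ (F.F₂ x y) (M.one (F.F₀ z))
    have e3 := G.natural_F₂ (M.one (F.F₀ y)) (F.F₂ x z)
    rw [TwoVectorSpace.commHex_iff] at h h' ⊢
    rw [TwoVectorSpace.commSq_iff] at e1 e2 e3
    replace h := congrArg G.F₁ h.2.2.2.2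
    replace h' := h'.2.2.2.2
    replace e1 := e1.2.2
    replace e2 := e2.2.2
    replace e3 := e3.2.2
    simp only [BracketTwoVectorSpace.o₂, BracketTwoVectorSpace.o₃,
      BracketTwoVectorSpace.m₂, BracketTwoVectorSpace.m₃, LinearFunctor.comp,
      LinearMap.mk₂_apply, LinearMap.comp_apply, LinearMap.coe_mk,
      AddHom.coe_mk, TwoVectorSpace.s_vcomp, TwoVectorSpace.t_vcomp, TwoVectorSpace.vcomp_eq,
      map_add, map_sub, LinearMap.add_apply, LinearMap.sub_apply, N.br.mor_one, M.br.mor_one,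
      N.br.t_mor, M.br.t_mor, N.br.s_mor, M.br.s_mor, F.s_F₁, F.t_F₁,
      G.s_F₁, G.t_F₁, G.F₁_one, F.s_F₂, F.t_F₂, G.s_F₂, G.t_F₂, N.t_one, N.s_one, M.t_one,
      M.s_one, F.s_F₃, F.t_F₃, G.s_F₃, G.t_F₃, L.isNatural_J₃.source, L.isNatural_J₃.target,
      M.isNatural_J₃.source, M.isNatural_J₃.target,
      N.isNatural_J₃.source, N.isNatural_J₃.target] at h h' e1 e2 e3 ⊢
    refine ⟨by abel, by abel, by abel, by abel, ?_⟩
    linear_combination (norm := abel) h + h' + e1 - e2 - e3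
  compat_J₅ x₁ x₂ y₁ y₂ y₃ := by
    have h := F.compat_J₅ x₁ x₂ y₁ y₂ y₃
    have h' := G.compat_J₅ (F.F₀ x₁) (F.F₀ x₂) (F.F₀ y₁) (F.F₀ y₂) (F.F₀ y₃)
    have e1 := G.natural_F₃ (M.one (F.F₀ x₁)) (M.one (F.F₀ x₂)) (F.F₃ y₁ y₂ y₃)
    have e2 := G.natural_F₃ (F.F₃ x₁ x₂ y₁) (M.one (F.F₀ y₂)) (M.one (F.F₀ y₃))
    have e3 := G.natural_F₃ (M.one (F.F₀ y₁)) (F.F₃ x₁ x₂ y₂) (M.one (F.F₀ y₃))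
    have e4 := G.natural_F₃ (M.one (F.F₀ y₁)) (M.one (F.F₀ y₂)) (F.F₃ x₁ x₂ y₃)
    rw [TwoVectorSpace.commHex_iff] at h h' ⊢
    rw [TwoVectorSpace.commSq_iff] at e1 e2 e3 e4
    replace h := congrArg G.F₁ h.2.2.2.2
    replace h' := h'.2.2.2.2
    replace e1 := e1.2.2
    replace e2 := e2.2.2
    replace e3 := e3.2.2
    replace e4 := e4.2.2
    simp only [BracketTwoVectorSpace.o₂, BracketTwoVectorSpace.o₃,
      BracketTwoVectorSpace.m₂, BracketTwoVectorSpace.m₃, LinearFunctor.comp,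
      LinearMap.mk₂_apply, LinearMap.comp_apply, LinearMap.coe_mk,
      AddHom.coe_mk, TwoVectorSpace.s_vcomp, TwoVectorSpace.t_vcomp, TwoVectorSpace.vcomp_eq,
      map_add, map_sub, LinearMap.add_apply, LinearMap.sub_apply, N.tr.mor_one, M.tr.mor_one,
      N.tr.t_mor, M.tr.t_mor, N.tr.s_mor, M.tr.s_mor, F.s_F₁, F.t_F₁,
      G.s_F₁, G.t_F₁, G.F₁_one, N.t_one, N.s_one, M.t_one,
      M.s_one, F.s_F₃, F.t_F₃, G.s_F₃, G.t_F₃, L.isNatural_J₅.source, L.isNatural_J₅.target,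
      M.isNatural_J₅.source, M.isNatural_J₅.target,
      N.isNatural_J₅.source, N.isNatural_J₅.target] at h h' e1 e2 e3 e4 ⊢
    refine ⟨by abel, by abel, by abel, by abel, ?_⟩
    linear_combination (norm := abel) h + h' + e1 - e2 - e3 - e4

end LieTriple2Hom

/-- The category of Lie triple 2-algebras. -/
instance lieTriple2AlgebraCategory (K : Type u) [Field K] :
    Category (LieTriple2Algebra.{u, v} K) where
  Hom L M := LieTriple2Hom L M
  id L := LieTriple2Hom.id L
  comp F G := LieTriple2Hom.comp F G
  id_comp {L M} F := by
    apply LieTriple2Hom.ext <;> (try rfl) <;> ext <;>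
      simp [LieTriple2Hom.comp, LieTriple2Hom.id, LinearFunctor.id, TwoVectorSpace.vcomp_eq,
        F.t_F₂, F.t_F₃, F.F₁_one]
  comp_id {L M} F := by
    apply LieTriple2Hom.ext <;> (try rfl) <;> ext <;>
      simp [LieTriple2Hom.comp, LieTriple2Hom.id, LinearFunctor.id, TwoVectorSpace.vcomp_eq]
  assoc {L M N P} F G H := by
    apply LieTriple2Hom.ext <;> (try rfl) <;> ext <;>
      simp [LieTriple2Hom.comp, LinearFunctor.comp, TwoVectorSpace.vcomp_eq, G.t_F₂, G.t_F₃,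
        H.t_F₁, H.F₁_one] <;> abel

/-- The underlying 2-vector space of a Lie triple 2-algebra. -/
def LieTriple2Algebra.toTwoVect (K : Type u) [Field K] :
    LieTriple2Algebra.{u, v} K ⥤ TwoVectorSpace.{u, v} K where
  obj L := L.toTwoVectorSpace
  map F := F.toLinearFunctor
  map_id _ := rfl
  map_comp _ _ := rfl

/-! ## 2-term L∞-triple algebras -/

/-- A 2-term L∞-triple algebra. The subscript of `b₁, b₂, c₁, c₂, c₃` is the position of the
argument from `V₁`: `b x y`, `b₁ u x`, `b₂ x u` are the brackets `[x, y]`, `[u, x]`, `[x, u]`, and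
`c x y z`, `c₁ u x y`, `c₂ x u y`, `c₃ x y u` are the brackets
`[x, y, z]`, `[u, x, y]`, `[x, u, y]`, `[x, y, u]`. Brackets with more than one argument from `V₁`
are zero (they would take values in degree at least two). Each of `l₃, lhat, ltilde, l₅` is a
homotopy in all of its arguments. -/
structure TwoTermLInfTriple (K : Type u) [Field K] where
  V₀ : Type v
  V₁ : Type v
  [group₀ : AddCommGroup V₀]
  [module₀ : Module K V₀]
  [group₁ : AddCommGroup V₁]
  [module₁ : Module K V₁]
  d : V₁ →ₗ[K] V₀
  b : V₀ →ₗ[K] V₀ →ₗ[K] V₀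
  b₁ : V₁ →ₗ[K] V₀ →ₗ[K] V₁
  b₂ : V₀ →ₗ[K] V₁ →ₗ[K] V₁
  c : V₀ →ₗ[K] V₀ →ₗ[K] V₀ →ₗ[K] V₀
  c₁ : V₁ →ₗ[K] V₀ →ₗ[K] V₀ →ₗ[K] V₁
  c₂ : V₀ →ₗ[K] V₁ →ₗ[K] V₀ →ₗ[K] V₁
  c₃ : V₀ →ₗ[K] V₀ →ₗ[K] V₁ →ₗ[K] V₁
  l₃ : V₀ →ₗ[K] V₀ →ₗ[K] V₀ →ₗ[K] V₁
  lhat : V₀ →ₗ[K] V₀ →ₗ[K] V₀ →ₗ[K] V₀ →ₗ[K] V₁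
  ltilde : V₀ →ₗ[K] V₀ →ₗ[K] V₀ →ₗ[K] V₀ →ₗ[K] V₁
  l₅ : V₀ →ₗ[K] V₀ →ₗ[K] V₀ →ₗ[K] V₀ →ₗ[K] V₀ →ₗ[K] V₁
  -- skew-symmetry
  b_skew : ∀ x y, b x y = - b y x
  b₂_skew : ∀ x u, b₂ x u = - b₁ u x
  c_skew : ∀ x y z, c x y z = - c y x z
  c₃_skew : ∀ x y u, c₃ x y u = - c₃ y x u
  c₁_skew : ∀ u x y, c₁ u x y = - c₂ x u y
  -- compatibility of the brackets with the differential
  d_b₂ : ∀ x u, d (b₂ x u) = b x (d u)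
  b_d : ∀ u w, b₂ (d u) w = b₁ u (d w)
  d_c₃ : ∀ x y u, d (c₃ x y u) = c x y (d u)
  d_c₁ : ∀ u x y, d (c₁ u x y) = c (d u) x y
  c_d₁₂ : ∀ u w x, c₂ (d u) w x = c₁ u (d w) x
  c_d₂₃ : ∀ x u w, c₃ x (d u) w = c₂ x u (d w)
  -- the homotopy `l₃`
  d_l₃ : ∀ x₁ x₂ x₃, d (l₃ x₁ x₂ x₃) =
    b (b x₁ x₂) x₃ + b (b x₂ x₃) x₁ + b (b x₃ x₁) x₂ + c x₁ x₂ x₃ + c x₂ x₃ x₁ + c x₃ x₁ x₂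
  l₃_d₁ : ∀ u x₂ x₃, l₃ (d u) x₂ x₃ =
    b₁ (b₁ u x₂) x₃ + b₂ (b x₂ x₃) u + b₁ (b₂ x₃ u) x₂ + c₁ u x₂ x₃ + c₃ x₂ x₃ u + c₂ x₃ u x₂
  l₃_d₂ : ∀ x₁ u x₃, l₃ x₁ (d u) x₃ =
    b₁ (b₂ x₁ u) x₃ + b₁ (b₁ u x₃) x₁ + b₂ (b x₃ x₁) u + c₂ x₁ u x₃ + c₁ u x₃ x₁ + c₃ x₃ x₁ u
  l₃_d₃ : ∀ x₁ x₂ u, l₃ x₁ x₂ (d u) =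
    b₂ (b x₁ x₂) u + b₁ (b₂ x₂ u) x₁ + b₁ (b₁ u x₁) x₂ + c₃ x₁ x₂ u + c₂ x₂ u x₁ + c₁ u x₁ x₂
  -- the homotopy `lhat`
  d_lhat : ∀ x₁ x₂ x₃ y, d (lhat x₁ x₂ x₃ y) =
    c (b x₁ x₂) x₃ y + c (b x₂ x₃) x₁ y + c (b x₃ x₁) x₂ y
  lhat_d₁ : ∀ u x₂ x₃ y, lhat (d u) x₂ x₃ y =
    c₁ (b₁ u x₂) x₃ y + c₂ (b x₂ x₃) u y + c₁ (b₂ x₃ u) x₂ y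
  lhat_d₂ : ∀ x₁ u x₃ y, lhat x₁ (d u) x₃ y =
    c₁ (b₂ x₁ u) x₃ y + c₁ (b₁ u x₃) x₁ y + c₂ (b x₃ x₁) u y
  lhat_d₃ : ∀ x₁ x₂ u y, lhat x₁ x₂ (d u) y =
    c₂ (b x₁ x₂) u y + c₁ (b₂ x₂ u) x₁ y + c₁ (b₁ u x₁) x₂ y
  lhat_d₄ : ∀ x₁ x₂ x₃ u, lhat x₁ x₂ x₃ (d u) =
    c₃ (b x₁ x₂) x₃ u + c₃ (b x₂ x₃) x₁ u + c₃ (b x₃ x₁) x₂ u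
  -- the homotopy `ltilde`
  d_ltilde : ∀ x₁ x₂ y₁ y₂, d (ltilde x₁ x₂ y₁ y₂) =
    - c x₁ x₂ (b y₁ y₂) + b (c x₁ x₂ y₁) y₂ + b y₁ (c x₁ x₂ y₂)
  ltilde_d₁ : ∀ u x₂ y₁ y₂, ltilde (d u) x₂ y₁ y₂ =
    - c₁ u x₂ (b y₁ y₂) + b₁ (c₁ u x₂ y₁) y₂ + b₂ y₁ (c₁ u x₂ y₂)
  ltilde_d₂ : ∀ x₁ u y₁ y₂, ltilde x₁ (d u) y₁ y₂ =
    - c₂ x₁ u (b y₁ y₂) + b₁ (c₂ x₁ u y₁) y₂ + b₂ y₁ (c₂ x₁ u y₂)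
  ltilde_d₃ : ∀ x₁ x₂ u y₂, ltilde x₁ x₂ (d u) y₂ =
    - c₃ x₁ x₂ (b₁ u y₂) + b₁ (c₃ x₁ x₂ u) y₂ + b₁ u (c x₁ x₂ y₂)
  ltilde_d₄ : ∀ x₁ x₂ y₁ u, ltilde x₁ x₂ y₁ (d u) =
    - c₃ x₁ x₂ (b₂ y₁ u) + b₂ (c x₁ x₂ y₁) u + b₂ y₁ (c₃ x₁ x₂ u)
  -- the homotopy `l₅`
  d_l₅ : ∀ x₁ x₂ y₁ y₂ y₃, d (l₅ x₁ x₂ y₁ y₂ y₃) =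
    - c x₁ x₂ (c y₁ y₂ y₃) + c (c x₁ x₂ y₁) y₂ y₃ + c y₁ (c x₁ x₂ y₂) y₃ + c y₁ y₂ (c x₁ x₂ y₃)
  l₅_d₁ : ∀ u x₂ y₁ y₂ y₃, l₅ (d u) x₂ y₁ y₂ y₃ =
    - c₁ u x₂ (c y₁ y₂ y₃) + c₁ (c₁ u x₂ y₁) y₂ y₃ + c₂ y₁ (c₁ u x₂ y₂) y₃
      + c₃ y₁ y₂ (c₁ u x₂ y₃)
  l₅_d₂ : ∀ x₁ u y₁ y₂ y₃, l₅ x₁ (d u) y₁ y₂ y₃ =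
    - c₂ x₁ u (c y₁ y₂ y₃) + c₁ (c₂ x₁ u y₁) y₂ y₃ + c₂ y₁ (c₂ x₁ u y₂) y₃
      + c₃ y₁ y₂ (c₂ x₁ u y₃)
  l₅_d₃ : ∀ x₁ x₂ u y₂ y₃, l₅ x₁ x₂ (d u) y₂ y₃ =
    - c₃ x₁ x₂ (c₁ u y₂ y₃) + c₁ (c₃ x₁ x₂ u) y₂ y₃ + c₁ u (c x₁ x₂ y₂) y₃
      + c₁ u y₂ (c x₁ x₂ y₃)
  l₅_d₄ : ∀ x₁ x₂ y₁ u y₃, l₅ x₁ x₂ y₁ (d u) y₃ =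
    - c₃ x₁ x₂ (c₂ y₁ u y₃) + c₂ (c x₁ x₂ y₁) u y₃ + c₂ y₁ (c₃ x₁ x₂ u) y₃
      + c₂ y₁ u (c x₁ x₂ y₃)
  l₅_d₅ : ∀ x₁ x₂ y₁ y₂ u, l₅ x₁ x₂ y₁ y₂ (d u) =
    - c₃ x₁ x₂ (c₃ y₁ y₂ u) + c₃ (c x₁ x₂ y₁) y₂ u + c₃ y₁ (c x₁ x₂ y₂) u
      + c₃ y₁ y₂ (c₃ x₁ x₂ u)
  -- the four coherence identities
  coherence₁ : ∀ x₁ x₂ y₁ y₂ y₃,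
    c₃ x₁ x₂ (l₃ y₁ y₂ y₃) + ltilde x₁ x₂ (b y₁ y₂) y₃ + ltilde x₁ x₂ y₂ (b y₁ y₃)
      + b₁ (ltilde x₁ x₂ y₁ y₂) y₃ + b₂ y₂ (ltilde x₁ x₂ y₁ y₃)
      + l₅ x₁ x₂ y₁ y₂ y₃ + l₅ x₁ x₂ y₃ y₁ y₂ =
    ltilde x₁ x₂ y₁ (b y₂ y₃) + b₂ y₁ (ltilde x₁ x₂ y₂ y₃)
      + l₃ (c x₁ x₂ y₁) y₂ y₃ + l₃ y₁ (c x₁ x₂ y₂) y₃ + l₃ y₁ y₂ (c x₁ x₂ y₃)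
      + l₅ x₁ x₂ y₃ y₂ y₁
  coherence₂ : ∀ x₁ x₂ y₁ y₂ y₃ z,
    c₃ x₁ x₂ (lhat y₁ y₂ y₃ z) + l₅ x₁ x₂ (b y₁ y₂) y₃ z + l₅ x₁ x₂ y₂ (b y₁ y₃) z
      + c₁ (ltilde x₁ x₂ y₁ y₂) y₃ z + c₂ y₂ (ltilde x₁ x₂ y₁ y₃) z =
    l₅ x₁ x₂ y₁ (b y₂ y₃) z + lhat (c x₁ x₂ y₁) y₂ y₃ z + c₂ y₁ (ltilde x₁ x₂ y₂ y₃) z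
      + lhat y₁ y₂ y₃ (c x₁ x₂ z) + lhat y₁ (c x₁ x₂ y₂) y₃ z + lhat y₁ y₂ (c x₁ x₂ y₃) z
  coherence₃ : ∀ x₁ x₂ y₁ y₂ z₁ z₂,
    c₃ x₁ x₂ (ltilde y₁ y₂ z₁ z₂) + ltilde x₁ x₂ (c y₁ y₂ z₁) z₂ + ltilde x₁ x₂ z₁ (c y₁ y₂ z₂)
      + b₁ (l₅ x₁ x₂ y₁ y₂ z₁) z₂ + b₂ z₁ (l₅ x₁ x₂ y₁ y₂ z₂) =
    l₅ x₁ x₂ y₁ y₂ (b z₁ z₂) + c₃ y₁ y₂ (ltilde x₁ x₂ z₁ z₂)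
      + ltilde (c x₁ x₂ y₁) y₂ z₁ z₂ + ltilde y₁ (c x₁ x₂ y₂) z₁ z₂
      + ltilde y₁ y₂ (c x₁ x₂ z₁) z₂ + ltilde y₁ y₂ z₁ (c x₁ x₂ z₂)
  coherence₄ : ∀ x₁ x₂ y₁ y₂ z₁ z₂ z₃,
    c₁ (l₅ x₁ x₂ y₁ y₂ z₁) z₂ z₃ + c₂ z₁ (l₅ x₁ x₂ y₁ y₂ z₂) z₃
      + c₃ x₁ x₂ (l₅ y₁ y₂ z₁ z₂ z₃) + c₃ z₁ z₂ (l₅ x₁ x₂ y₁ y₂ z₃)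
      + l₅ x₁ x₂ (c y₁ y₂ z₁) z₂ z₃ + l₅ x₁ x₂ z₁ (c y₁ y₂ z₂) z₃
      + l₅ x₁ x₂ z₁ z₂ (c y₁ y₂ z₃) =
    c₃ y₁ y₂ (l₅ x₁ x₂ z₁ z₂ z₃) + l₅ (c x₁ x₂ y₁) y₂ z₁ z₂ z₃ + l₅ y₁ (c x₁ x₂ y₂) z₁ z₂ z₃
      + l₅ y₁ y₂ (c x₁ x₂ z₁) z₂ z₃ + l₅ y₁ y₂ z₁ (c x₁ x₂ z₂) z₃
      + l₅ x₁ x₂ y₁ y₂ (c z₁ z₂ z₃) + l₅ y₁ y₂ z₁ z₂ (c x₁ x₂ z₃)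

attribute [instance] TwoTermLInfTriple.group₀ TwoTermLInfTriple.module₀
  TwoTermLInfTriple.group₁ TwoTermLInfTriple.module₁

/-- A homomorphism of 2-term L∞-triple algebras. -/
@[ext]
structure TwoTermHom {K : Type u} [Field K] (V W : TwoTermLInfTriple.{u, v} K) where
  φ₀ : V.V₀ →ₗ[K] W.V₀
  φ₁ : V.V₁ →ₗ[K] W.V₁
  φ₂ : V.V₀ →ₗ[K] V.V₀ →ₗ[K] W.V₁
  φ₃ : V.V₀ →ₗ[K] V.V₀ →ₗ[K] V.V₀ →ₗ[K] W.V₁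
  φ_d : ∀ u, φ₀ (V.d u) = W.d (φ₁ u)
  d_φ₂ : ∀ x y, W.d (φ₂ x y) = φ₀ (V.b x y) - W.b (φ₀ x) (φ₀ y)
  φ₂_d₁ : ∀ u x, φ₂ (V.d u) x = φ₁ (V.b₁ u x) - W.b₁ (φ₁ u) (φ₀ x)
  φ₂_d₂ : ∀ x u, φ₂ x (V.d u) = φ₁ (V.b₂ x u) - W.b₂ (φ₀ x) (φ₁ u)
  d_φ₃ : ∀ x y z, W.d (φ₃ x y z) = φ₀ (V.c x y z) - W.c (φ₀ x) (φ₀ y) (φ₀ z)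
  φ₃_d₁ : ∀ u x y, φ₃ (V.d u) x y = φ₁ (V.c₁ u x y) - W.c₁ (φ₁ u) (φ₀ x) (φ₀ y)
  φ₃_d₂ : ∀ x u y, φ₃ x (V.d u) y = φ₁ (V.c₂ x u y) - W.c₂ (φ₀ x) (φ₁ u) (φ₀ y)
  φ₃_d₃ : ∀ x y u, φ₃ x y (V.d u) = φ₁ (V.c₃ x y u) - W.c₃ (φ₀ x) (φ₀ y) (φ₁ u)
  compat_l₃ : ∀ x y z,
    W.b₂ (φ₀ x) (φ₂ y z) + φ₂ x (V.b y z) + φ₃ z y x + φ₁ (V.l₃ x y z) =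
    W.l₃ (φ₀ x) (φ₀ y) (φ₀ z) + W.b₁ (φ₂ x y) (φ₀ z) + W.b₂ (φ₀ y) (φ₂ x z)
      + φ₂ (V.b x y) z + φ₂ y (V.b x z) + φ₃ x y z + φ₃ z x y
  compat_l₅ : ∀ x₁ x₂ y₁ y₂ y₃,
    W.c₃ (φ₀ x₁) (φ₀ x₂) (φ₃ y₁ y₂ y₃) + φ₃ x₁ x₂ (V.c y₁ y₂ y₃) + φ₁ (V.l₅ x₁ x₂ y₁ y₂ y₃) =
    W.l₅ (φ₀ x₁) (φ₀ x₂) (φ₀ y₁) (φ₀ y₂) (φ₀ y₃)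
      + W.c₁ (φ₃ x₁ x₂ y₁) (φ₀ y₂) (φ₀ y₃) + W.c₂ (φ₀ y₁) (φ₃ x₁ x₂ y₂) (φ₀ y₃)
      + W.c₃ (φ₀ y₁) (φ₀ y₂) (φ₃ x₁ x₂ y₃)
      + φ₃ (V.c x₁ x₂ y₁) y₂ y₃ + φ₃ y₁ (V.c x₁ x₂ y₂) y₃ + φ₃ y₁ y₂ (V.c x₁ x₂ y₃)

namespace TwoTermHom

variable {K : Type u} [Field K]

/-- The identity homomorphism. -/
def id (V : TwoTermLInfTriple.{u, v} K) : TwoTermHom V V where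
  φ₀ := LinearMap.id
  φ₁ := LinearMap.id
  φ₂ := 0
  φ₃ := 0
  φ_d := by simp
  d_φ₂ := by simp
  φ₂_d₁ := by simp
  φ₂_d₂ := by simp
  d_φ₃ := by simp
  φ₃_d₁ := by simp
  φ₃_d₂ := by simp
  φ₃_d₃ := by simp
  compat_l₃ := by simp
  compat_l₅ := by simp

/-- The composite "first `φ`, then `ψ`", with
`(ψφ)₂ x y = ψ₂ (φ₀ x) (φ₀ y) + ψ₁ (φ₂ x y)` and
`(ψφ)₃ x y z = ψ₃ (φ₀ x) (φ₀ y) (φ₀ z) + ψ₁ (φ₃ x y z)`. -/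
def comp {U V W : TwoTermLInfTriple.{u, v} K} (φ : TwoTermHom U V) (ψ : TwoTermHom V W) :
    TwoTermHom U W where
  φ₀ := ψ.φ₀ ∘ₗ φ.φ₀
  φ₁ := ψ.φ₁ ∘ₗ φ.φ₁
  φ₂ := LinearMap.mk₂ K (fun x y => ψ.φ₂ (φ.φ₀ x) (φ.φ₀ y) + ψ.φ₁ (φ.φ₂ x y))
    (by intros; simp only [map_add, LinearMap.add_apply]; abel)
    (by intros; simp only [map_smul, LinearMap.smul_apply, smul_add])
    (by intros; simp only [map_add]; abel)
    (by intros; simp only [map_smul, smul_add])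
  φ₃ :=
    { toFun := fun x => LinearMap.mk₂ K
        (fun y z => ψ.φ₃ (φ.φ₀ x) (φ.φ₀ y) (φ.φ₀ z) + ψ.φ₁ (φ.φ₃ x y z))
        (by intros; simp only [map_add, LinearMap.add_apply]; abel)
        (by intros; simp only [map_smul, LinearMap.smul_apply, smul_add])
        (by intros; simp only [map_add]; abel)
        (by intros; simp only [map_smul, smul_add])
      map_add' := by
        intros; ext; simp only [map_add, LinearMap.add_apply, LinearMap.mk₂_apply]; abel
      map_smul' := by
        intros; ext
        simp only [map_smul, LinearMap.smul_apply, LinearMap.mk₂_apply, smul_add,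
          RingHom.id_apply] }
  φ_d u := by simp [φ.φ_d, ψ.φ_d]
  d_φ₂ x y := by simp [φ.d_φ₂, ψ.d_φ₂, ← ψ.φ_d]
  φ₂_d₁ u x := by simp [φ.φ_d, φ.φ₂_d₁, ψ.φ₂_d₁]
  φ₂_d₂ u x := by simp [φ.φ_d, φ.φ₂_d₂, ψ.φ₂_d₂]
  d_φ₃ x y z := by simp [φ.d_φ₃, ψ.d_φ₃, ← ψ.φ_d]
  φ₃_d₁ u x y := by simp [φ.φ_d, φ.φ₃_d₁, ψ.φ₃_d₁]
  φ₃_d₂ u x y := by simp [φ.φ_d, φ.φ₃_d₂, ψ.φ₃_d₂]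
  φ₃_d₃ u x y := by simp [φ.φ_d, φ.φ₃_d₃, ψ.φ₃_d₃]
  compat_l₃ x y z := by
    have h := congrArg ψ.φ₁ (φ.compat_l₃ x y z)
    have h' := ψ.compat_l₃ (φ.φ₀ x) (φ.φ₀ y) (φ.φ₀ z)
    have e1 := ψ.φ₂_d₂ (φ.φ₀ x) (φ.φ₂ y z)
    have e2 := ψ.φ₂_d₁ (φ.φ₂ x y) (φ.φ₀ z)
    have e3 := ψ.φ₂_d₂ (φ.φ₀ y) (φ.φ₂ x z)
    simp only [φ.d_φ₂, map_sub, LinearMap.sub_apply] at e1 e2 e3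
    simp only [map_add, LinearMap.mk₂_apply, LinearMap.coe_mk, AddHom.coe_mk,
      LinearMap.comp_apply, LinearMap.add_apply] at h ⊢
    linear_combination (norm := abel) h + h' + e1 - e2 - e3
  compat_l₅ x₁ x₂ y₁ y₂ y₃ := by
    have h := congrArg ψ.φ₁ (φ.compat_l₅ x₁ x₂ y₁ y₂ y₃)
    have h' := ψ.compat_l₅ (φ.φ₀ x₁) (φ.φ₀ x₂) (φ.φ₀ y₁) (φ.φ₀ y₂) (φ.φ₀ y₃)
    have e1 := ψ.φ₃_d₃ (φ.φ₀ x₁) (φ.φ₀ x₂) (φ.φ₃ y₁ y₂ y₃)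
    have e2 := ψ.φ₃_d₁ (φ.φ₃ x₁ x₂ y₁) (φ.φ₀ y₂) (φ.φ₀ y₃)
    have e3 := ψ.φ₃_d₂ (φ.φ₀ y₁) (φ.φ₃ x₁ x₂ y₂) (φ.φ₀ y₃)
    have e4 := ψ.φ₃_d₃ (φ.φ₀ y₁) (φ.φ₀ y₂) (φ.φ₃ x₁ x₂ y₃)
    simp only [φ.d_φ₃, map_sub, LinearMap.sub_apply] at e1 e2 e3 e4
    simp only [map_add, LinearMap.mk₂_apply, LinearMap.coe_mk, AddHom.coe_mk,
      LinearMap.comp_apply, LinearMap.add_apply] at h ⊢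
    linear_combination (norm := abel) h + h' + e1 - e2 - e3 - e4

end TwoTermHom

/-- The category of 2-term L∞-triple algebras. -/
instance twoTermLInfTripleCategory (K : Type u) [Field K] :
    Category (TwoTermLInfTriple.{u, v} K) where
  Hom V W := TwoTermHom V W
  id V := TwoTermHom.id V
  comp φ ψ := TwoTermHom.comp φ ψ
  id_comp φ := by
    apply TwoTermHom.ext <;> (try rfl) <;> ext <;> simp [TwoTermHom.comp, TwoTermHom.id]
  comp_id φ := by
    apply TwoTermHom.ext <;> (try rfl) <;> ext <;> simp [TwoTermHom.comp, TwoTermHom.id]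
  assoc φ ψ χ := by
    apply TwoTermHom.ext <;> (try rfl) <;> ext <;> simp [TwoTermHom.comp, add_assoc]

/-- The underlying 2-term complex of a 2-term L∞-triple algebra. -/
def TwoTermLInfTriple.toComplex (K : Type u) [Field K] :
    TwoTermLInfTriple.{u, v} K ⥤ Arrow (ModuleCat.{v} K) where
  obj V := Arrow.mk (ModuleCat.ofHom V.d)
  map φ := Arrow.homMk (ModuleCat.ofHom φ.φ₁) (ModuleCat.ofHom φ.φ₀) (by
    ext m
    exact (φ.φ_d m).symm)
  map_id _ := rfl
  map_comp _ _ := rfl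

end

/-! A morphism `f` of a 2-vector space splits as `f = 1_{s f} + arr f` with `arr f` in `ker s`.
Linearity of composition forces `f g = f + g - 1_{t f}`, so a 2-vector space carries no more
information than the complex `t : ker s → L₀`. Composition becomes addition of arrow parts, and a
commuting square or hexagon becomes composability, equality of sources and one linear equation in
`ker s` (`commSq_iff_arr`, `commHex_iff_arr`).

The interchange law says that a bracket with one argument in `ker s` sees only the targets of the
others (`br_mor_of_s_left`, `tr_mor_of_s₁` and their variants). Hence a bracket functor is
determined by its values on objects and on tuples with one arrow and identities elsewhere. What
remains of functoriality is compatibility with `d` and relations such as `[du, w] = [u, dw]`.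

A multilinear transformation with prescribed source is its arrow part `l`. Its target is right
exactly when `d l` is target minus source, which skew-symmetry turns into `E`. Its naturality is
multilinear, so it can be tested with one argument in `ker s` and identities elsewhere, and there it
is the homotopy condition on `l(…, du, …)`. Taking arrow parts turns each coherence law, and each
compatibility of a homomorphism, into the corresponding identity on the other side. The lemmas
`isNaturalJ₃_iff`, `coherence₁_iff`, `natural₂_iff`, `compatJ₃_iff` and their companions carry out
this translation in both directions.

So putting the `l`'s and the `φ`'s into arrow parts gives a functor that is fully faithful. It is
essentially surjective because `L` is strictly isomorphic, by `(x, w) ↦ 1_x + w`, to the algebra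
built from `t : ker s → L₀`. -/

noncomputable section

set_option linter.unusedSimpArgs false

/-! ### Splitting a morphism into an identity and an arrow part. -/

namespace TwoVectorSpace

variable {K : Type u} [Field K] (C : TwoVectorSpace.{u, v} K)

/-- The part of a morphism in the kernel of the source map. -/
def arr : C.Mor →ₗ[K] C.Mor := LinearMap.id - C.one ∘ₗ C.s

theorem arr_apply (f : C.Mor) : C.arr f = f - C.one (C.s f) := rfl

theorem eq_one_add_arr (f : C.Mor) : f = C.one (C.s f) + C.arr f := by simp [arr_apply]

@[simp] theorem s_arr (f : C.Mor) : C.s (C.arr f) = 0 := by simp [arr_apply]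

@[simp] theorem t_arr (f : C.Mor) : C.t (C.arr f) = C.t f - C.s f := by simp [arr_apply]

@[simp] theorem arr_one (x : C.Obj) : C.arr (C.one x) = 0 := by simp [arr_apply]

theorem arr_of_s_eq_zero {f : C.Mor} (h : C.s f = 0) : C.arr f = f := by simp [arr_apply, h]

/-- Identities and `ker s` together span the morphisms, so a property additive in `f` can be checked
on these two kinds. -/
theorem mor_induction {p : C.Mor → Prop} (f : C.Mor) (one : ∀ x, p (C.one x))
    (ker : ∀ w, C.s w = 0 → p w) (add : ∀ f g, p f → p g → p (f + g)) : p f := by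
  rw [C.eq_one_add_arr f]
  exact add _ _ (one _) (ker _ (C.s_arr f))

theorem mor_ext {f g : C.Mor} (h : C.s f = C.s g) (h' : C.arr f = C.arr g) : f = g := by
  rw [C.eq_one_add_arr f, C.eq_one_add_arr g, h, h']

/-- By `vcomp_eq` the arrow part of a composite is the sum of the arrow parts, and a morphism is
determined by its source and its arrow part. -/
theorem commSq_iff_arr (f₁ f₂ g₁ g₂ : C.Mor) : C.CommSq f₁ f₂ g₁ g₂ ↔
    C.t f₁ = C.s f₂ ∧ C.t g₁ = C.s g₂ ∧ C.s f₁ = C.s g₁ ∧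
      C.arr f₁ + C.arr f₂ = C.arr g₁ + C.arr g₂ := by
  rw [commSq_iff]
  refine and_congr_right fun h₁ => and_congr_right fun h₂ => ⟨fun h => ?_, fun ⟨h, h'⟩ => ?_⟩
  · have hs : C.s f₁ = C.s g₁ := by simpa [h₁, h₂] using congrArg C.s h
    refine ⟨hs, ?_⟩
    simp only [arr_apply, ← h₁, ← h₂, hs]
    linear_combination (norm := abel) h
  · simp only [arr_apply, ← h₁, ← h₂, h] at h'
    linear_combination (norm := abel) h'

theorem CommSq.arr_eq {C : TwoVectorSpace.{u, v} K} {f₁ f₂ g₁ g₂ : C.Mor}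
    (h : C.CommSq f₁ f₂ g₁ g₂) : C.arr f₁ + C.arr f₂ = C.arr g₁ + C.arr g₂ :=
  ((C.commSq_iff_arr _ _ _ _).1 h).2.2.2

theorem commHex_iff_arr (f₁ f₂ f₃ g₁ g₂ g₃ : C.Mor) : C.CommHex f₁ f₂ f₃ g₁ g₂ g₃ ↔
    C.t f₁ = C.s f₂ ∧ C.t f₂ = C.s f₃ ∧ C.t g₁ = C.s g₂ ∧ C.t g₂ = C.s g₃ ∧ C.s f₁ = C.s g₁ ∧
      C.arr f₁ + C.arr f₂ + C.arr f₃ = C.arr g₁ + C.arr g₂ + C.arr g₃ := by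
  rw [commHex_iff]
  refine and_congr_right fun h₁ => and_congr_right fun h₂ => and_congr_right fun h₃ =>
    and_congr_right fun h₄ => ⟨fun h => ?_, fun ⟨h, h'⟩ => ?_⟩
  · have hs : C.s f₁ = C.s g₁ := by
      have e := congrArg C.s h
      simp only [map_add, map_sub, s_one, h₁, h₂, h₃, h₄] at e
      linear_combination (norm := abel) e
    refine ⟨hs, ?_⟩
    simp only [arr_apply, ← h₁, ← h₂, ← h₃, ← h₄, hs]
    linear_combination (norm := abel) h
  · simp only [arr_apply, ← h₁, ← h₂, ← h₃, ← h₄, h] at h'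
    linear_combination (norm := abel) h'

end TwoVectorSpace

/-! ### Brackets of one arrow with identities, and the interchange law. -/

namespace BracketTwoVectorSpace

variable {K : Type u} [Field K] (L : BracketTwoVectorSpace.{u, v} K)

/-- `[f, 1_x]` -/
def b₁ : L.Mor →ₗ[K] L.Obj →ₗ[K] L.Mor := L.br.mor.compl₂ L.one
/-- `[1_x, f]` -/
def b₂ : L.Obj →ₗ[K] L.Mor →ₗ[K] L.Mor := L.br.mor ∘ₗ L.one
/-- `[f, 1_x, 1_y]` -/
def c₁ : L.Mor →ₗ[K] L.Obj →ₗ[K] L.Obj →ₗ[K] L.Mor :=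
  (L.tr.mor.compl₂ L.one).compr₂ (LinearMap.lcomp K L.Mor L.one)
/-- `[1_x, f, 1_y]` -/
def c₂ : L.Obj →ₗ[K] L.Mor →ₗ[K] L.Obj →ₗ[K] L.Mor :=
  (L.tr.mor ∘ₗ L.one).compr₂ (LinearMap.lcomp K L.Mor L.one)
/-- `[1_x, 1_y, f]` -/
def c₃ : L.Obj →ₗ[K] L.Obj →ₗ[K] L.Mor →ₗ[K] L.Mor := (L.tr.mor.compl₂ L.one) ∘ₗ L.one

theorem b₁_apply (f : L.Mor) (x : L.Obj) : L.b₁ f x = L.br.mor f (L.one x) := rfl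
theorem b₂_apply (x : L.Obj) (f : L.Mor) : L.b₂ x f = L.br.mor (L.one x) f := rfl
theorem c₁_apply (f : L.Mor) (x y : L.Obj) :
    L.c₁ f x y = L.tr.mor f (L.one x) (L.one y) := rfl
theorem c₂_apply (x : L.Obj) (f : L.Mor) (y : L.Obj) :
    L.c₂ x f y = L.tr.mor (L.one x) f (L.one y) := rfl
theorem c₃_apply (x y : L.Obj) (f : L.Mor) :
    L.c₃ x y f = L.tr.mor (L.one x) (L.one y) f := rfl

@[simp] theorem s_b₁ (f x) : L.s (L.b₁ f x) = L.br.obj (L.s f) x := by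
  simp [b₁_apply, L.br.s_mor]
@[simp] theorem s_b₂ (x f) : L.s (L.b₂ x f) = L.br.obj x (L.s f) := by
  simp [b₂_apply, L.br.s_mor]
@[simp] theorem s_c₁ (f x y) : L.s (L.c₁ f x y) = L.tr.obj (L.s f) x y := by
  simp [c₁_apply, L.tr.s_mor]
@[simp] theorem s_c₂ (x f y) : L.s (L.c₂ x f y) = L.tr.obj x (L.s f) y := by
  simp [c₂_apply, L.tr.s_mor]
@[simp] theorem s_c₃ (x y f) : L.s (L.c₃ x y f) = L.tr.obj x y (L.s f) := by
  simp [c₃_apply, L.tr.s_mor]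
@[simp] theorem t_b₁ (f x) : L.t (L.b₁ f x) = L.br.obj (L.t f) x := by
  simp [b₁_apply, L.br.t_mor]
@[simp] theorem t_b₂ (x f) : L.t (L.b₂ x f) = L.br.obj x (L.t f) := by
  simp [b₂_apply, L.br.t_mor]
@[simp] theorem t_c₁ (f x y) : L.t (L.c₁ f x y) = L.tr.obj (L.t f) x y := by
  simp [c₁_apply, L.tr.t_mor]
@[simp] theorem t_c₂ (x f y) : L.t (L.c₂ x f y) = L.tr.obj x (L.t f) y := by
  simp [c₂_apply, L.tr.t_mor]
@[simp] theorem t_c₃ (x y f) : L.t (L.c₃ x y f) = L.tr.obj x y (L.t f) := by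
  simp [c₃_apply, L.tr.t_mor]

theorem b₁_one (x y) : L.b₁ (L.one x) y = L.one (L.br.obj x y) := L.br.mor_one x y
theorem b₂_one (x y) : L.b₂ x (L.one y) = L.one (L.br.obj x y) := L.br.mor_one x y
theorem c₁_one (x y z) : L.c₁ (L.one x) y z = L.one (L.tr.obj x y z) := L.tr.mor_one x y z
theorem c₂_one (x y z) : L.c₂ x (L.one y) z = L.one (L.tr.obj x y z) := L.tr.mor_one x y z
theorem c₃_one (x y z) : L.c₃ x y (L.one z) = L.one (L.tr.obj x y z) := L.tr.mor_one x y z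

/-- Bracketing with identities sends identities to identities, so it respects the splitting. The
same reason covers the four lemmas that follow. -/
theorem arr_b₁ (f x) : L.arr (L.b₁ f x) = L.b₁ (L.arr f) x := by
  simp [TwoVectorSpace.arr_apply, b₁_one]
theorem arr_b₂ (x f) : L.arr (L.b₂ x f) = L.b₂ x (L.arr f) := by
  simp [TwoVectorSpace.arr_apply, b₂_one]
theorem arr_c₁ (f x y) : L.arr (L.c₁ f x y) = L.c₁ (L.arr f) x y := by
  simp [TwoVectorSpace.arr_apply, c₁_one]
theorem arr_c₂ (x f y) : L.arr (L.c₂ x f y) = L.c₂ x (L.arr f) y := by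
  simp [TwoVectorSpace.arr_apply, c₂_one]
theorem arr_c₃ (x y f) : L.arr (L.c₃ x y f) = L.c₃ x y (L.arr f) := by
  simp [TwoVectorSpace.arr_apply, c₃_one]

/-- Interchange: `f` is `0` followed by `f` and `g` is `g` followed by `0`, so `[f, g]` is the
composite of `[0, g]` and `[f, 0]`, both zero. -/
theorem br_mor_eq_zero {f g : L.Mor} (hf : L.s f = 0) (hg : L.t g = 0) : L.br.mor f g = 0 := by
  have h := L.br.mor_comp 0 f g 0 (by simp [hf]) (by simp [hg])
  simpa [TwoVectorSpace.vcomp_eq, hg] using h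

/-- The difference `f - 1_{t f}` has target zero, so its bracket with `w` vanishes. -/
theorem br_mor_of_s_left {w : L.Mor} (h : L.s w = 0) (f : L.Mor) :
    L.br.mor w f = L.b₁ w (L.t f) := by
  have := L.br_mor_eq_zero (g := f - L.one (L.t f)) h (by simp)
  rwa [map_sub, sub_eq_zero] at this

theorem br_mor_of_s_right {w : L.Mor} (h : L.s w = 0) (f : L.Mor) :
    L.br.mor f w = L.b₂ (L.t f) w := by
  rw [L.br_mor_skew, L.br_mor_of_s_left h, b₂_apply, L.br_mor_skew, b₁_apply]

theorem tr_mor_of_s₁ {w : L.Mor} (h : L.s w = 0) (f g : L.Mor) :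
    L.tr.mor w f g = L.c₁ w (L.t f) (L.t g) := by
  -- Interchange again, with factors `0, w` of `w`, `f', 0` of `f'` and `1, g` of `g`. Each of the
  -- two brackets that arise contains a zero.
  have h₁ : ∀ f' : L.Mor, L.t f' = 0 → L.tr.mor w f' g = 0 := fun f' hf' => by
    have := L.tr.mor_comp 0 w f' 0 (L.one (L.s g)) g (by simp [h]) (by simp [hf']) (by simp)
    simpa [TwoVectorSpace.vcomp_eq, hf'] using this
  have h₂ : ∀ g' : L.Mor, L.t g' = 0 → L.tr.mor w (L.one (L.t f)) g' = 0 := fun g' hg' => by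
    have := L.tr.mor_comp 0 w (L.one (L.t f)) (L.one (L.t f)) g' 0 (by simp [h]) (by simp)
      (by simp [hg'])
    simpa [TwoVectorSpace.vcomp_eq, hg'] using this
  have e₁ := h₁ (f - L.one (L.t f)) (by simp)
  have e₂ := h₂ (g - L.one (L.t g)) (by simp)
  rw [map_sub, LinearMap.sub_apply, sub_eq_zero] at e₁
  rw [map_sub, sub_eq_zero] at e₂
  rw [e₁, e₂, c₁_apply]

theorem tr_mor_of_s₂ {w : L.Mor} (h : L.s w = 0) (f g : L.Mor) :
    L.tr.mor f w g = L.c₂ (L.t f) w (L.t g) := by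
  rw [L.tr_mor_skew, L.tr_mor_of_s₁ h, c₂_apply, L.tr_mor_skew, c₁_apply]

theorem tr_mor_of_s₃ {w : L.Mor} (h : L.s w = 0) (f g : L.Mor) :
    L.tr.mor f g w = L.c₃ (L.t f) (L.t g) w := by
  have h₁ : ∀ f' g' : L.Mor, L.t f' = 0 → L.tr.mor f' g' w = 0 := fun f' g' hf' => by
    have := L.tr.mor_comp f' 0 (L.one (L.s g')) g' 0 w (by simp [hf']) (by simp) (by simp [h])
    simpa [TwoVectorSpace.vcomp_eq, hf'] using this
  have e₁ := h₁ (f - L.one (L.t f)) g (by simp)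
  have e₂ := h₁ (g - L.one (L.t g)) (L.one (L.t f)) (by simp)
  -- `h₁` treats only the first slot; skew-symmetry moves the second argument there.
  rw [L.tr_mor_skew, neg_eq_zero] at e₂
  rw [map_sub, LinearMap.sub_apply, LinearMap.sub_apply, sub_eq_zero] at e₁
  rw [map_sub, LinearMap.sub_apply, sub_eq_zero] at e₂
  rw [e₁, e₂, c₃_apply]

end BracketTwoVectorSpace

/-! ### Naturality as equations between arrow parts. -/

namespace BracketTwoVectorSpace

variable {K : Type u} [Field K] {L : BracketTwoVectorSpace.{u, v} K}

attribute [local simp] br_mor_of_s_left br_mor_of_s_right tr_mor_of_s₁ tr_mor_of_s₂ tr_mor_of_s₃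
  arr_b₁ arr_b₂ arr_c₁ arr_c₂ arr_c₃ TwoVectorSpace.arr_of_s_eq_zero
  BilinearFunctor.s_mor BilinearFunctor.t_mor BilinearFunctor.mor_one
  TrilinearFunctor.s_mor TrilinearFunctor.t_mor TrilinearFunctor.mor_one

/-- The arrow form of the naturality square is additive in each `fᵢ`, so each may be taken to be an
identity or in `ker s`. As soon as one of them is some `w` with `s w = 0`, the term `J` at the
sources vanishes and the brackets see only the targets of the others, so the others may be replaced
by identities. The three companions for `Jhat`, `Jtilde` and `J₅` rest on the same argument. -/
theorem isNaturalJ₃_iff {J : L.Tri} : L.IsNaturalJ₃ J ↔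
    (∀ x₁ x₂ x₃, L.s (J x₁ x₂ x₃) = L.o₂ x₁ (L.o₂ x₂ x₃) + L.o₃ x₃ x₂ x₁) ∧
    (∀ x₁ x₂ x₃, L.t (J x₁ x₂ x₃) =
      L.o₂ (L.o₂ x₁ x₂) x₃ + L.o₂ x₂ (L.o₂ x₁ x₃) + L.o₃ x₁ x₂ x₃ + L.o₃ x₃ x₁ x₂) ∧
    (∀ w x₂ x₃, L.s w = 0 →
      L.b₁ w (L.o₂ x₂ x₃) + L.c₃ x₃ x₂ w + L.arr (J (L.t w) x₂ x₃) =
        L.b₁ (L.b₁ w x₂) x₃ + L.b₂ x₂ (L.b₁ w x₃) + L.c₁ w x₂ x₃ + L.c₂ x₃ w x₂) ∧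
    (∀ x₁ w x₃, L.s w = 0 →
      L.b₂ x₁ (L.b₁ w x₃) + L.c₂ x₃ w x₁ + L.arr (J x₁ (L.t w) x₃) =
        L.b₁ (L.b₂ x₁ w) x₃ + L.b₁ w (L.o₂ x₁ x₃) + L.c₂ x₁ w x₃ + L.c₃ x₃ x₁ w) ∧
    (∀ x₁ x₂ w, L.s w = 0 →
      L.b₂ x₁ (L.b₂ x₂ w) + L.c₁ w x₂ x₁ + L.arr (J x₁ x₂ (L.t w)) =
        L.b₂ (L.o₂ x₁ x₂) w + L.b₂ x₂ (L.b₂ x₁ w) + L.c₃ x₁ x₂ w + L.c₁ w x₁ x₂) := by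
  constructor
  · rintro ⟨source, target, natural⟩
    refine ⟨source, target, fun w x₂ x₃ h => ?_,
      fun x₁ w x₃ h => ?_,
      fun x₁ x₂ w h => ?_⟩
    · simpa [h] using (natural w (L.one x₂) (L.one x₃)).arr_eq
    · simpa [h] using (natural (L.one x₁) w (L.one x₃)).arr_eq
    · simpa [h] using (natural (L.one x₁) (L.one x₂) w).arr_eq
  · rintro ⟨source, target, h₁, h₂, h₃⟩
    refine ⟨source, target, fun f₁ f₂ f₃ => ?_⟩
    rw [L.commSq_iff_arr]
    refine ⟨by simp [source], by simp [target], by simp [source], ?_⟩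
    induction f₁ using L.mor_induction with
    | one x₁ =>
      induction f₂ using L.mor_induction with
      | one x₂ =>
        induction f₃ using L.mor_induction with
        | one x₃ =>
          -- When all arguments are identities, both sides reduce to the arrow part of the same `J`.
          simp [add_comm]
        | ker w h =>
          simpa [h] using h₃ x₁ x₂ w h
        | add f g hf hg =>
          simp only [m₂, m₃, map_add, LinearMap.add_apply] at hf hg ⊢
          linear_combination (norm := abel) hf + hg
      | ker w h =>
        simpa [h] using h₂ x₁ w (L.t f₃) h
      | add f g hf hg =>
        simp only [m₂, m₃, map_add, LinearMap.add_apply] at hf hg ⊢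
        linear_combination (norm := abel) hf + hg
    | ker w h =>
      simpa [h] using h₁ w (L.t f₂) (L.t f₃) h
    | add f g hf hg =>
      simp only [m₂, m₃, map_add, LinearMap.add_apply] at hf hg ⊢
      linear_combination (norm := abel) hf + hg

theorem isNaturalJhat_iff {J : L.Quadri} : L.IsNaturalJhat J ↔
    (∀ x₁ x₂ x₃ y, L.s (J x₁ x₂ x₃ y) = L.o₃ x₁ (L.o₂ x₂ x₃) y) ∧
    (∀ x₁ x₂ x₃ y, L.t (J x₁ x₂ x₃ y) =
      L.o₃ (L.o₂ x₁ x₂) x₃ y + L.o₃ x₂ (L.o₂ x₁ x₃) y) ∧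
    (∀ w x₂ x₃ y, L.s w = 0 →
      L.c₁ w (L.o₂ x₂ x₃) y + L.arr (J (L.t w) x₂ x₃ y) =
        L.c₁ (L.b₁ w x₂) x₃ y + L.c₂ x₂ (L.b₁ w x₃) y) ∧
    (∀ x₁ w x₃ y, L.s w = 0 →
      L.c₂ x₁ (L.b₁ w x₃) y + L.arr (J x₁ (L.t w) x₃ y) =
        L.c₁ (L.b₂ x₁ w) x₃ y + L.c₁ w (L.o₂ x₁ x₃) y) ∧
    (∀ x₁ x₂ w y, L.s w = 0 →
      L.c₂ x₁ (L.b₂ x₂ w) y + L.arr (J x₁ x₂ (L.t w) y) =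
        L.c₂ (L.o₂ x₁ x₂) w y + L.c₂ x₂ (L.b₂ x₁ w) y) ∧
    (∀ x₁ x₂ x₃ w, L.s w = 0 →
      L.c₃ x₁ (L.o₂ x₂ x₃) w + L.arr (J x₁ x₂ x₃ (L.t w)) =
        L.c₃ (L.o₂ x₁ x₂) x₃ w + L.c₃ x₂ (L.o₂ x₁ x₃) w) := by
  constructor
  · rintro ⟨source, target, natural⟩
    refine ⟨source, target, fun w x₂ x₃ y h => ?_,
      fun x₁ w x₃ y h => ?_,
      fun x₁ x₂ w y h => ?_,
      fun x₁ x₂ x₃ w h => ?_⟩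
    · simpa [h] using (natural w (L.one x₂) (L.one x₃) (L.one y)).arr_eq
    · simpa [h] using (natural (L.one x₁) w (L.one x₃) (L.one y)).arr_eq
    · simpa [h] using (natural (L.one x₁) (L.one x₂) w (L.one y)).arr_eq
    · simpa [h] using (natural (L.one x₁) (L.one x₂) (L.one x₃) w).arr_eq
  · rintro ⟨source, target, h₁, h₂, h₃, h₄⟩
    refine ⟨source, target, fun f₁ f₂ f₃ f₄ => ?_⟩
    rw [L.commSq_iff_arr]
    refine ⟨by simp [source], by simp [target], by simp [source], ?_⟩
    induction f₁ using L.mor_induction with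
    | one x₁ =>
      induction f₂ using L.mor_induction with
      | one x₂ =>
        induction f₃ using L.mor_induction with
        | one x₃ =>
          induction f₄ using L.mor_induction with
          | one y =>
            simp [add_comm]
          | ker w h =>
            simpa [h] using h₄ x₁ x₂ x₃ w h
          | add f g hf hg =>
            simp only [m₂, m₃, map_add, LinearMap.add_apply] at hf hg ⊢
            linear_combination (norm := abel) hf + hg
        | ker w h =>
          simpa [h] using h₃ x₁ x₂ w (L.t f₄) h
        | add f g hf hg =>
          simp only [m₂, m₃, map_add, LinearMap.add_apply] at hf hg ⊢
          linear_combination (norm := abel) hf + hg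
      | ker w h =>
        simpa [h] using h₂ x₁ w (L.t f₃) (L.t f₄) h
      | add f g hf hg =>
        simp only [m₂, m₃, map_add, LinearMap.add_apply] at hf hg ⊢
        linear_combination (norm := abel) hf + hg
    | ker w h =>
      simpa [h] using h₁ w (L.t f₂) (L.t f₃) (L.t f₄) h
    | add f g hf hg =>
      simp only [m₂, m₃, map_add, LinearMap.add_apply] at hf hg ⊢
      linear_combination (norm := abel) hf + hg

theorem isNaturalJtilde_iff {J : L.Quadri} : L.IsNaturalJtilde J ↔
    (∀ x₁ x₂ y₁ y₂, L.s (J x₁ x₂ y₁ y₂) = L.o₃ x₁ x₂ (L.o₂ y₁ y₂)) ∧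
    (∀ x₁ x₂ y₁ y₂, L.t (J x₁ x₂ y₁ y₂) =
      L.o₂ (L.o₃ x₁ x₂ y₁) y₂ + L.o₂ y₁ (L.o₃ x₁ x₂ y₂)) ∧
    (∀ w x₂ y₁ y₂, L.s w = 0 →
      L.c₁ w x₂ (L.o₂ y₁ y₂) + L.arr (J (L.t w) x₂ y₁ y₂) =
        L.b₁ (L.c₁ w x₂ y₁) y₂ + L.b₂ y₁ (L.c₁ w x₂ y₂)) ∧
    (∀ x₁ w y₁ y₂, L.s w = 0 →
      L.c₂ x₁ w (L.o₂ y₁ y₂) + L.arr (J x₁ (L.t w) y₁ y₂) =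
        L.b₁ (L.c₂ x₁ w y₁) y₂ + L.b₂ y₁ (L.c₂ x₁ w y₂)) ∧
    (∀ x₁ x₂ w y₂, L.s w = 0 →
      L.c₃ x₁ x₂ (L.b₁ w y₂) + L.arr (J x₁ x₂ (L.t w) y₂) =
        L.b₁ (L.c₃ x₁ x₂ w) y₂ + L.b₁ w (L.o₃ x₁ x₂ y₂)) ∧
    (∀ x₁ x₂ y₁ w, L.s w = 0 →
      L.c₃ x₁ x₂ (L.b₂ y₁ w) + L.arr (J x₁ x₂ y₁ (L.t w)) =
        L.b₂ (L.o₃ x₁ x₂ y₁) w + L.b₂ y₁ (L.c₃ x₁ x₂ w)) := by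
  constructor
  · rintro ⟨source, target, natural⟩
    refine ⟨source, target, fun w x₂ y₁ y₂ h => ?_,
      fun x₁ w y₁ y₂ h => ?_,
      fun x₁ x₂ w y₂ h => ?_,
      fun x₁ x₂ y₁ w h => ?_⟩
    · simpa [h] using (natural w (L.one x₂) (L.one y₁) (L.one y₂)).arr_eq
    · simpa [h] using (natural (L.one x₁) w (L.one y₁) (L.one y₂)).arr_eq
    · simpa [h] using (natural (L.one x₁) (L.one x₂) w (L.one y₂)).arr_eq
    · simpa [h] using (natural (L.one x₁) (L.one x₂) (L.one y₁) w).arr_eq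
  · rintro ⟨source, target, h₁, h₂, h₃, h₄⟩
    refine ⟨source, target, fun f₁ f₂ f₃ f₄ => ?_⟩
    rw [L.commSq_iff_arr]
    refine ⟨by simp [source], by simp [target], by simp [source], ?_⟩
    induction f₁ using L.mor_induction with
    | one x₁ =>
      induction f₂ using L.mor_induction with
      | one x₂ =>
        induction f₃ using L.mor_induction with
        | one y₁ =>
          induction f₄ using L.mor_induction with
          | one y₂ =>
            simp [add_comm]
          | ker w h =>
            simpa [h] using h₄ x₁ x₂ y₁ w h
          | add f g hf hg =>
            simp only [m₂, m₃, map_add, LinearMap.add_apply] at hf hg ⊢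
            linear_combination (norm := abel) hf + hg
        | ker w h =>
          simpa [h] using h₃ x₁ x₂ w (L.t f₄) h
        | add f g hf hg =>
          simp only [m₂, m₃, map_add, LinearMap.add_apply] at hf hg ⊢
          linear_combination (norm := abel) hf + hg
      | ker w h =>
        simpa [h] using h₂ x₁ w (L.t f₃) (L.t f₄) h
      | add f g hf hg =>
        simp only [m₂, m₃, map_add, LinearMap.add_apply] at hf hg ⊢
        linear_combination (norm := abel) hf + hg
    | ker w h =>
      simpa [h] using h₁ w (L.t f₂) (L.t f₃) (L.t f₄) h
    | add f g hf hg =>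
      simp only [m₂, m₃, map_add, LinearMap.add_apply] at hf hg ⊢
      linear_combination (norm := abel) hf + hg

theorem isNaturalJ₅_iff {J : L.Quinque} : L.IsNaturalJ₅ J ↔
    (∀ x₁ x₂ y₁ y₂ y₃, L.s (J x₁ x₂ y₁ y₂ y₃) = L.o₃ x₁ x₂ (L.o₃ y₁ y₂ y₃)) ∧
    (∀ x₁ x₂ y₁ y₂ y₃, L.t (J x₁ x₂ y₁ y₂ y₃) =
      L.o₃ (L.o₃ x₁ x₂ y₁) y₂ y₃ + L.o₃ y₁ (L.o₃ x₁ x₂ y₂) y₃ + L.o₃ y₁ y₂ (L.o₃ x₁ x₂ y₃)) ∧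
    (∀ w x₂ y₁ y₂ y₃, L.s w = 0 →
      L.c₁ w x₂ (L.o₃ y₁ y₂ y₃) + L.arr (J (L.t w) x₂ y₁ y₂ y₃) =
        L.c₁ (L.c₁ w x₂ y₁) y₂ y₃ + L.c₂ y₁ (L.c₁ w x₂ y₂) y₃ + L.c₃ y₁ y₂ (L.c₁ w x₂ y₃)) ∧
    (∀ x₁ w y₁ y₂ y₃, L.s w = 0 →
      L.c₂ x₁ w (L.o₃ y₁ y₂ y₃) + L.arr (J x₁ (L.t w) y₁ y₂ y₃) =
        L.c₁ (L.c₂ x₁ w y₁) y₂ y₃ + L.c₂ y₁ (L.c₂ x₁ w y₂) y₃ + L.c₃ y₁ y₂ (L.c₂ x₁ w y₃)) ∧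
    (∀ x₁ x₂ w y₂ y₃, L.s w = 0 →
      L.c₃ x₁ x₂ (L.c₁ w y₂ y₃) + L.arr (J x₁ x₂ (L.t w) y₂ y₃) =
        L.c₁ (L.c₃ x₁ x₂ w) y₂ y₃ + L.c₁ w (L.o₃ x₁ x₂ y₂) y₃ + L.c₁ w y₂ (L.o₃ x₁ x₂ y₃)) ∧
    (∀ x₁ x₂ y₁ w y₃, L.s w = 0 →
      L.c₃ x₁ x₂ (L.c₂ y₁ w y₃) + L.arr (J x₁ x₂ y₁ (L.t w) y₃) =
        L.c₂ (L.o₃ x₁ x₂ y₁) w y₃ + L.c₂ y₁ (L.c₃ x₁ x₂ w) y₃ + L.c₂ y₁ w (L.o₃ x₁ x₂ y₃)) ∧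
    (∀ x₁ x₂ y₁ y₂ w, L.s w = 0 →
      L.c₃ x₁ x₂ (L.c₃ y₁ y₂ w) + L.arr (J x₁ x₂ y₁ y₂ (L.t w)) =
        L.c₃ (L.o₃ x₁ x₂ y₁) y₂ w + L.c₃ y₁ (L.o₃ x₁ x₂ y₂) w + L.c₃ y₁ y₂ (L.c₃ x₁ x₂ w)) := by
  constructor
  · rintro ⟨source, target, natural⟩
    refine ⟨source, target, fun w x₂ y₁ y₂ y₃ h => ?_,
      fun x₁ w y₁ y₂ y₃ h => ?_,
      fun x₁ x₂ w y₂ y₃ h => ?_,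
      fun x₁ x₂ y₁ w y₃ h => ?_,
      fun x₁ x₂ y₁ y₂ w h => ?_⟩
    · simpa [h] using (natural w (L.one x₂) (L.one y₁) (L.one y₂) (L.one y₃)).arr_eq
    · simpa [h] using (natural (L.one x₁) w (L.one y₁) (L.one y₂) (L.one y₃)).arr_eq
    · simpa [h] using (natural (L.one x₁) (L.one x₂) w (L.one y₂) (L.one y₃)).arr_eq
    · simpa [h] using (natural (L.one x₁) (L.one x₂) (L.one y₁) w (L.one y₃)).arr_eq
    · simpa [h] using (natural (L.one x₁) (L.one x₂) (L.one y₁) (L.one y₂) w).arr_eq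
  · rintro ⟨source, target, h₁, h₂, h₃, h₄, h₅⟩
    refine ⟨source, target, fun f₁ f₂ f₃ f₄ f₅ => ?_⟩
    rw [L.commSq_iff_arr]
    refine ⟨by simp [source], by simp [target], by simp [source], ?_⟩
    induction f₁ using L.mor_induction with
    | one x₁ =>
      induction f₂ using L.mor_induction with
      | one x₂ =>
        induction f₃ using L.mor_induction with
        | one y₁ =>
          induction f₄ using L.mor_induction with
          | one y₂ =>
            induction f₅ using L.mor_induction with
            | one y₃ =>
              simp [add_comm]
            | ker w h =>
              simpa [h] using h₅ x₁ x₂ y₁ y₂ w h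
            | add f g hf hg =>
              simp only [m₂, m₃, map_add, LinearMap.add_apply] at hf hg ⊢
              linear_combination (norm := abel) hf + hg
          | ker w h =>
            simpa [h] using h₄ x₁ x₂ y₁ w (L.t f₅) h
          | add f g hf hg =>
            simp only [m₂, m₃, map_add, LinearMap.add_apply] at hf hg ⊢
            linear_combination (norm := abel) hf + hg
        | ker w h =>
          simpa [h] using h₃ x₁ x₂ w (L.t f₄) (L.t f₅) h
        | add f g hf hg =>
          simp only [m₂, m₃, map_add, LinearMap.add_apply] at hf hg ⊢
          linear_combination (norm := abel) hf + hg
      | ker w h =>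
        simpa [h] using h₂ x₁ w (L.t f₃) (L.t f₄) (L.t f₅) h
      | add f g hf hg =>
        simp only [m₂, m₃, map_add, LinearMap.add_apply] at hf hg ⊢
        linear_combination (norm := abel) hf + hg
    | ker w h =>
      simpa [h] using h₁ w (L.t f₂) (L.t f₃) (L.t f₄) (L.t f₅) h
    | add f g hf hg =>
      simp only [m₂, m₃, map_add, LinearMap.add_apply] at hf hg ⊢
      linear_combination (norm := abel) hf + hg

end BracketTwoVectorSpace

/-! ### Coherence laws as equations between arrow parts. -/

namespace BracketTwoVectorSpace

variable {K : Type u} [Field K] {L : BracketTwoVectorSpace.{u, v} K}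

/-- The prescribed sources and targets already make both paths of the hexagon composable with a
common source. The identity summands have arrow part zero, so only the sum of the arrow parts along
each path has to be compared. -/
theorem coherence₁_iff {J₃ : L.Tri} {Jtilde : L.Quadri} {J₅ : L.Quinque}
    (h₃ : L.IsNaturalJ₃ J₃) (ht : L.IsNaturalJtilde Jtilde) (h₅ : L.IsNaturalJ₅ J₅) :
    L.Coherence₁ J₃ Jtilde J₅ ↔ ∀ x₁ x₂ y₁ y₂ y₃,
    L.c₃ x₁ x₂ (L.arr (J₃ y₁ y₂ y₃)) + L.arr (Jtilde x₁ x₂ (L.o₂ y₁ y₂) y₃)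
      + L.arr (Jtilde x₁ x₂ y₂ (L.o₂ y₁ y₃))
      + L.b₁ (L.arr (Jtilde x₁ x₂ y₁ y₂)) y₃ + L.b₂ y₂ (L.arr (Jtilde x₁ x₂ y₁ y₃))
      + L.arr (J₅ x₁ x₂ y₁ y₂ y₃) + L.arr (J₅ x₁ x₂ y₃ y₁ y₂) =
    L.arr (Jtilde x₁ x₂ y₁ (L.o₂ y₂ y₃)) + L.b₂ y₁ (L.arr (Jtilde x₁ x₂ y₂ y₃))
      + L.arr (J₃ (L.o₃ x₁ x₂ y₁) y₂ y₃) + L.arr (J₃ y₁ (L.o₃ x₁ x₂ y₂) y₃)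
      + L.arr (J₃ y₁ y₂ (L.o₃ x₁ x₂ y₃)) + L.arr (J₅ x₁ x₂ y₃ y₂ y₁) := by
  simp only [Coherence₁, ← b₁_apply, ← b₂_apply, ← c₁_apply, ← c₂_apply, ← c₃_apply, m₂, m₃]
  refine forall_congr' fun x₁ => forall_congr' fun x₂ => forall_congr' fun y₁ =>
    forall_congr' fun y₂ => forall_congr' fun y₃ => ?_
  rw [L.commHex_iff_arr]
  refine ⟨fun ⟨_, _, _, _, _, h⟩ => ?_, fun h => ⟨?_, ?_, ?_, ?_, ?_, ?_⟩⟩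
  · simp only [map_add, arr_b₁, arr_b₂, arr_c₁, arr_c₂, arr_c₃, L.arr_one] at h
    linear_combination (norm := abel) h
  iterate 5
    -- Four composability conditions and the equality of the two sources; the coherence equation
    -- plays no role in them.
    simp only [map_add, LinearMap.add_apply, h₃.source, h₃.target, ht.source, ht.target,
      h₅.source, h₅.target, t_b₁, t_b₂, t_c₁, t_c₂, t_c₃, s_b₁, s_b₂, s_c₁, s_c₂, s_c₃,
      L.s_one, L.t_one] <;>
    abel
  · simp only [map_add, arr_b₁, arr_b₂, arr_c₁, arr_c₂, arr_c₃, L.arr_one]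
    linear_combination (norm := abel) h

theorem coherence₂_iff {Jhat Jtilde : L.Quadri} {J₅ : L.Quinque}
    (hh : L.IsNaturalJhat Jhat) (ht : L.IsNaturalJtilde Jtilde) (h₅ : L.IsNaturalJ₅ J₅) :
    L.Coherence₂ Jhat Jtilde J₅ ↔ ∀ x₁ x₂ y₁ y₂ y₃ z,
    L.c₃ x₁ x₂ (L.arr (Jhat y₁ y₂ y₃ z)) + L.arr (J₅ x₁ x₂ (L.o₂ y₁ y₂) y₃ z)
      + L.arr (J₅ x₁ x₂ y₂ (L.o₂ y₁ y₃) z)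
      + L.c₁ (L.arr (Jtilde x₁ x₂ y₁ y₂)) y₃ z + L.c₂ y₂ (L.arr (Jtilde x₁ x₂ y₁ y₃)) z =
    L.arr (J₅ x₁ x₂ y₁ (L.o₂ y₂ y₃) z) + L.arr (Jhat (L.o₃ x₁ x₂ y₁) y₂ y₃ z)
      + L.c₂ y₁ (L.arr (Jtilde x₁ x₂ y₂ y₃)) z
      + L.arr (Jhat y₁ y₂ y₃ (L.o₃ x₁ x₂ z)) + L.arr (Jhat y₁ (L.o₃ x₁ x₂ y₂) y₃ z)
      + L.arr (Jhat y₁ y₂ (L.o₃ x₁ x₂ y₃) z) := by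
  simp only [Coherence₂, ← b₁_apply, ← b₂_apply, ← c₁_apply, ← c₂_apply, ← c₃_apply, m₂, m₃]
  refine forall_congr' fun x₁ => forall_congr' fun x₂ => forall_congr' fun y₁ =>
    forall_congr' fun y₂ => forall_congr' fun y₃ => forall_congr' fun z => ?_
  rw [L.commHex_iff_arr]
  refine ⟨fun ⟨_, _, _, _, _, h⟩ => ?_, fun h => ⟨?_, ?_, ?_, ?_, ?_, ?_⟩⟩
  · simp only [map_add, arr_b₁, arr_b₂, arr_c₁, arr_c₂, arr_c₃, L.arr_one] at h
    linear_combination (norm := abel) h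
  iterate 5
    simp only [map_add, LinearMap.add_apply, hh.source, hh.target, ht.source, ht.target,
      h₅.source, h₅.target, t_b₁, t_b₂, t_c₁, t_c₂, t_c₃, s_b₁, s_b₂, s_c₁, s_c₂, s_c₃,
      L.s_one, L.t_one] <;>
    abel
  · simp only [map_add, arr_b₁, arr_b₂, arr_c₁, arr_c₂, arr_c₃, L.arr_one]
    linear_combination (norm := abel) h

theorem coherence₃_iff {Jtilde : L.Quadri} {J₅ : L.Quinque}
    (ht : L.IsNaturalJtilde Jtilde) (h₅ : L.IsNaturalJ₅ J₅) :
    L.Coherence₃ Jtilde J₅ ↔ ∀ x₁ x₂ y₁ y₂ z₁ z₂,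
    L.c₃ x₁ x₂ (L.arr (Jtilde y₁ y₂ z₁ z₂)) + L.arr (Jtilde x₁ x₂ (L.o₃ y₁ y₂ z₁) z₂)
      + L.arr (Jtilde x₁ x₂ z₁ (L.o₃ y₁ y₂ z₂))
      + L.b₁ (L.arr (J₅ x₁ x₂ y₁ y₂ z₁)) z₂ + L.b₂ z₁ (L.arr (J₅ x₁ x₂ y₁ y₂ z₂)) =
    L.arr (J₅ x₁ x₂ y₁ y₂ (L.o₂ z₁ z₂)) + L.c₃ y₁ y₂ (L.arr (Jtilde x₁ x₂ z₁ z₂))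
      + L.arr (Jtilde (L.o₃ x₁ x₂ y₁) y₂ z₁ z₂) + L.arr (Jtilde y₁ (L.o₃ x₁ x₂ y₂) z₁ z₂)
      + L.arr (Jtilde y₁ y₂ (L.o₃ x₁ x₂ z₁) z₂)
      + L.arr (Jtilde y₁ y₂ z₁ (L.o₃ x₁ x₂ z₂)) := by
  simp only [Coherence₃, ← b₁_apply, ← b₂_apply, ← c₁_apply, ← c₂_apply, ← c₃_apply, m₂, m₃]
  refine forall_congr' fun x₁ => forall_congr' fun x₂ => forall_congr' fun y₁ =>
    forall_congr' fun y₂ => forall_congr' fun z₁ => forall_congr' fun z₂ => ?_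
  rw [L.commHex_iff_arr]
  refine ⟨fun ⟨_, _, _, _, _, h⟩ => ?_, fun h => ⟨?_, ?_, ?_, ?_, ?_, ?_⟩⟩
  · simp only [map_add, arr_b₁, arr_b₂, arr_c₁, arr_c₂, arr_c₃, L.arr_one] at h
    linear_combination (norm := abel) h
  iterate 5
    simp only [map_add, LinearMap.add_apply, ht.source, ht.target,
      h₅.source, h₅.target, t_b₁, t_b₂, t_c₁, t_c₂, t_c₃, s_b₁, s_b₂, s_c₁, s_c₂, s_c₃,
      L.s_one, L.t_one] <;>
    abel
  · simp only [map_add, arr_b₁, arr_b₂, arr_c₁, arr_c₂, arr_c₃, L.arr_one]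
    linear_combination (norm := abel) h

theorem coherence₄_iff {J₅ : L.Quinque} (h₅ : L.IsNaturalJ₅ J₅) :
    L.Coherence₄ J₅ ↔ ∀ x₁ x₂ y₁ y₂ z₁ z₂ z₃,
    L.c₁ (L.arr (J₅ x₁ x₂ y₁ y₂ z₁)) z₂ z₃ + L.c₂ z₁ (L.arr (J₅ x₁ x₂ y₁ y₂ z₂)) z₃
      + L.c₃ x₁ x₂ (L.arr (J₅ y₁ y₂ z₁ z₂ z₃)) + L.c₃ z₁ z₂ (L.arr (J₅ x₁ x₂ y₁ y₂ z₃))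
      + L.arr (J₅ x₁ x₂ (L.o₃ y₁ y₂ z₁) z₂ z₃) + L.arr (J₅ x₁ x₂ z₁ (L.o₃ y₁ y₂ z₂) z₃)
      + L.arr (J₅ x₁ x₂ z₁ z₂ (L.o₃ y₁ y₂ z₃)) =
    L.c₃ y₁ y₂ (L.arr (J₅ x₁ x₂ z₁ z₂ z₃)) + L.arr (J₅ (L.o₃ x₁ x₂ y₁) y₂ z₁ z₂ z₃)
      + L.arr (J₅ y₁ (L.o₃ x₁ x₂ y₂) z₁ z₂ z₃)
      + L.arr (J₅ y₁ y₂ (L.o₃ x₁ x₂ z₁) z₂ z₃) + L.arr (J₅ y₁ y₂ z₁ (L.o₃ x₁ x₂ z₂) z₃)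
      + L.arr (J₅ x₁ x₂ y₁ y₂ (L.o₃ z₁ z₂ z₃)) + L.arr (J₅ y₁ y₂ z₁ z₂ (L.o₃ x₁ x₂ z₃)) := by
  simp only [Coherence₄, ← b₁_apply, ← b₂_apply, ← c₁_apply, ← c₂_apply, ← c₃_apply, m₂, m₃]
  refine forall_congr' fun x₁ => forall_congr' fun x₂ => forall_congr' fun y₁ =>
    forall_congr' fun y₂ => forall_congr' fun z₁ => forall_congr' fun z₂ =>
    forall_congr' fun z₃ => ?_
  rw [L.commHex_iff_arr]
  refine ⟨fun ⟨_, _, _, _, _, h⟩ => ?_, fun h => ⟨?_, ?_, ?_, ?_, ?_, ?_⟩⟩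
  · simp only [map_add, arr_b₁, arr_b₂, arr_c₁, arr_c₂, arr_c₃, L.arr_one] at h
    linear_combination (norm := abel) h
  iterate 5
    simp only [map_add, LinearMap.add_apply,
      h₅.source, h₅.target, t_b₁, t_b₂, t_c₁, t_c₂, t_c₃, s_b₁, s_b₂, s_c₁, s_c₂, s_c₃,
      L.s_one, L.t_one] <;>
    abel
  · simp only [map_add, arr_b₁, arr_b₂, arr_c₁, arr_c₂, arr_c₃, L.arr_one]
    linear_combination (norm := abel) h

/-! ### Homomorphism conditions as equations between arrow parts. -/

variable {L M : BracketTwoVectorSpace.{u, v} K}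
  (F : LinearFunctor L.toTwoVectorSpace M.toTwoVectorSpace)

theorem _root_.LinearFunctor.arr_F₁ {C D : TwoVectorSpace.{u, v} K} (F : LinearFunctor C D)
    (f : C.Mor) : D.arr (F.F₁ f) = F.F₁ (C.arr f) := by
  simp [TwoVectorSpace.arr_apply, F.s_F₁, F.F₁_one]

attribute [local simp] br_mor_of_s_left br_mor_of_s_right tr_mor_of_s₁ tr_mor_of_s₂ tr_mor_of_s₃
  arr_b₁ arr_b₂ arr_c₁ arr_c₂ arr_c₃ TwoVectorSpace.arr_of_s_eq_zero
  BilinearFunctor.s_mor BilinearFunctor.t_mor BilinearFunctor.mor_one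
  TrilinearFunctor.s_mor TrilinearFunctor.t_mor TrilinearFunctor.mor_one
  LinearFunctor.arr_F₁ LinearFunctor.s_F₁ LinearFunctor.t_F₁ LinearFunctor.F₁_one

/-- The reduction is that of `isNaturalJ₃_iff`. It applies because `F₁` maps identities to
identities and `ker s` into `ker s`. -/
theorem natural₂_iff {F₂ : L.Obj →ₗ[K] L.Obj →ₗ[K] M.Mor}
    (hs : ∀ x y, M.s (F₂ x y) = M.o₂ (F.F₀ x) (F.F₀ y))
    (ht : ∀ x y, M.t (F₂ x y) = F.F₀ (L.o₂ x y)) :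
    (∀ f g : L.Mor, M.CommSq (M.m₂ (F.F₁ f) (F.F₁ g)) (F₂ (L.t f) (L.t g))
      (F₂ (L.s f) (L.s g)) (F.F₁ (L.m₂ f g))) ↔
    (∀ w x, L.s w = 0 →
      M.b₁ (F.F₁ w) (F.F₀ x) + M.arr (F₂ (L.t w) x) = F.F₁ (L.b₁ w x)) ∧
    (∀ x w, L.s w = 0 →
      M.b₂ (F.F₀ x) (F.F₁ w) + M.arr (F₂ x (L.t w)) = F.F₁ (L.b₂ x w)) := by
  constructor
  · refine fun natural => ⟨fun w x h => ?_, fun x w h => ?_⟩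
    · simpa [h] using (natural w (L.one x)).arr_eq
    · simpa [h] using (natural (L.one x) w).arr_eq
  · rintro ⟨h₁, h₂⟩ f₁ f₂
    rw [M.commSq_iff_arr]
    refine ⟨by simp [hs], by simp [ht],
      by simp [hs], ?_⟩
    induction f₁ using L.mor_induction with
    | one x₁ =>
      induction f₂ using L.mor_induction with
      | one x₂ => simp
      | ker w h =>
        simpa [h] using h₂ x₁ w h
      | add f g hf hg =>
        simp only [m₂, map_add, LinearMap.add_apply] at hf hg ⊢
        linear_combination (norm := abel) hf + hg
    | ker w h =>
      simpa [h] using h₁ w (L.t f₂) h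
    | add f g hf hg =>
      simp only [m₂, map_add, LinearMap.add_apply] at hf hg ⊢
      linear_combination (norm := abel) hf + hg

theorem natural₃_iff {F₃ : L.Obj →ₗ[K] L.Obj →ₗ[K] L.Obj →ₗ[K] M.Mor}
    (hs : ∀ x y z, M.s (F₃ x y z) = M.o₃ (F.F₀ x) (F.F₀ y) (F.F₀ z))
    (ht : ∀ x y z, M.t (F₃ x y z) = F.F₀ (L.o₃ x y z)) :
    (∀ f g k : L.Mor, M.CommSq (M.m₃ (F.F₁ f) (F.F₁ g) (F.F₁ k)) (F₃ (L.t f) (L.t g) (L.t k))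
      (F₃ (L.s f) (L.s g) (L.s k)) (F.F₁ (L.m₃ f g k))) ↔
    (∀ w x y, L.s w = 0 →
      M.c₁ (F.F₁ w) (F.F₀ x) (F.F₀ y) + M.arr (F₃ (L.t w) x y) = F.F₁ (L.c₁ w x y)) ∧
    (∀ x w y, L.s w = 0 →
      M.c₂ (F.F₀ x) (F.F₁ w) (F.F₀ y) + M.arr (F₃ x (L.t w) y) = F.F₁ (L.c₂ x w y)) ∧
    (∀ x y w, L.s w = 0 →
      M.c₃ (F.F₀ x) (F.F₀ y) (F.F₁ w) + M.arr (F₃ x y (L.t w)) = F.F₁ (L.c₃ x y w)) := by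
  constructor
  · refine fun natural => ⟨fun w x y h => ?_, fun x w y h => ?_, fun x y w h => ?_⟩
    · simpa [h] using (natural w (L.one x) (L.one y)).arr_eq
    · simpa [h] using (natural (L.one x) w (L.one y)).arr_eq
    · simpa [h] using (natural (L.one x) (L.one y) w).arr_eq
  · rintro ⟨h₁, h₂, h₃⟩ f₁ f₂ f₃
    rw [M.commSq_iff_arr]
    refine ⟨by simp [hs], by simp [ht],
      by simp [hs], ?_⟩
    induction f₁ using L.mor_induction with
    | one x₁ =>
      induction f₂ using L.mor_induction with
      | one x₂ =>
        induction f₃ using L.mor_induction with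
        | one x₃ => simp
        | ker w h =>
          simpa [h] using h₃ x₁ x₂ w h
        | add f g hf hg =>
          simp only [m₃, map_add, LinearMap.add_apply] at hf hg ⊢
          linear_combination (norm := abel) hf + hg
      | ker w h =>
        simpa [h] using h₂ x₁ w (L.t f₃) h
      | add f g hf hg =>
        simp only [m₃, map_add, LinearMap.add_apply] at hf hg ⊢
        linear_combination (norm := abel) hf + hg
    | ker w h =>
      simpa [h] using h₁ w (L.t f₂) (L.t f₃) h
    | add f g hf hg =>
      simp only [m₃, map_add, LinearMap.add_apply] at hf hg ⊢
      linear_combination (norm := abel) hf + hg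

variable {F₂ : L.Obj →ₗ[K] L.Obj →ₗ[K] M.Mor} {F₃ : L.Obj →ₗ[K] L.Obj →ₗ[K] L.Obj →ₗ[K] M.Mor}

/-- As for the coherence laws, the endpoints match automatically and only arrow parts matter. The
resulting equation has the shape of `compat_l₃`. -/
theorem compatJ₃_iff {J : L.Tri} {J' : M.Tri} (h : L.IsNaturalJ₃ J) (h' : M.IsNaturalJ₃ J')
    (hs₂ : ∀ x y, M.s (F₂ x y) = M.o₂ (F.F₀ x) (F.F₀ y))
    (ht₂ : ∀ x y, M.t (F₂ x y) = F.F₀ (L.o₂ x y))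
    (hs₃ : ∀ x y z, M.s (F₃ x y z) = M.o₃ (F.F₀ x) (F.F₀ y) (F.F₀ z))
    (ht₃ : ∀ x y z, M.t (F₃ x y z) = F.F₀ (L.o₃ x y z)) :
    (∀ x y z, M.CommHex
      (M.m₂ (M.one (F.F₀ x)) (F₂ y z) + M.one (M.o₃ (F.F₀ z) (F.F₀ y) (F.F₀ x)))
      (F₂ x (L.o₂ y z) + F₃ z y x)
      (F.F₁ (J x y z))
      (J' (F.F₀ x) (F.F₀ y) (F.F₀ z))
      (M.m₂ (F₂ x y) (M.one (F.F₀ z)) + M.m₂ (M.one (F.F₀ y)) (F₂ x z)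
        + M.one (M.o₃ (F.F₀ x) (F.F₀ y) (F.F₀ z)) + M.one (M.o₃ (F.F₀ z) (F.F₀ x) (F.F₀ y)))
      (F₂ (L.o₂ x y) z + F₂ y (L.o₂ x z) + F₃ x y z + F₃ z x y)) ↔
    ∀ x y z, M.b₂ (F.F₀ x) (M.arr (F₂ y z)) + M.arr (F₂ x (L.o₂ y z)) + M.arr (F₃ z y x)
        + F.F₁ (L.arr (J x y z)) =
      M.arr (J' (F.F₀ x) (F.F₀ y) (F.F₀ z)) + M.b₁ (M.arr (F₂ x y)) (F.F₀ z)
        + M.b₂ (F.F₀ y) (M.arr (F₂ x z)) + M.arr (F₂ (L.o₂ x y) z) + M.arr (F₂ y (L.o₂ x z))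
        + M.arr (F₃ x y z) + M.arr (F₃ z x y) := by
  simp only [← b₁_apply, ← b₂_apply, m₂]
  refine forall_congr' fun x => forall_congr' fun y => forall_congr' fun z => ?_
  rw [M.commHex_iff_arr]
  refine ⟨fun ⟨_, _, _, _, _, e⟩ => ?_, fun e => ⟨?_, ?_, ?_, ?_, ?_, ?_⟩⟩
  · simp only [map_add, arr_b₁, arr_b₂, M.arr_one, F.arr_F₁] at e
    linear_combination (norm := abel) e
  iterate 5
    simp only [map_add, LinearMap.add_apply, hs₂, ht₂, hs₃, ht₃, F.s_F₁, F.t_F₁,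
      h.source, h.target, h'.source,
      h'.target, t_b₁, t_b₂, s_b₁, s_b₂, M.s_one, M.t_one]
  · simp only [map_add, arr_b₁, arr_b₂, M.arr_one, F.arr_F₁]
    linear_combination (norm := abel) e

theorem compatJ₅_iff {J : L.Quinque} {J' : M.Quinque}
    (h : L.IsNaturalJ₅ J) (h' : M.IsNaturalJ₅ J')
    (hs₃ : ∀ x y z, M.s (F₃ x y z) = M.o₃ (F.F₀ x) (F.F₀ y) (F.F₀ z))
    (ht₃ : ∀ x y z, M.t (F₃ x y z) = F.F₀ (L.o₃ x y z)) :
    (∀ x₁ x₂ y₁ y₂ y₃, M.CommHex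
      (M.m₃ (M.one (F.F₀ x₁)) (M.one (F.F₀ x₂)) (F₃ y₁ y₂ y₃))
      (F₃ x₁ x₂ (L.o₃ y₁ y₂ y₃))
      (F.F₁ (J x₁ x₂ y₁ y₂ y₃))
      (J' (F.F₀ x₁) (F.F₀ x₂) (F.F₀ y₁) (F.F₀ y₂) (F.F₀ y₃))
      (M.m₃ (F₃ x₁ x₂ y₁) (M.one (F.F₀ y₂)) (M.one (F.F₀ y₃))
        + M.m₃ (M.one (F.F₀ y₁)) (F₃ x₁ x₂ y₂) (M.one (F.F₀ y₃))
        + M.m₃ (M.one (F.F₀ y₁)) (M.one (F.F₀ y₂)) (F₃ x₁ x₂ y₃))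
      (F₃ (L.o₃ x₁ x₂ y₁) y₂ y₃ + F₃ y₁ (L.o₃ x₁ x₂ y₂) y₃ + F₃ y₁ y₂ (L.o₃ x₁ x₂ y₃))) ↔
    ∀ x₁ x₂ y₁ y₂ y₃,
      M.c₃ (F.F₀ x₁) (F.F₀ x₂) (M.arr (F₃ y₁ y₂ y₃)) + M.arr (F₃ x₁ x₂ (L.o₃ y₁ y₂ y₃))
        + F.F₁ (L.arr (J x₁ x₂ y₁ y₂ y₃)) =
      M.arr (J' (F.F₀ x₁) (F.F₀ x₂) (F.F₀ y₁) (F.F₀ y₂) (F.F₀ y₃))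
        + M.c₁ (M.arr (F₃ x₁ x₂ y₁)) (F.F₀ y₂) (F.F₀ y₃)
        + M.c₂ (F.F₀ y₁) (M.arr (F₃ x₁ x₂ y₂)) (F.F₀ y₃)
        + M.c₃ (F.F₀ y₁) (F.F₀ y₂) (M.arr (F₃ x₁ x₂ y₃))
        + M.arr (F₃ (L.o₃ x₁ x₂ y₁) y₂ y₃) + M.arr (F₃ y₁ (L.o₃ x₁ x₂ y₂) y₃)
        + M.arr (F₃ y₁ y₂ (L.o₃ x₁ x₂ y₃)) := by
  simp only [← c₁_apply, ← c₂_apply, ← c₃_apply, m₃]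
  refine forall_congr' fun x₁ => forall_congr' fun x₂ => forall_congr' fun y₁ =>
    forall_congr' fun y₂ => forall_congr' fun y₃ => ?_
  rw [M.commHex_iff_arr]
  refine ⟨fun ⟨_, _, _, _, _, e⟩ => ?_, fun e => ⟨?_, ?_, ?_, ?_, ?_, ?_⟩⟩
  · simp only [map_add, arr_c₁, arr_c₂, arr_c₃, F.arr_F₁] at e
    linear_combination (norm := abel) e
  iterate 5
    simp only [map_add, LinearMap.add_apply, hs₃, ht₃, F.s_F₁, F.t_F₁,
      h.source, h.target, h'.source,
      h'.target, t_c₁, t_c₂, t_c₃, s_c₁, s_c₂, s_c₃, M.s_one, M.t_one]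
  · simp only [map_add, arr_c₁, arr_c₂, arr_c₃, F.arr_F₁]
    linear_combination (norm := abel) e

end BracketTwoVectorSpace

/-! ### The bracket functors of a 2-term L∞-triple algebra. -/

namespace TwoTermLInfTriple

variable {K : Type u} [Field K] (V : TwoTermLInfTriple.{u, v} K)

theorem d_b₁ (w x) : V.d (V.b₁ w x) = V.b (V.d w) x := by
  have h := congrArg V.d (V.b₂_skew x w)
  rw [V.d_b₂, map_neg, V.b_skew] at h
  exact (neg_injective h).symm

theorem d_c₂ (x w y) : V.d (V.c₂ x w y) = V.c x (V.d w) y := by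
  have h := congrArg V.d (V.c₁_skew w x y)
  rw [V.d_c₁, map_neg, V.c_skew] at h
  exact (neg_injective h).symm

/-- The axioms move `d` only between adjacent slots. Swapping the first two arguments makes the
outer slots adjacent, and swapping back restores the sign. -/
theorem c_d₁₃ (w x u) : V.c₃ (V.d w) x u = V.c₁ w x (V.d u) := by
  rw [V.c₃_skew, V.c_d₂₃, V.c₁_skew]

theorem b₁_d_skew (w u) : V.b₁ w (V.d u) = - V.b₁ u (V.d w) := by
  rw [← V.b_d, V.b₂_skew]

theorem c₁_d_skew (w u x) : V.c₁ w (V.d u) x = - V.c₁ u (V.d w) x := by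
  rw [← V.c_d₁₂, ← neg_eq_iff_eq_neg, V.c₁_skew]

/-- The bracket of morphisms `x ⟶ x + d u` and `y ⟶ y + d w`. -/
def brMor : V.V₀ × V.V₁ →ₗ[K] V.V₀ × V.V₁ →ₗ[K] V.V₀ × V.V₁ :=
  LinearMap.mk₂ K
    -- The formula is forced by functoriality: `[f, g]` is `[1_x, g]` followed by `[f, 1_{t g}]`,
    -- and arrow parts add.
    (fun f g => (V.b f.1 g.1, V.b₁ f.2 (g.1 + V.d g.2) + V.b₂ f.1 g.2))
    (by intros; ext <;> simp; abel)
    (by intros; ext <;> simp)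
    (by intros; ext <;> simp; abel)
    (by intros; ext <;> simp)

/-- The ternary bracket of morphisms. -/
def trMor : V.V₀ × V.V₁ →ₗ[K] V.V₀ × V.V₁ →ₗ[K] V.V₀ × V.V₁ →ₗ[K] V.V₀ × V.V₁ where
  toFun f := LinearMap.mk₂ K
    -- The summands come from factoring `[f, g, k]` as `[1, 1, k]`, then `[1, g, 1_{t k}]`, then
    -- `[f, 1_{t g}, 1_{t k}]`.
    (fun g k => (V.c f.1 g.1 k.1, V.c₁ f.2 (g.1 + V.d g.2) (k.1 + V.d k.2)
      + V.c₂ f.1 g.2 (k.1 + V.d k.2) + V.c₃ f.1 g.1 k.2))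
    (by intros; ext <;> simp; abel)
    (by intros; ext <;> simp)
    (by intros; ext <;> simp; abel)
    (by intros; ext <;> simp)
  map_add' f f' := by
    refine LinearMap.ext₂ fun g k => ?_
    ext <;> simp
    abel
  map_smul' a f := by
    refine LinearMap.ext₂ fun g k => ?_
    ext <;> simp

theorem brMor_apply (f g) : V.brMor f g =
    (V.b f.1 g.1, V.b₁ f.2 (g.1 + V.d g.2) + V.b₂ f.1 g.2) := rfl

theorem trMor_apply (f g k) : V.trMor f g k =
    (V.c f.1 g.1 k.1, V.c₁ f.2 (g.1 + V.d g.2) (k.1 + V.d k.2)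
      + V.c₂ f.1 g.2 (k.1 + V.d k.2) + V.c₃ f.1 g.1 k.2) := rfl

def brFunctor : BilinearFunctor (TwoVectorSpace.ofLinearMap V.d) where
  obj := V.b
  mor := V.brMor
  s_mor _ _ := rfl
  t_mor := by
    rintro ⟨x, w⟩ ⟨y, u⟩
    change V.b x y + V.d (V.b₁ w (y + V.d u) + V.b₂ x u) = V.b (x + V.d w) (y + V.d u)
    simp only [map_add, LinearMap.add_apply, V.d_b₁, V.d_b₂]
    abel
  mor_one x y := by
    change V.brMor (x, 0) (y, 0) = (V.b x y, 0)
    simp [brMor_apply]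
  mor_comp := by
    rintro ⟨x, w⟩ ⟨x', w'⟩ ⟨y, u⟩ ⟨y', u'⟩ hf hg
    have hf : x + V.d w = x' := hf
    have hg : y + V.d u = y' := hg
    subst hf hg
    change V.brMor (x, w + w') (y, u + u') = ((V.brMor (x, w) (y, u)).1,
      (V.brMor (x, w) (y, u)).2 + (V.brMor (x + V.d w, w') (y + V.d u, u')).2)
    -- After expansion the two sides differ only in `[w, du']` against `[dw, u']`, so the
    -- interchange law is exactly `b_d`.
    simp only [brMor_apply, map_add, LinearMap.add_apply, V.b_d]
    ext
    · simp
    · simp only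
      abel

def trFunctor : TrilinearFunctor (TwoVectorSpace.ofLinearMap V.d) where
  obj := V.c
  mor := V.trMor
  s_mor _ _ _ := rfl
  t_mor := by
    rintro ⟨x, w⟩ ⟨y, u⟩ ⟨z, m⟩
    change V.c x y z + V.d (V.c₁ w (y + V.d u) (z + V.d m) + V.c₂ x u (z + V.d m) + V.c₃ x y m) =
      V.c (x + V.d w) (y + V.d u) (z + V.d m)
    simp only [map_add, LinearMap.add_apply, V.d_c₁, V.d_c₂, V.d_c₃]
    abel
  mor_one x y z := by
    change V.trMor (x, 0) (y, 0) (z, 0) = (V.c x y z, 0)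
    simp [trMor_apply]
  mor_comp := by
    rintro ⟨x, w⟩ ⟨x', w'⟩ ⟨y, u⟩ ⟨y', u'⟩ ⟨z, m⟩ ⟨z', m'⟩ hf hg hk
    have hf : x + V.d w = x' := hf
    have hg : y + V.d u = y' := hg
    have hk : z + V.d m = z' := hk
    subst hf hg hk
    change V.trMor (x, w + w') (y, u + u') (z, m + m') =
      ((V.trMor (x, w) (y, u) (z, m)).1,
        (V.trMor (x, w) (y, u) (z, m)).2
          + (V.trMor (x + V.d w, w') (y + V.d u, u') (z + V.d m, m')).2)
    -- Moving each arrow to the later factor needs one relation for each pair of slots.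
    simp only [trMor_apply, map_add, LinearMap.add_apply, V.c_d₁₂, V.c_d₂₃, V.c_d₁₃]
    ext
    · simp
    · simp only
      abel

/-- The 2-vector space of a 2-term L∞-triple algebra, with its brackets. -/
def toBracket : BracketTwoVectorSpace.{u, v} K where
  toTwoVectorSpace := TwoVectorSpace.ofLinearMap V.d
  br := V.brFunctor
  tr := V.trFunctor
  br_obj_skew := V.b_skew
  br_mor_skew := by
    rintro ⟨x, w⟩ ⟨y, u⟩
    change V.brMor (x, w) (y, u) = - V.brMor (y, u) (x, w)
    -- The formula for `brMor` is not visibly symmetric in its arguments. The discrepancy is the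
    -- cross term `[w, du]`, which is itself skew by `b₁_d_skew`.
    simp only [brMor_apply, Prod.neg_mk, map_add, V.b₂_skew]
    rw [V.b_skew, V.b₁_d_skew]
    ext
    · simp
    · simp only
      abel
  tr_obj_skew := V.c_skew
  tr_mor_skew := by
    rintro ⟨x, w⟩ ⟨y, u⟩ ⟨z, m⟩
    change V.trMor (x, w) (y, u) (z, m) = - V.trMor (y, u) (x, w) (z, m)
    simp only [trMor_apply, Prod.neg_mk, map_add, LinearMap.add_apply]
    rw [V.c_skew, V.c₁_d_skew w u, V.c₁_d_skew w u, V.c₁_skew w y, V.c₁_skew w y,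
      V.c₁_skew u x, V.c₁_skew u x, V.c₃_skew]
    ext
    · simp
    · simp only
      abel

/-- The inclusion of `V₁` into the morphisms. -/
def inr : V.V₁ →ₗ[K] V.toBracket.Mor := LinearMap.inr K V.V₀ V.V₁

theorem inr_injective : Function.Injective V.inr := LinearMap.inr_injective

/-- The projection of the morphisms onto `V₁`. -/
def snd : V.toBracket.Mor →ₗ[K] V.V₁ := LinearMap.snd K V.V₀ V.V₁

/-- Through this the criteria stated with `arr` become equations inside the image of `inr`, that is,
equations in `V₁`. -/
theorem arr_eq (f : V.toBracket.Mor) : V.toBracket.arr f = V.inr (V.snd f) := by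
  rw [TwoVectorSpace.arr_apply]
  change (f.1 - f.1, f.2 - 0) = (0, f.2)
  simp

@[simp] theorem snd_one (x) : V.snd (V.toBracket.one x) = 0 := rfl
@[simp] theorem s_inr (w) : V.toBracket.s (V.inr w) = 0 := rfl
@[simp] theorem t_inr (w) : V.toBracket.t (V.inr w) = V.d w := zero_add _

theorem exists_inr_eq {f : V.toBracket.Mor} (h : V.toBracket.s f = 0) : ∃ w, f = V.inr w :=
  ⟨V.snd f, by rw [← V.arr_eq, TwoVectorSpace.arr_of_s_eq_zero _ h]⟩

@[simp] theorem bracket_b₁ (w : V.V₁) (x : V.V₀) :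
    V.toBracket.b₁ (V.inr w) x = V.inr (V.b₁ w x) := by
  change V.brMor (0, w) (x, 0) = (0, V.b₁ w x)
  simp [brMor_apply]

@[simp] theorem bracket_b₂ (x : V.V₀) (w : V.V₁) :
    V.toBracket.b₂ x (V.inr w) = V.inr (V.b₂ x w) := by
  change V.brMor (x, 0) (0, w) = (0, V.b₂ x w)
  simp [brMor_apply]

@[simp] theorem bracket_c₁ (w : V.V₁) (x : V.V₀) (y : V.V₀) :
    V.toBracket.c₁ (V.inr w) x y = V.inr (V.c₁ w x y) := by
  change V.trMor (0, w) (x, 0) (y, 0) = (0, V.c₁ w x y)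
  simp [trMor_apply]

@[simp] theorem bracket_c₂ (x : V.V₀) (w : V.V₁) (y : V.V₀) :
    V.toBracket.c₂ x (V.inr w) y = V.inr (V.c₂ x w y) := by
  change V.trMor (x, 0) (0, w) (y, 0) = (0, V.c₂ x w y)
  simp [trMor_apply]

@[simp] theorem bracket_c₃ (x : V.V₀) (y : V.V₀) (w : V.V₁) :
    V.toBracket.c₃ x y (V.inr w) = V.inr (V.c₃ x y w) := by
  change V.trMor (x, 0) (y, 0) (0, w) = (0, V.c₃ x y w)
  simp [trMor_apply]

end TwoTermLInfTriple

/-! ### Constructors for multilinear maps in three, four and five variables. -/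

namespace LinearMap

variable {R M N P Q S T : Type*} [CommSemiring R] [AddCommMonoid M] [Module R M]
  [AddCommMonoid N] [Module R N] [AddCommMonoid P] [Module R P] [AddCommMonoid Q] [Module R Q]
  [AddCommMonoid S] [Module R S] [AddCommMonoid T] [Module R T]

/-- A trilinear map from a family of bilinear maps. -/
def mk₃ (f : M → N → P → Q)
    (add₁ : ∀ x x' y z, f (x + x') y z = f x y z + f x' y z)
    (smul₁ : ∀ (a : R) x y z, f (a • x) y z = a • f x y z)
    (add₂ : ∀ x y y' z, f x (y + y') z = f x y z + f x y' z)
    (smul₂ : ∀ (a : R) x y z, f x (a • y) z = a • f x y z)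
    (add₃ : ∀ x y z z', f x y (z + z') = f x y z + f x y z')
    (smul₃ : ∀ (a : R) x y z, f x y (a • z) = a • f x y z) :
    M →ₗ[R] N →ₗ[R] P →ₗ[R] Q where
  toFun x := mk₂ R (f x) (add₂ x) (fun a y z => smul₂ a x y z) (add₃ x)
    (fun a y z => smul₃ a x y z)
  map_add' x x' := ext₂ (add₁ x x')
  map_smul' a x := ext₂ (smul₁ a x)

/-- A quadrilinear map from a family of trilinear maps. -/
def mk₄ (f : M → N →ₗ[R] P →ₗ[R] Q →ₗ[R] S)
    (add : ∀ x x' y z t, f (x + x') y z t = f x y z t + f x' y z t)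
    (smul : ∀ (a : R) x y z t, f (a • x) y z t = a • f x y z t) :
    M →ₗ[R] N →ₗ[R] P →ₗ[R] Q →ₗ[R] S where
  toFun := f
  map_add' x x' := ext fun y => ext₂ (add x x' y)
  map_smul' a x := ext fun y => ext₂ (smul a x y)

/-- A quinquelinear map from a family of quadrilinear maps. -/
def mk₅ (f : M → N →ₗ[R] P →ₗ[R] Q →ₗ[R] S →ₗ[R] T)
    (add : ∀ x x' y z t r, f (x + x') y z t r = f x y z t r + f x' y z t r)
    (smul : ∀ (a : R) x y z t r, f (a • x) y z t r = a • f x y z t r) :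
    M →ₗ[R] N →ₗ[R] P →ₗ[R] Q →ₗ[R] S →ₗ[R] T where
  toFun := f
  map_add' x x' := ext₂ fun y z => ext₂ (add x x' y z)
  map_smul' a x := ext₂ fun y z => ext₂ (smul a x y z)

end LinearMap

/-! ### The structural transformations and their coherence. -/

namespace TwoTermLInfTriple

variable {K : Type u} [Field K] (V : TwoTermLInfTriple.{u, v} K)

/-- The first component is the prescribed source, so the only freedom is the arrow part, which is
`l₃` with no sign. `Jhat`, `Jtilde` and `J₅` are formed in the same way. -/
def J₃ : V.toBracket.Tri :=
  (LinearMap.mk₃ (fun x₁ x₂ x₃ => (V.b x₁ (V.b x₂ x₃) + V.c x₃ x₂ x₁, V.l₃ x₁ x₂ x₃))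
    (by intros; ext <;> simp; abel) (by intros; ext <;> simp)
    (by intros; ext <;> simp; abel) (by intros; ext <;> simp)
    (by intros; ext <;> simp; abel) (by intros; ext <;> simp) :
    V.V₀ →ₗ[K] V.V₀ →ₗ[K] V.V₀ →ₗ[K] V.V₀ × V.V₁)

def Jhat : V.toBracket.Quadri :=
  (LinearMap.mk₄ (fun x₁ => LinearMap.mk₃
    (fun x₂ x₃ y => (V.c x₁ (V.b x₂ x₃) y, V.lhat x₁ x₂ x₃ y))
    (by intros; ext <;> simp) (by intros; ext <;> simp)
    (by intros; ext <;> simp) (by intros; ext <;> simp)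
    (by intros; ext <;> simp) (by intros; ext <;> simp))
    (by intros; ext <;> simp [LinearMap.mk₃]) (by intros; ext <;> simp [LinearMap.mk₃]) :
    V.V₀ →ₗ[K] V.V₀ →ₗ[K] V.V₀ →ₗ[K] V.V₀ →ₗ[K] V.V₀ × V.V₁)

def Jtilde : V.toBracket.Quadri :=
  (LinearMap.mk₄ (fun x₁ => LinearMap.mk₃
    (fun x₂ y₁ y₂ => (V.c x₁ x₂ (V.b y₁ y₂), V.ltilde x₁ x₂ y₁ y₂))
    (by intros; ext <;> simp) (by intros; ext <;> simp)
    (by intros; ext <;> simp) (by intros; ext <;> simp)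
    (by intros; ext <;> simp) (by intros; ext <;> simp))
    (by intros; ext <;> simp [LinearMap.mk₃]) (by intros; ext <;> simp [LinearMap.mk₃]) :
    V.V₀ →ₗ[K] V.V₀ →ₗ[K] V.V₀ →ₗ[K] V.V₀ →ₗ[K] V.V₀ × V.V₁)

def J₅ : V.toBracket.Quinque :=
  (LinearMap.mk₅ (fun x₁ => LinearMap.mk₄ (fun x₂ => LinearMap.mk₃
    (fun y₁ y₂ y₃ => (V.c x₁ x₂ (V.c y₁ y₂ y₃), V.l₅ x₁ x₂ y₁ y₂ y₃))
    (by intros; ext <;> simp) (by intros; ext <;> simp)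
    (by intros; ext <;> simp) (by intros; ext <;> simp)
    (by intros; ext <;> simp) (by intros; ext <;> simp))
    (by intros; ext <;> simp [LinearMap.mk₃]) (by intros; ext <;> simp [LinearMap.mk₃]))
    (by intros; ext <;> simp [LinearMap.mk₃, LinearMap.mk₄])
    (by intros; ext <;> simp [LinearMap.mk₃, LinearMap.mk₄]) :
    V.V₀ →ₗ[K] V.V₀ →ₗ[K] V.V₀ →ₗ[K] V.V₀ →ₗ[K] V.V₀ →ₗ[K] V.V₀ × V.V₁)

/-- The target is the source plus `d l₃`. Skew-symmetry turns the cyclic sum in `d_l₃` into target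
minus source of `J₃`. -/
theorem t_J₃ (x₁ x₂ x₃ : V.V₀) : V.toBracket.t (V.J₃ x₁ x₂ x₃) =
    V.b (V.b x₁ x₂) x₃ + V.b x₂ (V.b x₁ x₃) + V.c x₁ x₂ x₃ + V.c x₃ x₁ x₂ := by
  change V.b x₁ (V.b x₂ x₃) + V.c x₃ x₂ x₁ + V.d (V.l₃ x₁ x₂ x₃) = _
  rw [V.d_l₃, V.b_skew x₁ (V.b x₂ x₃), V.c_skew x₃ x₂ x₁, V.b_skew x₂ (V.b x₁ x₃),
    V.b_skew x₁ x₃, map_neg, LinearMap.neg_apply]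
  abel

theorem t_Jhat (x₁ x₂ x₃ y : V.V₀) : V.toBracket.t (V.Jhat x₁ x₂ x₃ y) =
    V.c (V.b x₁ x₂) x₃ y + V.c x₂ (V.b x₁ x₃) y := by
  change V.c x₁ (V.b x₂ x₃) y + V.d (V.lhat x₁ x₂ x₃ y) = _
  rw [V.d_lhat, V.c_skew x₁ (V.b x₂ x₃), V.c_skew x₂ (V.b x₁ x₃),
    V.b_skew x₁ x₃, map_neg, LinearMap.neg_apply, LinearMap.neg_apply]
  abel

theorem t_Jtilde (x₁ x₂ y₁ y₂ : V.V₀) : V.toBracket.t (V.Jtilde x₁ x₂ y₁ y₂) =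
    V.b (V.c x₁ x₂ y₁) y₂ + V.b y₁ (V.c x₁ x₂ y₂) := by
  change V.c x₁ x₂ (V.b y₁ y₂) + V.d (V.ltilde x₁ x₂ y₁ y₂) = _
  rw [V.d_ltilde]
  abel

theorem t_J₅ (x₁ x₂ y₁ y₂ y₃ : V.V₀) : V.toBracket.t (V.J₅ x₁ x₂ y₁ y₂ y₃) =
    V.c (V.c x₁ x₂ y₁) y₂ y₃ + V.c y₁ (V.c x₁ x₂ y₂) y₃ + V.c y₁ y₂ (V.c x₁ x₂ y₃) := by
  change V.c x₁ x₂ (V.c y₁ y₂ y₃) + V.d (V.l₅ x₁ x₂ y₁ y₂ y₃) = _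
  rw [V.d_l₅]
  abel

@[simp] theorem bracket_o₂ (x y : V.V₀) : V.toBracket.br.obj x y = V.b x y := rfl
@[simp] theorem bracket_o₃ (x y z : V.V₀) : V.toBracket.tr.obj x y z = V.c x y z := rfl

/-- The three one-variable conditions of `isNaturalJ₃_iff` are `l₃_d₁`, `l₃_d₂` and `l₃_d₃`, up to
the signs between the cyclic form of `E` and the form target minus source. -/
theorem isNatural_J₃ : V.toBracket.IsNaturalJ₃ V.J₃ := by
  refine BracketTwoVectorSpace.isNaturalJ₃_iff.2
    ⟨fun _ _ _ => rfl, V.t_J₃, fun f (x₂ x₃ : V.V₀) h => ?_, fun (x₁ : V.V₀) f (x₃ : V.V₀) h => ?_,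
      fun (x₁ x₂ : V.V₀) f h => ?_⟩ <;> obtain ⟨w, rfl⟩ := V.exists_inr_eq h <;>
    simp only [t_inr, arr_eq, BracketTwoVectorSpace.o₂, BracketTwoVectorSpace.o₃, bracket_o₂,
      bracket_o₃, bracket_b₁, bracket_b₂, bracket_c₁, bracket_c₂, bracket_c₃, ← map_add] <;>
    congr 1
  · change _ + V.l₃ (V.d w) x₂ x₃ = _
    rw [V.l₃_d₁, V.c₃_skew x₃ x₂, V.b₂_skew (V.b x₂ x₃), V.b₂_skew x₂, V.b₂_skew x₃, map_neg,
      LinearMap.neg_apply]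
    abel
  · change _ + V.l₃ x₁ (V.d w) x₃ = _
    rw [V.l₃_d₂, V.b₂_skew x₁ (V.b₁ w x₃), V.c₁_skew w x₃, V.b₂_skew (V.b x₃ x₁),
      V.b_skew x₃ x₁, map_neg]
    abel
  · change _ + V.l₃ x₁ x₂ (V.d w) = _
    rw [V.l₃_d₃, V.b₂_skew x₁ (V.b₂ x₂ w), V.b₂_skew x₂ (V.b₂ x₁ w), V.b₂_skew x₁ w, map_neg,
      LinearMap.neg_apply, V.c₁_skew w x₂]
    abel

theorem isNatural_Jhat : V.toBracket.IsNaturalJhat V.Jhat := by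
  refine BracketTwoVectorSpace.isNaturalJhat_iff.2
    ⟨fun _ _ _ _ => rfl, V.t_Jhat, fun f (x₂ x₃ y : V.V₀) h => ?_,
      fun (x₁ : V.V₀) f (x₃ y : V.V₀) h => ?_, fun (x₁ x₂ : V.V₀) f (y : V.V₀) h => ?_,
      fun (x₁ x₂ x₃ : V.V₀) f h => ?_⟩ <;> obtain ⟨w, rfl⟩ := V.exists_inr_eq h <;>
    simp only [t_inr, arr_eq, BracketTwoVectorSpace.o₂, BracketTwoVectorSpace.o₃, bracket_o₂,
      bracket_o₃, bracket_b₁, bracket_b₂, bracket_c₁, bracket_c₂, bracket_c₃, ← map_add] <;>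
    congr 1
  · change _ + V.lhat (V.d w) x₂ x₃ y = _
    rw [V.lhat_d₁, V.c₁_skew w (V.b x₂ x₃), V.b₂_skew x₃, map_neg, LinearMap.neg_apply,
      LinearMap.neg_apply, V.c₁_skew (V.b₁ w x₃)]
    abel
  · change _ + V.lhat x₁ (V.d w) x₃ y = _
    rw [V.lhat_d₂, V.c₁_skew (V.b₁ w x₃), V.c₁_skew w (V.b x₁ x₃), V.b_skew x₃ x₁, map_neg,
      LinearMap.neg_apply, LinearMap.neg_apply]
    abel
  · change _ + V.lhat x₁ x₂ (V.d w) y = _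
    rw [V.lhat_d₃, V.c₁_skew (V.b₂ x₂ w), V.c₁_skew (V.b₁ w x₁), V.b₂_skew x₁ w, map_neg,
      LinearMap.neg_apply]
    abel
  · change _ + V.lhat x₁ x₂ x₃ (V.d w) = _
    rw [V.lhat_d₄, V.c₃_skew x₁ (V.b x₂ x₃), V.c₃_skew x₂ (V.b x₁ x₃), V.b_skew x₃ x₁, map_neg,
      LinearMap.neg_apply, LinearMap.neg_apply]
    abel

/-- Here, as for `J₅`, the homotopy axioms already read target minus source, so no skew-symmetry is
needed. -/
theorem isNatural_Jtilde : V.toBracket.IsNaturalJtilde V.Jtilde := by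
  refine BracketTwoVectorSpace.isNaturalJtilde_iff.2
    ⟨fun _ _ _ _ => rfl, V.t_Jtilde, fun f (x₂ y₁ y₂ : V.V₀) h => ?_,
      fun (x₁ : V.V₀) f (y₁ y₂ : V.V₀) h => ?_, fun (x₁ x₂ : V.V₀) f (y₂ : V.V₀) h => ?_,
      fun (x₁ x₂ y₁ : V.V₀) f h => ?_⟩ <;> obtain ⟨w, rfl⟩ := V.exists_inr_eq h <;>
    simp only [t_inr, arr_eq, BracketTwoVectorSpace.o₂, BracketTwoVectorSpace.o₃, bracket_o₂,
      bracket_o₃, bracket_b₁, bracket_b₂, bracket_c₁, bracket_c₂, bracket_c₃, ← map_add] <;>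
    congr 1
  · change _ + V.ltilde (V.d w) x₂ y₁ y₂ = _
    rw [V.ltilde_d₁]
    abel
  · change _ + V.ltilde x₁ (V.d w) y₁ y₂ = _
    rw [V.ltilde_d₂]
    abel
  · change _ + V.ltilde x₁ x₂ (V.d w) y₂ = _
    rw [V.ltilde_d₃]
    abel
  · change _ + V.ltilde x₁ x₂ y₁ (V.d w) = _
    rw [V.ltilde_d₄]
    abel

theorem isNatural_J₅ : V.toBracket.IsNaturalJ₅ V.J₅ := by
  refine BracketTwoVectorSpace.isNaturalJ₅_iff.2
    ⟨fun _ _ _ _ _ => rfl, V.t_J₅, fun f (x₂ y₁ y₂ y₃ : V.V₀) h => ?_,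
      fun (x₁ : V.V₀) f (y₁ y₂ y₃ : V.V₀) h => ?_, fun (x₁ x₂ : V.V₀) f (y₂ y₃ : V.V₀) h => ?_,
      fun (x₁ x₂ y₁ : V.V₀) f (y₃ : V.V₀) h => ?_, fun (x₁ x₂ y₁ y₂ : V.V₀) f h => ?_⟩ <;>
    obtain ⟨w, rfl⟩ := V.exists_inr_eq h <;>
    simp only [t_inr, arr_eq, BracketTwoVectorSpace.o₂, BracketTwoVectorSpace.o₃, bracket_o₂,
      bracket_o₃, bracket_b₁, bracket_b₂, bracket_c₁, bracket_c₂, bracket_c₃, ← map_add] <;>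
    congr 1
  · change _ + V.l₅ (V.d w) x₂ y₁ y₂ y₃ = _
    rw [V.l₅_d₁]
    abel
  · change _ + V.l₅ x₁ (V.d w) y₁ y₂ y₃ = _
    rw [V.l₅_d₂]
    abel
  · change _ + V.l₅ x₁ x₂ (V.d w) y₂ y₃ = _
    rw [V.l₅_d₃]
    abel
  · change _ + V.l₅ x₁ x₂ y₁ (V.d w) y₃ = _
    rw [V.l₅_d₄]
    abel
  · change _ + V.l₅ x₁ x₂ y₁ y₂ (V.d w) = _
    rw [V.l₅_d₅]
    abel

/-- The Lie triple 2-algebra of a 2-term L∞-triple algebra. -/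
def toLieTriple2Algebra : LieTriple2Algebra.{u, v} K where
  toBracketTwoVectorSpace := V.toBracket
  J₃ := V.J₃
  Jhat := V.Jhat
  Jtilde := V.Jtilde
  J₅ := V.J₅
  isNatural_J₃ := V.isNatural_J₃
  isNatural_Jhat := V.isNatural_Jhat
  isNatural_Jtilde := V.isNatural_Jtilde
  isNatural_J₅ := V.isNatural_J₅
  coherence₁ := by
    -- In arrow form the hexagon is the image under `inr` of the algebraic coherence identity;
    -- likewise for the other three.
    refine (BracketTwoVectorSpace.coherence₁_iff V.isNatural_J₃ V.isNatural_Jtilde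
      V.isNatural_J₅).2 fun (x₁ x₂ y₁ y₂ y₃ : V.V₀) => ?_
    simp only [BracketTwoVectorSpace.o₂, BracketTwoVectorSpace.o₃, bracket_o₂, bracket_o₃,
      arr_eq, bracket_b₁, bracket_b₂, bracket_c₃, ← map_add]
    exact congrArg V.inr (V.coherence₁ x₁ x₂ y₁ y₂ y₃)
  coherence₂ := by
    refine (BracketTwoVectorSpace.coherence₂_iff V.isNatural_Jhat V.isNatural_Jtilde
      V.isNatural_J₅).2 fun (x₁ x₂ y₁ y₂ y₃ z : V.V₀) => ?_
    simp only [BracketTwoVectorSpace.o₂, BracketTwoVectorSpace.o₃, bracket_o₂, bracket_o₃,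
      arr_eq, bracket_c₁, bracket_c₂, bracket_c₃, ← map_add]
    exact congrArg V.inr (V.coherence₂ x₁ x₂ y₁ y₂ y₃ z)
  coherence₃ := by
    refine (BracketTwoVectorSpace.coherence₃_iff V.isNatural_Jtilde
      V.isNatural_J₅).2 fun (x₁ x₂ y₁ y₂ z₁ z₂ : V.V₀) => ?_
    simp only [BracketTwoVectorSpace.o₂, BracketTwoVectorSpace.o₃, bracket_o₂, bracket_o₃,
      arr_eq, bracket_b₁, bracket_b₂, bracket_c₃, ← map_add]
    exact congrArg V.inr (V.coherence₃ x₁ x₂ y₁ y₂ z₁ z₂)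
  coherence₄ := by
    refine (BracketTwoVectorSpace.coherence₄_iff
      V.isNatural_J₅).2 fun (x₁ x₂ y₁ y₂ z₁ z₂ z₃ : V.V₀) => ?_
    simp only [BracketTwoVectorSpace.o₂, BracketTwoVectorSpace.o₃, bracket_o₂, bracket_o₃,
      arr_eq, bracket_c₁, bracket_c₂, bracket_c₃, ← map_add]
    exact congrArg V.inr (V.coherence₄ x₁ x₂ y₁ y₂ z₁ z₂ z₃)

theorem d_snd (f : V.toBracket.Mor) : V.d (V.snd f) = V.toBracket.t f - V.toBracket.s f :=
  (add_sub_cancel_left (G := V.V₀) f.1 (V.d f.2)).symm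

theorem mor_ext {f g : V.toBracket.Mor} (h : V.toBracket.s f = V.toBracket.s g)
    (h' : V.snd f = V.snd g) : f = g := Prod.ext h h'

end TwoTermLInfTriple

/-! ### From homomorphisms of 2-term algebras to homomorphisms of Lie triple 2-algebras. -/

namespace TwoTermHom

open BracketTwoVectorSpace

variable {K : Type u} [Field K] {V W : TwoTermLInfTriple.{u, v} K} (φ : TwoTermHom V W)

/-- The linear functor of a homomorphism. -/
def toFunctor : LinearFunctor V.toBracket.toTwoVectorSpace W.toBracket.toTwoVectorSpace :=
  (twoVectorSpaceOfComplex K).map ((TwoTermLInfTriple.toComplex K).map φ)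

@[simp] theorem toFunctor_F₀ (x : V.V₀) : φ.toFunctor.F₀ x = φ.φ₀ x := rfl

@[simp] theorem toFunctor_F₁_inr (w : V.V₁) : φ.toFunctor.F₁ (V.inr w) = W.inr (φ.φ₁ w) := by
  change (φ.φ₀ 0, φ.φ₁ w) = (0, φ.φ₁ w)
  rw [map_zero]

/-- The source is dictated and `φ₂` is the arrow part; `d_φ₂` then says that the target is correct.
-/
def F₂ : V.toBracket.Obj →ₗ[K] V.toBracket.Obj →ₗ[K] W.toBracket.Mor :=
  (LinearMap.mk₂ K (fun x y => (W.b (φ.φ₀ x) (φ.φ₀ y), φ.φ₂ x y))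
    (by intros; ext <;> simp) (by intros; ext <;> simp)
    (by intros; ext <;> simp) (by intros; ext <;> simp) :
    V.V₀ →ₗ[K] V.V₀ →ₗ[K] W.V₀ × W.V₁)

def F₃ : V.toBracket.Obj →ₗ[K] V.toBracket.Obj →ₗ[K] V.toBracket.Obj →ₗ[K] W.toBracket.Mor :=
  (LinearMap.mk₃ (fun x y z => (W.c (φ.φ₀ x) (φ.φ₀ y) (φ.φ₀ z), φ.φ₃ x y z))
    (by intros; ext <;> simp) (by intros; ext <;> simp)
    (by intros; ext <;> simp) (by intros; ext <;> simp)
    (by intros; ext <;> simp) (by intros; ext <;> simp) :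
    V.V₀ →ₗ[K] V.V₀ →ₗ[K] V.V₀ →ₗ[K] W.V₀ × W.V₁)

theorem t_F₂ (x y : V.V₀) : W.toBracket.t (φ.F₂ x y) = φ.φ₀ (V.b x y) := by
  change W.b (φ.φ₀ x) (φ.φ₀ y) + W.d (φ.φ₂ x y) = φ.φ₀ (V.b x y)
  rw [φ.d_φ₂, add_sub_cancel]

theorem t_F₃ (x y z : V.V₀) : W.toBracket.t (φ.F₃ x y z) = φ.φ₀ (V.c x y z) := by
  change W.c (φ.φ₀ x) (φ.φ₀ y) (φ.φ₀ z) + W.d (φ.φ₃ x y z) = φ.φ₀ (V.c x y z)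
  rw [φ.d_φ₃, add_sub_cancel]

/-- The homomorphism of Lie triple 2-algebras of a homomorphism of 2-term L∞-triple algebras. -/
def toLieTriple2Hom : LieTriple2Hom V.toLieTriple2Algebra W.toLieTriple2Algebra where
  toLinearFunctor := φ.toFunctor
  F₂ := φ.F₂
  F₃ := φ.F₃
  s_F₂ _ _ := rfl
  t_F₂ := φ.t_F₂
  natural_F₂ := by
    refine (natural₂_iff (L := V.toBracket) (M := W.toBracket) φ.toFunctor
      (fun _ _ => rfl) φ.t_F₂).2 ⟨fun f (x : V.V₀) h => ?_, fun (x : V.V₀) f h => ?_⟩ <;>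
      obtain ⟨w, rfl⟩ := V.exists_inr_eq h <;>
      simp only [toFunctor_F₀, toFunctor_F₁_inr, V.t_inr, V.bracket_b₁, V.bracket_b₂,
        W.bracket_b₁, W.bracket_b₂, W.arr_eq, ← map_add] <;>
      congr 1
    · change _ + φ.φ₂ (V.d w) x = _
      rw [φ.φ₂_d₁, add_sub_cancel]
    · change _ + φ.φ₂ x (V.d w) = _
      rw [φ.φ₂_d₂, add_sub_cancel]
  s_F₃ _ _ _ := rfl
  t_F₃ := φ.t_F₃
  natural_F₃ := by
    refine (natural₃_iff (L := V.toBracket) (M := W.toBracket) φ.toFunctor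
      (fun _ _ _ => rfl) φ.t_F₃).2 ⟨fun f (x y : V.V₀) h => ?_,
        fun (x : V.V₀) f (y : V.V₀) h => ?_, fun (x y : V.V₀) f h => ?_⟩ <;>
      obtain ⟨w, rfl⟩ := V.exists_inr_eq h <;>
      simp only [toFunctor_F₀, toFunctor_F₁_inr, V.t_inr, V.bracket_c₁, V.bracket_c₂,
        V.bracket_c₃, W.bracket_c₁, W.bracket_c₂, W.bracket_c₃, W.arr_eq, ← map_add] <;>
      congr 1
    · change _ + φ.φ₃ (V.d w) x y = _
      rw [φ.φ₃_d₁, add_sub_cancel]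
    · change _ + φ.φ₃ x (V.d w) y = _
      rw [φ.φ₃_d₂, add_sub_cancel]
    · change _ + φ.φ₃ x y (V.d w) = _
      rw [φ.φ₃_d₃, add_sub_cancel]
  compat_J₃ := by
    refine (compatJ₃_iff φ.toFunctor V.isNatural_J₃ W.isNatural_J₃ (fun _ _ => rfl)
      φ.t_F₂ (fun _ _ _ => rfl)
      φ.t_F₃).2 fun (x y z : V.V₀) => ?_
    simp only [toFunctor_F₀, toFunctor_F₁_inr, V.arr_eq,
      W.arr_eq, W.bracket_b₁, W.bracket_b₂, ← map_add]
    exact congrArg W.inr (φ.compat_l₃ x y z)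
  compat_J₅ := by
    refine (compatJ₅_iff φ.toFunctor V.isNatural_J₅ W.isNatural_J₅ (fun _ _ _ => rfl)
      φ.t_F₃).2 fun (x₁ x₂ y₁ y₂ y₃ : V.V₀) => ?_
    simp only [toFunctor_F₀, toFunctor_F₁_inr, V.arr_eq,
      W.arr_eq, W.bracket_c₁, W.bracket_c₂, W.bracket_c₃, ← map_add]
    exact congrArg W.inr (φ.compat_l₅ x₁ x₂ y₁ y₂ y₃)

end TwoTermHom

/-! ### Recovering a homomorphism of 2-term algebras from arrow parts. -/

namespace LieTriple2Hom

open BracketTwoVectorSpace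

variable {K : Type u} [Field K] {V W : TwoTermLInfTriple.{u, v} K}
  (F : LieTriple2Hom V.toLieTriple2Algebra W.toLieTriple2Algebra)

def φ₀ : V.V₀ →ₗ[K] W.V₀ := F.F₀
def φ₁ : V.V₁ →ₗ[K] W.V₁ := W.snd ∘ₗ F.F₁ ∘ₗ V.inr
def φ₂ : V.V₀ →ₗ[K] V.V₀ →ₗ[K] W.V₁ := LinearMap.compRight K W.snd ∘ₗ F.F₂
def φ₃ : V.V₀ →ₗ[K] V.V₀ →ₗ[K] V.V₀ →ₗ[K] W.V₁ :=
  LinearMap.compRight K (LinearMap.compRight K W.snd) ∘ₗ F.F₃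

/-- The linear functor underlying `F`. -/
def functor : LinearFunctor V.toBracket.toTwoVectorSpace W.toBracket.toTwoVectorSpace :=
  F.toLinearFunctor

@[simp] theorem functor_F₀ (x : V.V₀) : F.functor.F₀ x = F.φ₀ x := rfl

-- A functor preserves sources, so it maps `ker s` into `ker s`, and no `V₀`-component appears.
@[simp] theorem functor_F₁_inr (w : V.V₁) : F.functor.F₁ (V.inr w) = W.inr (F.φ₁ w) := by
  refine W.mor_ext ?_ rfl
  rw [F.functor.s_F₁, V.s_inr, W.s_inr, map_zero]

/-- The homomorphism of 2-term L∞-triple algebras underlying a homomorphism of the associated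
Lie triple 2-algebras. -/
def toTwoTermHom : TwoTermHom V W where
  φ₀ := F.φ₀
  φ₁ := F.φ₁
  φ₂ := F.φ₂
  φ₃ := F.φ₃
  φ_d w := by
    have h := F.functor.t_F₁ (V.inr w)
    rw [functor_F₁_inr, V.t_inr, W.t_inr] at h
    exact h.symm
  -- `d` of an arrow part is target minus source.
  d_φ₂ x y := (W.d_snd _).trans (congrArg₂ (fun a b : W.V₀ => a - b) (F.t_F₂ x y) (F.s_F₂ x y))
  φ₂_d₁ w x := by
    -- Naturality at one arrow and one identity is an equation in the image of `inr`, which is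
    -- injective.
    have h := ((natural₂_iff (L := V.toBracket) (M := W.toBracket) F.functor F.s_F₂
      F.t_F₂).1 F.natural_F₂).1 (V.inr w) x (V.s_inr w)
    simp only [V.t_inr, V.bracket_b₁, functor_F₀, functor_F₁_inr, W.bracket_b₁, W.arr_eq,
      ← map_add] at h
    exact eq_sub_of_add_eq' (W.inr_injective h)
  φ₂_d₂ x w := by
    have h := ((natural₂_iff (L := V.toBracket) (M := W.toBracket) F.functor F.s_F₂
      F.t_F₂).1 F.natural_F₂).2 x (V.inr w) (V.s_inr w)
    simp only [V.t_inr, V.bracket_b₂, functor_F₀, functor_F₁_inr, W.bracket_b₂, W.arr_eq,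
      ← map_add] at h
    exact eq_sub_of_add_eq' (W.inr_injective h)
  d_φ₃ x y z :=
    (W.d_snd _).trans (congrArg₂ (fun a b : W.V₀ => a - b) (F.t_F₃ x y z) (F.s_F₃ x y z))
  φ₃_d₁ w x y := by
    have h := ((natural₃_iff (L := V.toBracket) (M := W.toBracket) F.functor F.s_F₃
      F.t_F₃).1 F.natural_F₃).1 (V.inr w) x y (V.s_inr w)
    simp only [V.t_inr, V.bracket_c₁, functor_F₀, functor_F₁_inr, W.bracket_c₁, W.arr_eq,
      ← map_add] at h
    exact eq_sub_of_add_eq' (W.inr_injective h)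
  φ₃_d₂ x w y := by
    have h := ((natural₃_iff (L := V.toBracket) (M := W.toBracket) F.functor F.s_F₃
      F.t_F₃).1 F.natural_F₃).2.1 x (V.inr w) y (V.s_inr w)
    simp only [V.t_inr, V.bracket_c₂, functor_F₀, functor_F₁_inr, W.bracket_c₂, W.arr_eq,
      ← map_add] at h
    exact eq_sub_of_add_eq' (W.inr_injective h)
  φ₃_d₃ x y w := by
    have h := ((natural₃_iff (L := V.toBracket) (M := W.toBracket) F.functor F.s_F₃
      F.t_F₃).1 F.natural_F₃).2.2 x y (V.inr w) (V.s_inr w)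
    simp only [V.t_inr, V.bracket_c₃, functor_F₀, functor_F₁_inr, W.bracket_c₃, W.arr_eq,
      ← map_add] at h
    exact eq_sub_of_add_eq' (W.inr_injective h)
  compat_l₃ x y z := by
    have h := (compatJ₃_iff (L := V.toBracket) (M := W.toBracket) (F₂ := F.F₂) (F₃ := F.F₃)
      F.functor V.isNatural_J₃ W.isNatural_J₃ F.s_F₂ F.t_F₂ F.s_F₃ F.t_F₃).1
      F.compat_J₃ x y z
    simp only [V.arr_eq, W.arr_eq, functor_F₀, functor_F₁_inr, W.bracket_b₁, W.bracket_b₂,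
      ← map_add] at h
    exact W.inr_injective h
  compat_l₅ x₁ x₂ y₁ y₂ y₃ := by
    have h := (compatJ₅_iff (L := V.toBracket) (M := W.toBracket) (F₃ := F.F₃)
      F.functor V.isNatural_J₅ W.isNatural_J₅ F.s_F₃ F.t_F₃).1
      F.compat_J₅ x₁ x₂ y₁ y₂ y₃
    simp only [V.arr_eq, W.arr_eq, functor_F₀, functor_F₁_inr, W.bracket_c₁, W.bracket_c₂,
      W.bracket_c₃, ← map_add] at h
    exact W.inr_injective h

end LieTriple2Hom

/-! ### The comparison functor and its full faithfulness. -/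

/-- The functor from 2-term L∞-triple algebras to Lie triple 2-algebras. -/
def lieTriple2AlgebraFunctor (K : Type u) [Field K] :
    TwoTermLInfTriple.{u, v} K ⥤ LieTriple2Algebra.{u, v} K where
  obj V := V.toLieTriple2Algebra
  map φ := TwoTermHom.toLieTriple2Hom φ
  map_id _ := LieTriple2Hom.ext rfl rfl (LinearMap.ext₂ fun _ _ => rfl)
    (LinearMap.ext fun _ => LinearMap.ext₂ fun _ _ => rfl)
  -- Composition in `ofLinearMap` keeps the first source and adds `V₁`-parts, so composing `F₂`'s or
  -- `F₃`'s is definitionally the formula for composite `φ₂` or `φ₃`.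
  map_comp _ _ := LieTriple2Hom.ext rfl rfl (LinearMap.ext₂ fun _ _ => rfl)
    (LinearMap.ext fun _ => LinearMap.ext₂ fun _ _ => rfl)

/-- Each component of `φ` is definitionally the corresponding arrow part of its image. -/
theorem TwoTermHom.toLieTriple2Hom_injective {K : Type u} [Field K]
    {V W : TwoTermLInfTriple.{u, v} K} :
    Function.Injective (TwoTermHom.toLieTriple2Hom : TwoTermHom V W → _) := by
  intro φ ψ h
  refine TwoTermHom.ext ?_ ?_ ?_ ?_
  · exact congrArg LieTriple2Hom.φ₀ h
  · exact congrArg LieTriple2Hom.φ₁ h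
  · exact congrArg LieTriple2Hom.φ₂ h
  · exact congrArg LieTriple2Hom.φ₃ h

/-- A morphism is known from its source and its `V₁`-part. The sources are imposed by the axioms of
a homomorphism, so passing to arrow parts loses nothing. -/
theorem LieTriple2Hom.toLieTriple2Hom_toTwoTermHom {K : Type u} [Field K]
    {V W : TwoTermLInfTriple.{u, v} K}
    (F : LieTriple2Hom V.toLieTriple2Algebra W.toLieTriple2Algebra) :
    F.toTwoTermHom.toLieTriple2Hom = F := by
  refine LieTriple2Hom.ext rfl (LinearMap.ext fun (f : V.toBracket.Mor) => ?_)
    (LinearMap.ext₂ fun x y => ?_)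
    (LinearMap.ext fun x => LinearMap.ext₂ fun y z => ?_)
  · refine W.mor_ext (F.s_F₁ f).symm ?_
    have h : f = V.toBracket.one (V.toBracket.s f) + V.inr (V.snd f) := by
      rw [← V.arr_eq, ← TwoVectorSpace.eq_one_add_arr]
    change W.snd (F.functor.F₁ (V.inr (V.snd f))) = W.snd (F.functor.F₁ f)
    conv_rhs => rw [h]
    rw [map_add, map_add, F.functor.F₁_one, W.snd_one, zero_add]
  · exact W.mor_ext (F.s_F₂ x y).symm rfl
  · exact W.mor_ext (F.s_F₃ x y z).symm rfl

instance (K : Type u) [Field K] : (lieTriple2AlgebraFunctor.{u, v} K).Faithful where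
  map_injective h := TwoTermHom.toLieTriple2Hom_injective h

instance (K : Type u) [Field K] : (lieTriple2AlgebraFunctor.{u, v} K).Full where
  map_surjective F := ⟨LieTriple2Hom.toTwoTermHom F, LieTriple2Hom.toLieTriple2Hom_toTwoTermHom F⟩

/-! ### The 2-term L∞-triple algebra on `t : ker s → L₀`. -/

namespace TwoVectorSpace

variable {K : Type u} [Field K] (C : TwoVectorSpace.{u, v} K)

/-- The projection of the morphisms onto the kernel of the source map. -/
def toKer : C.Mor →ₗ[K] LinearMap.ker C.s := C.arr.codRestrict _ C.s_arr

@[simp] theorem coe_toKer (f : C.Mor) : (C.toKer f : C.Mor) = C.arr f := rfl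

end TwoVectorSpace

namespace LieTriple2Algebra

open BracketTwoVectorSpace

variable {K : Type u} [Field K] (L : LieTriple2Algebra.{u, v} K)

theorem arr_coe (w : LinearMap.ker L.s) : L.arr (w : L.Mor) = w :=
  TwoVectorSpace.arr_of_s_eq_zero _ w.2

/-- Composing with `toKer` puts the values in `ker s`. For these brackets it changes nothing, since
a bracket with an argument in `ker s` already lies there. For the `J`'s it discards the source,
which is known from naturality. -/
def kerB₁ : LinearMap.ker L.s →ₗ[K] L.Obj →ₗ[K] LinearMap.ker L.s :=
  (L.b₁ ∘ₗ (LinearMap.ker L.s).subtype).compr₂ L.toKer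
def kerB₂ : L.Obj →ₗ[K] LinearMap.ker L.s →ₗ[K] LinearMap.ker L.s :=
  (L.b₂.compl₂ (LinearMap.ker L.s).subtype).compr₂ L.toKer
def kerC₁ : LinearMap.ker L.s →ₗ[K] L.Obj →ₗ[K] L.Obj →ₗ[K] LinearMap.ker L.s :=
  (L.c₁ ∘ₗ (LinearMap.ker L.s).subtype).compr₂ (LinearMap.compRight K L.toKer)
def kerC₂ : L.Obj →ₗ[K] LinearMap.ker L.s →ₗ[K] L.Obj →ₗ[K] LinearMap.ker L.s :=
  (L.c₂.compl₂ (LinearMap.ker L.s).subtype).compr₂ (LinearMap.compRight K L.toKer)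
def kerC₃ : L.Obj →ₗ[K] L.Obj →ₗ[K] LinearMap.ker L.s →ₗ[K] LinearMap.ker L.s :=
  L.c₃.compr₂ (LinearMap.compRight K L.toKer ∘ₗ LinearMap.lcomp K L.Mor (LinearMap.ker L.s).subtype)
def kerJ₃ : L.Obj →ₗ[K] L.Obj →ₗ[K] L.Obj →ₗ[K] LinearMap.ker L.s :=
  L.J₃.compr₂ (LinearMap.compRight K L.toKer)
def kerJhat : L.Obj →ₗ[K] L.Obj →ₗ[K] L.Obj →ₗ[K] L.Obj →ₗ[K] LinearMap.ker L.s :=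
  L.Jhat.compr₂ (LinearMap.compRight K (LinearMap.compRight K L.toKer))
def kerJtilde : L.Obj →ₗ[K] L.Obj →ₗ[K] L.Obj →ₗ[K] L.Obj →ₗ[K] LinearMap.ker L.s :=
  L.Jtilde.compr₂ (LinearMap.compRight K (LinearMap.compRight K L.toKer))
def kerJ₅ : L.Obj →ₗ[K] L.Obj →ₗ[K] L.Obj →ₗ[K] L.Obj →ₗ[K] L.Obj →ₗ[K] LinearMap.ker L.s :=
  L.J₅.compr₂ (LinearMap.compRight K (LinearMap.compRight K (LinearMap.compRight K L.toKer)))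

@[simp] theorem coe_kerB₁ (w x) : (L.kerB₁ w x : L.Mor) = L.b₁ w x := by
  change L.arr (L.b₁ w x) = _
  rw [L.arr_b₁, arr_coe]
@[simp] theorem coe_kerB₂ (x w) : (L.kerB₂ x w : L.Mor) = L.b₂ x w := by
  change L.arr (L.b₂ x w) = _
  rw [L.arr_b₂, arr_coe]
@[simp] theorem coe_kerC₁ (w x y) : (L.kerC₁ w x y : L.Mor) = L.c₁ w x y := by
  change L.arr (L.c₁ w x y) = _
  rw [L.arr_c₁, arr_coe]
@[simp] theorem coe_kerC₂ (x w y) : (L.kerC₂ x w y : L.Mor) = L.c₂ x w y := by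
  change L.arr (L.c₂ x w y) = _
  rw [L.arr_c₂, arr_coe]
@[simp] theorem coe_kerC₃ (x y w) : (L.kerC₃ x y w : L.Mor) = L.c₃ x y w := by
  change L.arr (L.c₃ x y w) = _
  rw [L.arr_c₃, arr_coe]
@[simp] theorem coe_kerJ₃ (x y z) : (L.kerJ₃ x y z : L.Mor) = L.arr (L.J₃ x y z) := rfl
@[simp] theorem coe_kerJhat (x y z t) :
    (L.kerJhat x y z t : L.Mor) = L.arr (L.Jhat x y z t) := rfl
@[simp] theorem coe_kerJtilde (x y z t) :
    (L.kerJtilde x y z t : L.Mor) = L.arr (L.Jtilde x y z t) := rfl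
@[simp] theorem coe_kerJ₅ (x y z t r) :
    (L.kerJ₅ x y z t r : L.Mor) = L.arr (L.J₅ x y z t r) := rfl

theorem b₂_skew (x f) : L.b₂ x f = - L.b₁ f x := L.br_mor_skew _ _
theorem c₁_skew (f x y) : L.c₁ f x y = - L.c₂ x f y := L.tr_mor_skew _ _ _
theorem c₃_skew (x y f) : L.c₃ x y f = - L.c₃ y x f := L.tr_mor_skew _ _ _

/-- The 2-term L∞-triple algebra of a Lie triple 2-algebra. -/
def toTwoTermLInfTriple : TwoTermLInfTriple.{u, v} K where
  V₀ := L.Obj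
  V₁ := LinearMap.ker L.s
  d := L.t ∘ₗ (LinearMap.ker L.s).subtype
  b := L.br.obj
  b₁ := L.kerB₁
  b₂ := L.kerB₂
  c := L.tr.obj
  c₁ := L.kerC₁
  c₂ := L.kerC₂
  c₃ := L.kerC₃
  l₃ := L.kerJ₃
  lhat := L.kerJhat
  ltilde := L.kerJtilde
  l₅ := L.kerJ₅
  b_skew := L.br_obj_skew
  b₂_skew x w := Subtype.ext (by simp [L.b₂_skew])
  c_skew := L.tr_obj_skew
  c₃_skew x y w := Subtype.ext (by simpa using L.c₃_skew x y w)
  c₁_skew w x y := Subtype.ext (by simp [L.c₁_skew])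
  d_b₂ x w := by simp
  -- Both sides equal the bracket `[w, u]` of two morphisms in `ker s`, evaluated by letting one or
  -- the other argument be seen through its target. The ternary relations that follow hold for the
  -- same reason.
  b_d w u := Subtype.ext (by
    simp [← L.br_mor_of_s_left w.2, ← L.br_mor_of_s_right u.2])
  d_c₃ x y w := by simp
  d_c₁ w x y := by simp
  c_d₁₂ w u x := Subtype.ext (by
    have h₁ := L.tr_mor_of_s₁ w.2 u (L.one x)
    have h₂ := L.tr_mor_of_s₂ u.2 w (L.one x)
    simp only [L.t_one] at h₁ h₂
    simp [← h₁, ← h₂])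
  c_d₂₃ x w u := Subtype.ext (by
    have h₁ := L.tr_mor_of_s₂ w.2 (L.one x) u
    have h₂ := L.tr_mor_of_s₃ u.2 (L.one x) w
    simp only [L.t_one] at h₁ h₂
    simp [← h₁, ← h₂])
  d_l₃ x₁ x₂ x₃ := by
    -- Target minus source of `J₃`, brought to the cyclic form by skew-symmetry.
    change L.t (L.arr (L.J₃ x₁ x₂ x₃)) = _
    rw [L.t_arr, L.isNatural_J₃.source, L.isNatural_J₃.target]
    simp only [o₂, o₃]
    rw [L.br_obj_skew x₁ (L.br.obj x₂ x₃), L.tr_obj_skew x₃ x₂ x₁,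
      L.br_obj_skew x₂ (L.br.obj x₁ x₃),
      L.br_obj_skew x₁ x₃, map_neg, LinearMap.neg_apply]
    abel
  l₃_d₁ w x₂ x₃ := Subtype.ext (by
    -- Naturality with the arrow `w` in this slot and identities in the others is the homotopy
    -- condition; the remaining homotopy conditions arise likewise, slot by slot.
    have h := (isNaturalJ₃_iff.1 L.isNatural_J₃).2.2.1
      (w : L.Mor) x₂ x₃ w.2
    simp only [o₂, o₃] at h
    simp only [LinearMap.comp_apply, Submodule.subtype_apply, Submodule.coe_add, Submodule.coe_neg,
      coe_kerB₁, coe_kerB₂, coe_kerC₁, coe_kerC₂, coe_kerC₃, coe_kerJ₃]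
    simp only [L.c₃_skew x₃ x₂, L.b₂_skew (L.br.obj x₂ x₃), L.b₂_skew x₂, L.b₂_skew x₃, map_neg,
      LinearMap.neg_apply] at h ⊢
    linear_combination (norm := abel) h)
  l₃_d₂ x₁ w x₃ := Subtype.ext (by
    have h := (isNaturalJ₃_iff.1 L.isNatural_J₃).2.2.2.1
      x₁ (w : L.Mor) x₃ w.2
    simp only [o₂, o₃] at h
    simp only [LinearMap.comp_apply, Submodule.subtype_apply, Submodule.coe_add, Submodule.coe_neg,
      coe_kerB₁, coe_kerB₂, coe_kerC₁, coe_kerC₂, coe_kerC₃, coe_kerJ₃]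
    simp only [L.b₂_skew x₁ (L.b₁ w x₃), L.c₁_skew w x₃, L.b₂_skew (L.br.obj x₁ x₃),
      L.br_obj_skew x₃ x₁, map_neg, LinearMap.neg_apply] at h ⊢
    linear_combination (norm := abel) h)
  l₃_d₃ x₁ x₂ w := Subtype.ext (by
    have h := (isNaturalJ₃_iff.1 L.isNatural_J₃).2.2.2.2
      x₁ x₂ (w : L.Mor) w.2
    simp only [o₂, o₃] at h
    simp only [LinearMap.comp_apply, Submodule.subtype_apply, Submodule.coe_add, Submodule.coe_neg,
      coe_kerB₁, coe_kerB₂, coe_kerC₁, coe_kerC₂, coe_kerC₃, coe_kerJ₃]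
    simp only [L.b₂_skew x₁ (L.b₂ x₂ w), L.b₂_skew x₂ (L.b₁ w x₁), L.b₂_skew x₁ w,
      L.c₁_skew w x₂, map_neg, LinearMap.neg_apply] at h ⊢
    linear_combination (norm := abel) h)
  d_lhat x₁ x₂ x₃ y := by
    change L.t (L.arr (L.Jhat x₁ x₂ x₃ y)) = _
    rw [L.t_arr, L.isNatural_Jhat.source, L.isNatural_Jhat.target]
    simp only [o₂, o₃]
    rw [L.tr_obj_skew x₁ (L.br.obj x₂ x₃), L.tr_obj_skew x₂ (L.br.obj x₁ x₃),
      L.br_obj_skew x₁ x₃, map_neg, LinearMap.neg_apply, LinearMap.neg_apply]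
    abel
  lhat_d₁ w x₂ x₃ y := Subtype.ext (by
    have h := (isNaturalJhat_iff.1 L.isNatural_Jhat).2.2.1
      (w : L.Mor) x₂ x₃ y w.2
    simp only [o₂, o₃] at h
    simp only [LinearMap.comp_apply, Submodule.subtype_apply, Submodule.coe_add, Submodule.coe_neg,
      coe_kerB₁, coe_kerB₂, coe_kerC₁, coe_kerC₂, coe_kerC₃, coe_kerJhat]
    simp only [L.c₁_skew w (L.br.obj x₂ x₃), L.b₂_skew x₃, L.c₁_skew (L.b₁ w x₃), map_neg,
      LinearMap.neg_apply] at h ⊢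
    linear_combination (norm := abel) h)
  lhat_d₂ x₁ w x₃ y := Subtype.ext (by
    have h := (isNaturalJhat_iff.1 L.isNatural_Jhat).2.2.2.1
      x₁ (w : L.Mor) x₃ y w.2
    simp only [o₂, o₃] at h
    simp only [LinearMap.comp_apply, Submodule.subtype_apply, Submodule.coe_add, Submodule.coe_neg,
      coe_kerB₁, coe_kerB₂, coe_kerC₁, coe_kerC₂, coe_kerC₃, coe_kerJhat]
    simp only [L.c₁_skew (L.b₁ w x₃), L.c₁_skew w (L.br.obj x₁ x₃), L.br_obj_skew x₃ x₁, map_neg,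
      LinearMap.neg_apply] at h ⊢
    linear_combination (norm := abel) h)
  lhat_d₃ x₁ x₂ w y := Subtype.ext (by
    have h := (isNaturalJhat_iff.1 L.isNatural_Jhat).2.2.2.2.1
      x₁ x₂ (w : L.Mor) y w.2
    simp only [o₂, o₃] at h
    simp only [LinearMap.comp_apply, Submodule.subtype_apply, Submodule.coe_add, Submodule.coe_neg,
      coe_kerB₁, coe_kerB₂, coe_kerC₁, coe_kerC₂, coe_kerC₃, coe_kerJhat]
    simp only [L.c₁_skew (L.b₂ x₂ w), L.c₁_skew (L.b₁ w x₁), L.b₂_skew x₁ w, map_neg,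
      LinearMap.neg_apply] at h ⊢
    linear_combination (norm := abel) h)
  lhat_d₄ x₁ x₂ x₃ w := Subtype.ext (by
    have h := (isNaturalJhat_iff.1 L.isNatural_Jhat).2.2.2.2.2
      x₁ x₂ x₃ (w : L.Mor) w.2
    simp only [o₂, o₃] at h
    simp only [LinearMap.comp_apply, Submodule.subtype_apply, Submodule.coe_add, Submodule.coe_neg,
      coe_kerB₁, coe_kerB₂, coe_kerC₁, coe_kerC₂, coe_kerC₃, coe_kerJhat]
    simp only [L.c₃_skew x₁ (L.br.obj x₂ x₃), L.c₃_skew x₂ (L.br.obj x₁ x₃), L.br_obj_skew x₃ x₁,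
      map_neg, LinearMap.neg_apply] at h ⊢
    linear_combination (norm := abel) h)
  d_ltilde x₁ x₂ y₁ y₂ := by
    change L.t (L.arr (L.Jtilde x₁ x₂ y₁ y₂)) = _
    rw [L.t_arr, L.isNatural_Jtilde.source, L.isNatural_Jtilde.target]
    abel
  ltilde_d₁ w x₂ y₁ y₂ := Subtype.ext (by
    have h := (isNaturalJtilde_iff.1 L.isNatural_Jtilde).2.2.1
      (w : L.Mor) x₂ y₁ y₂ w.2
    simp only [o₂, o₃] at h
    simp only [LinearMap.comp_apply, Submodule.subtype_apply, Submodule.coe_add, Submodule.coe_neg,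
      coe_kerB₁, coe_kerB₂, coe_kerC₁, coe_kerC₂, coe_kerC₃, coe_kerJtilde]
    linear_combination (norm := abel) h)
  ltilde_d₂ x₁ w y₁ y₂ := Subtype.ext (by
    have h := (isNaturalJtilde_iff.1 L.isNatural_Jtilde).2.2.2.1
      x₁ (w : L.Mor) y₁ y₂ w.2
    simp only [o₂, o₃] at h
    simp only [LinearMap.comp_apply, Submodule.subtype_apply, Submodule.coe_add, Submodule.coe_neg,
      coe_kerB₁, coe_kerB₂, coe_kerC₁, coe_kerC₂, coe_kerC₃, coe_kerJtilde]
    linear_combination (norm := abel) h)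
  ltilde_d₃ x₁ x₂ w y₂ := Subtype.ext (by
    have h := (isNaturalJtilde_iff.1 L.isNatural_Jtilde).2.2.2.2.1
      x₁ x₂ (w : L.Mor) y₂ w.2
    simp only [o₂, o₃] at h
    simp only [LinearMap.comp_apply, Submodule.subtype_apply, Submodule.coe_add, Submodule.coe_neg,
      coe_kerB₁, coe_kerB₂, coe_kerC₁, coe_kerC₂, coe_kerC₃, coe_kerJtilde]
    linear_combination (norm := abel) h)
  ltilde_d₄ x₁ x₂ y₁ w := Subtype.ext (by
    have h := (isNaturalJtilde_iff.1 L.isNatural_Jtilde).2.2.2.2.2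
      x₁ x₂ y₁ (w : L.Mor) w.2
    simp only [o₂, o₃] at h
    simp only [LinearMap.comp_apply, Submodule.subtype_apply, Submodule.coe_add, Submodule.coe_neg,
      coe_kerB₁, coe_kerB₂, coe_kerC₁, coe_kerC₂, coe_kerC₃, coe_kerJtilde]
    linear_combination (norm := abel) h)
  d_l₅ x₁ x₂ y₁ y₂ y₃ := by
    change L.t (L.arr (L.J₅ x₁ x₂ y₁ y₂ y₃)) = _
    rw [L.t_arr, L.isNatural_J₅.source, L.isNatural_J₅.target]
    abel
  l₅_d₁ w x₂ y₁ y₂ y₃ := Subtype.ext (by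
    have h := (isNaturalJ₅_iff.1 L.isNatural_J₅).2.2.1
      (w : L.Mor) x₂ y₁ y₂ y₃ w.2
    simp only [o₂, o₃] at h
    simp only [LinearMap.comp_apply, Submodule.subtype_apply, Submodule.coe_add, Submodule.coe_neg,
      coe_kerB₁, coe_kerB₂, coe_kerC₁, coe_kerC₂, coe_kerC₃, coe_kerJ₅]
    linear_combination (norm := abel) h)
  l₅_d₂ x₁ w y₁ y₂ y₃ := Subtype.ext (by
    have h := (isNaturalJ₅_iff.1 L.isNatural_J₅).2.2.2.1
      x₁ (w : L.Mor) y₁ y₂ y₃ w.2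
    simp only [o₂, o₃] at h
    simp only [LinearMap.comp_apply, Submodule.subtype_apply, Submodule.coe_add, Submodule.coe_neg,
      coe_kerB₁, coe_kerB₂, coe_kerC₁, coe_kerC₂, coe_kerC₃, coe_kerJ₅]
    linear_combination (norm := abel) h)
  l₅_d₃ x₁ x₂ w y₂ y₃ := Subtype.ext (by
    have h := (isNaturalJ₅_iff.1 L.isNatural_J₅).2.2.2.2.1
      x₁ x₂ (w : L.Mor) y₂ y₃ w.2
    simp only [o₂, o₃] at h
    simp only [LinearMap.comp_apply, Submodule.subtype_apply, Submodule.coe_add, Submodule.coe_neg,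
      coe_kerB₁, coe_kerB₂, coe_kerC₁, coe_kerC₂, coe_kerC₃, coe_kerJ₅]
    linear_combination (norm := abel) h)
  l₅_d₄ x₁ x₂ y₁ w y₃ := Subtype.ext (by
    have h := (isNaturalJ₅_iff.1 L.isNatural_J₅).2.2.2.2.2.1
      x₁ x₂ y₁ (w : L.Mor) y₃ w.2
    simp only [o₂, o₃] at h
    simp only [LinearMap.comp_apply, Submodule.subtype_apply, Submodule.coe_add, Submodule.coe_neg,
      coe_kerB₁, coe_kerB₂, coe_kerC₁, coe_kerC₂, coe_kerC₃, coe_kerJ₅]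
    linear_combination (norm := abel) h)
  l₅_d₅ x₁ x₂ y₁ y₂ w := Subtype.ext (by
    have h := (isNaturalJ₅_iff.1 L.isNatural_J₅).2.2.2.2.2.2
      x₁ x₂ y₁ y₂ (w : L.Mor) w.2
    simp only [o₂, o₃] at h
    simp only [LinearMap.comp_apply, Submodule.subtype_apply, Submodule.coe_add, Submodule.coe_neg,
      coe_kerB₁, coe_kerB₂, coe_kerC₁, coe_kerC₂, coe_kerC₃, coe_kerJ₅]
    linear_combination (norm := abel) h)
  coherence₁ x₁ x₂ y₁ y₂ y₃ := Subtype.ext (by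
    simpa using (coherence₁_iff L.isNatural_J₃ L.isNatural_Jtilde
      L.isNatural_J₅).1 L.coherence₁
      x₁ x₂ y₁ y₂ y₃)
  coherence₂ x₁ x₂ y₁ y₂ y₃ z := Subtype.ext (by
    simpa using (coherence₂_iff L.isNatural_Jhat L.isNatural_Jtilde
      L.isNatural_J₅).1 L.coherence₂
      x₁ x₂ y₁ y₂ y₃ z)
  coherence₃ x₁ x₂ y₁ y₂ z₁ z₂ := Subtype.ext (by
    simpa using (coherence₃_iff L.isNatural_Jtilde L.isNatural_J₅).1 L.coherence₃
      x₁ x₂ y₁ y₂ z₁ z₂)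
  coherence₄ x₁ x₂ y₁ y₂ z₁ z₂ z₃ := Subtype.ext (by
    simpa using (coherence₄_iff L.isNatural_J₅).1 L.coherence₄
      x₁ x₂ y₁ y₂ z₁ z₂ z₃)

end LieTriple2Algebra

/-! ### Strict homomorphisms and isomorphisms. -/

namespace LieTriple2Hom

open BracketTwoVectorSpace

variable {K : Type u} [Field K] {L M : LieTriple2Algebra.{u, v} K}

/-- A linear functor that strictly preserves the brackets and `J₃`, `J₅`, as a homomorphism. -/
def ofStrict (F : LinearFunctor L.toTwoVectorSpace M.toTwoVectorSpace)
    (h₂ : ∀ f g, F.F₁ (L.br.mor f g) = M.br.mor (F.F₁ f) (F.F₁ g))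
    (h₃ : ∀ f g k, F.F₁ (L.tr.mor f g k) = M.tr.mor (F.F₁ f) (F.F₁ g) (F.F₁ k))
    (hJ₃ : ∀ x y z, F.F₁ (L.J₃ x y z) = M.J₃ (F.F₀ x) (F.F₀ y) (F.F₀ z))
    (hJ₅ : ∀ x₁ x₂ y₁ y₂ y₃, F.F₁ (L.J₅ x₁ x₂ y₁ y₂ y₃) =
      M.J₅ (F.F₀ x₁) (F.F₀ x₂) (F.F₀ y₁) (F.F₀ y₂) (F.F₀ y₃)) :
    LieTriple2Hom L M :=
  -- Preservation on objects is the source of preservation on identity morphisms.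
  have t₂ : ∀ x y, M.br.obj (F.F₀ x) (F.F₀ y) = F.F₀ (L.br.obj x y) := fun x y => by
    simpa [L.br.mor_one, M.br.mor_one, F.F₁_one] using (congrArg M.s (h₂ (L.one x) (L.one y))).symm
  have t₃ : ∀ x y z, M.tr.obj (F.F₀ x) (F.F₀ y) (F.F₀ z) = F.F₀ (L.tr.obj x y z) :=
    fun x y z => by
      simpa [L.tr.mor_one, M.tr.mor_one, F.F₁_one] using
        (congrArg M.s (h₃ (L.one x) (L.one y) (L.one z))).symm
  let F₂ : L.Obj →ₗ[K] L.Obj →ₗ[K] M.Mor := L.br.obj.compr₂ (M.one ∘ₗ F.F₀)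
  let F₃ : L.Obj →ₗ[K] L.Obj →ₗ[K] L.Obj →ₗ[K] M.Mor :=
    L.tr.obj.compr₂ (LinearMap.compRight K (M.one ∘ₗ F.F₀))
  have e₂ : ∀ x y, F₂ x y = M.one (F.F₀ (L.br.obj x y)) := fun _ _ => rfl
  have e₃ : ∀ x y z, F₃ x y z = M.one (F.F₀ (L.tr.obj x y z)) := fun _ _ _ => rfl
  have s_F₂ : ∀ x y, M.s (F₂ x y) = M.o₂ (F.F₀ x) (F.F₀ y) := fun x y => by simp [e₂, t₂]
  have t_F₂ : ∀ x y, M.t (F₂ x y) = F.F₀ (L.o₂ x y) := fun x y => by simp [e₂]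
  have s_F₃ : ∀ x y z, M.s (F₃ x y z) = M.o₃ (F.F₀ x) (F.F₀ y) (F.F₀ z) :=
    fun x y z => by simp [e₃, t₃]
  have t_F₃ : ∀ x y z, M.t (F₃ x y z) = F.F₀ (L.o₃ x y z) := fun x y z => by simp [e₃]
  { toLinearFunctor := F
    F₂ := F₂
    F₃ := F₃
    s_F₂ := s_F₂
    t_F₂ := t_F₂
    -- `F₂` consists of identities, whose arrow parts vanish, so naturality reduces to strict
    -- preservation of the bracket.
    natural_F₂ := (natural₂_iff F s_F₂ t_F₂).2
      ⟨fun w x _ => by simp [e₂, b₁_apply, h₂, F.F₁_one],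
        fun x w _ => by simp [e₂, b₂_apply, h₂, F.F₁_one]⟩
    s_F₃ := s_F₃
    t_F₃ := t_F₃
    natural_F₃ := (natural₃_iff F s_F₃ t_F₃).2
      ⟨fun w x y _ => by simp [e₃, c₁_apply, h₃, F.F₁_one],
        fun x w y _ => by simp [e₃, c₂_apply, h₃, F.F₁_one],
        fun x y w _ => by simp [e₃, c₃_apply, h₃, F.F₁_one]⟩
    -- Homomorphisms are constrained only by `J₃` and `J₅`, so nothing about `Jhat` or `Jtilde` has
    -- to be matched.
    compat_J₃ := (compatJ₃_iff F L.isNatural_J₃ M.isNatural_J₃ s_F₂ t_F₂ s_F₃ t_F₃).2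
      fun x y z => by simp [e₂, e₃, ← F.arr_F₁, hJ₃]
    compat_J₅ := (compatJ₅_iff F L.isNatural_J₅ M.isNatural_J₅ s_F₃ t_F₃).2
      fun x₁ x₂ y₁ y₂ y₃ => by simp [e₃, ← F.arr_F₁, hJ₅] }

/-- The structure morphisms of the composite are composites of identities, hence identities
themselves. -/
theorem ofStrict_comp_ofStrict {F : LinearFunctor L.toTwoVectorSpace M.toTwoVectorSpace}
    {G : LinearFunctor M.toTwoVectorSpace L.toTwoVectorSpace}
    (h₀ : ∀ x, G.F₀ (F.F₀ x) = x) (h₁ : ∀ f, G.F₁ (F.F₁ f) = f) {h₂ h₃ hJ₃ hJ₅ h₂' h₃' hJ₃' hJ₅'} :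
    (ofStrict F h₂ h₃ hJ₃ hJ₅).comp (ofStrict G h₂' h₃' hJ₃' hJ₅') = LieTriple2Hom.id L := by
  refine LieTriple2Hom.ext (LinearMap.ext h₀) (LinearMap.ext h₁)
    (LinearMap.ext₂ fun x y => ?_) (LinearMap.ext fun x => LinearMap.ext₂ fun y z => ?_)
  · refine (L.vcomp_eq _ _ _).trans ?_
    change L.one (G.F₀ (M.br.obj (F.F₀ x) (F.F₀ y))) + G.F₁ (M.one (F.F₀ (L.br.obj x y))) -
      L.one (L.t (L.one (G.F₀ (M.br.obj (F.F₀ x) (F.F₀ y))))) = L.one (L.br.obj x y)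
    rw [L.t_one, add_sub_cancel_left, G.F₁_one, h₀]
  · refine (L.vcomp_eq _ _ _).trans ?_
    change L.one (G.F₀ (M.tr.obj (F.F₀ x) (F.F₀ y) (F.F₀ z))) +
      G.F₁ (M.one (F.F₀ (L.tr.obj x y z))) -
      L.one (L.t (L.one (G.F₀ (M.tr.obj (F.F₀ x) (F.F₀ y) (F.F₀ z))))) = L.one (L.tr.obj x y z)
    rw [L.t_one, add_sub_cancel_left, G.F₁_one, h₀]

/-- A strict homomorphism whose linear functor is invertible is an isomorphism. -/
def isoOfStrict (F : LinearFunctor L.toTwoVectorSpace M.toTwoVectorSpace)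
    (G : LinearFunctor M.toTwoVectorSpace L.toTwoVectorSpace)
    (hFG₀ : ∀ x, G.F₀ (F.F₀ x) = x) (hFG₁ : ∀ f, G.F₁ (F.F₁ f) = f)
    (hGF₀ : ∀ x, F.F₀ (G.F₀ x) = x) (hGF₁ : ∀ f, F.F₁ (G.F₁ f) = f)
    (h₂ : ∀ f g, F.F₁ (L.br.mor f g) = M.br.mor (F.F₁ f) (F.F₁ g))
    (h₃ : ∀ f g k, F.F₁ (L.tr.mor f g k) = M.tr.mor (F.F₁ f) (F.F₁ g) (F.F₁ k))
    (hJ₃ : ∀ x y z, F.F₁ (L.J₃ x y z) = M.J₃ (F.F₀ x) (F.F₀ y) (F.F₀ z))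
    (hJ₅ : ∀ x₁ x₂ y₁ y₂ y₃, F.F₁ (L.J₅ x₁ x₂ y₁ y₂ y₃) =
      M.J₅ (F.F₀ x₁) (F.F₀ x₂) (F.F₀ y₁) (F.F₀ y₂) (F.F₀ y₃)) : L ≅ M where
  hom := ofStrict F h₂ h₃ hJ₃ hJ₅
  inv := ofStrict G
    -- Strictness passes to the inverse: a bracket in `L` is `G` of its image under `F`, and `F`
    -- distributes over it.
    (fun f g => by rw [← hFG₁ (L.br.mor _ _), h₂, hGF₁, hGF₁])
    (fun f g k => by rw [← hFG₁ (L.tr.mor _ _ _), h₃, hGF₁, hGF₁, hGF₁])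
    (fun x y z => by rw [← hFG₁ (L.J₃ _ _ _), hJ₃, hGF₀, hGF₀, hGF₀])
    (fun x₁ x₂ y₁ y₂ y₃ => by
      rw [← hFG₁ (L.J₅ _ _ _ _ _), hJ₅, hGF₀, hGF₀, hGF₀, hGF₀, hGF₀])
  hom_inv_id := ofStrict_comp_ofStrict hFG₀ hFG₁
  inv_hom_id := ofStrict_comp_ofStrict hGF₀ hGF₁

end LieTriple2Hom

/-! ### Essential surjectivity. -/

namespace TwoVectorSpace

variable {K : Type u} [Field K] (C : TwoVectorSpace.{u, v} K)

/-- The linear functor `(x, w) ↦ 1_x + w` from the 2-vector space of `t : ker s → C₀` to `C`. -/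
def ofKer : LinearFunctor (ofLinearMap (C.t ∘ₗ (LinearMap.ker C.s).subtype)) C where
  F₀ := LinearMap.id
  F₁ := C.one.coprod (LinearMap.ker C.s).subtype
  s_F₁ := by
    rintro ⟨x, w⟩
    change C.s (C.one x + w) = x
    rw [map_add, C.s_one, LinearMap.mem_ker.1 w.2, add_zero]
  t_F₁ := by
    rintro ⟨x, w⟩
    change C.t (C.one x + w) = x + C.t w
    rw [map_add, C.t_one]
  F₁_one x := by
    change C.one x + ((0 : LinearMap.ker C.s) : C.Mor) = C.one x
    simp
  F₁_comp := by
    rintro ⟨x, w⟩ ⟨y, m⟩ h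
    have h : x + C.t w = y := h
    subst h
    rw [vcomp_eq]
    change C.one x + ((w + m : LinearMap.ker C.s) : C.Mor) =
      (C.one x + w) + (C.one (x + C.t w) + m) - C.one (C.t (C.one x + w))
    rw [map_add C.t, C.t_one, Submodule.coe_add]
    abel

/-- The inverse of `ofKer`. -/
def toKerFunctor : LinearFunctor C (ofLinearMap (C.t ∘ₗ (LinearMap.ker C.s).subtype)) where
  F₀ := LinearMap.id
  F₁ := C.s.prod C.toKer
  s_F₁ _ := rfl
  t_F₁ f := by
    change C.s f + C.t (C.arr f) = C.t f
    rw [t_arr, add_sub_cancel]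
  F₁_one x := by
    change (C.s (C.one x), C.toKer (C.one x)) = (x, 0)
    exact Prod.ext (C.s_one x) (Subtype.ext (C.arr_one x))
  F₁_comp f g h := by
    change (C.s (C.vcomp f g h), C.toKer (C.vcomp f g h)) = (C.s f, C.toKer f + C.toKer g)
    refine Prod.ext (C.s_vcomp f g h) (Subtype.ext ?_)
    change C.arr (C.vcomp f g h) = C.arr f + C.arr g
    -- Composition is `f + g - 1_{t f}` and the subtracted identity has no arrow part.
    rw [vcomp_eq, map_sub, map_add, arr_one, sub_zero]

end TwoVectorSpace

namespace LieTriple2Algebra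

variable {K : Type u} [Field K] (L : LieTriple2Algebra.{u, v} K)

/-- A Lie triple 2-algebra is isomorphic to that of its 2-term L∞-triple algebra. -/
def isoToTwoTermLInfTriple : L.toTwoTermLInfTriple.toLieTriple2Algebra ≅ L :=
  LieTriple2Hom.isoOfStrict (L := L.toTwoTermLInfTriple.toLieTriple2Algebra)
    L.ofKer L.toKerFunctor (fun _ => rfl)
    (by
      rintro ⟨(x : L.Obj), (w : LinearMap.ker L.s)⟩
      change (L.s (L.one x + w), L.toKer (L.one x + w)) = (x, w)
      refine Prod.ext ?_ (Subtype.ext ?_)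
      · simp
      · simp [L.arr_coe])
    (fun _ => rfl)
    (fun f => (L.eq_one_add_arr f).symm)
    (by
      rintro ⟨(x : L.Obj), (w : LinearMap.ker L.s)⟩ ⟨(y : L.Obj), (m : LinearMap.ker L.s)⟩
      change L.one (L.br.obj x y) + ((L.kerB₁ w (y + L.t m) + L.kerB₂ x m : LinearMap.ker L.s) :
        L.Mor) = L.br.mor (L.one x + w) (L.one y + m)
      -- Only the sum containing `w` is collapsed to a target, `y + t m`; the term with `1_x` is
      -- expanded further. This reproduces the asymmetric formula defining `brMor`.
      rw [map_add L.br.mor, LinearMap.add_apply, L.br_mor_of_s_left w.2, map_add (L.br.mor _),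
        L.br_mor_of_s_right m.2, L.br.mor_one]
      simp
      abel)
    (by
      rintro ⟨(x : L.Obj), (w : LinearMap.ker L.s)⟩ ⟨(y : L.Obj), (m : LinearMap.ker L.s)⟩
        ⟨(z : L.Obj), (n : LinearMap.ker L.s)⟩
      change L.one (L.tr.obj x y z) + ((L.kerC₁ w (y + L.t m) (z + L.t n)
        + L.kerC₂ x m (z + L.t n) + L.kerC₃ x y n : LinearMap.ker L.s) : L.Mor) =
        L.tr.mor (L.one x + w) (L.one y + m) (L.one z + n)
      rw [map_add L.tr.mor, LinearMap.add_apply, LinearMap.add_apply, L.tr_mor_of_s₁ w.2,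
        map_add (L.tr.mor _), LinearMap.add_apply, L.tr_mor_of_s₂ m.2, map_add (L.tr.mor _ _),
        L.tr_mor_of_s₃ n.2, L.tr.mor_one]
      simp
      abel)
    (fun (x y z : L.Obj) => by
      -- The identity term is the one on the source of `J₃`, so the left side is the canonical
      -- splitting of `J₃`.
      change L.one (L.o₂ x (L.o₂ y z) + L.o₃ z y x) + L.arr (L.J₃ x y z) = L.J₃ x y z
      rw [← L.isNatural_J₃.source, ← L.eq_one_add_arr])
    (fun (x₁ x₂ y₁ y₂ y₃ : L.Obj) => by
      change L.one (L.o₃ x₁ x₂ (L.o₃ y₁ y₂ y₃)) + L.arr (L.J₅ x₁ x₂ y₁ y₂ y₃) =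
        L.J₅ x₁ x₂ y₁ y₂ y₃
      rw [← L.isNatural_J₅.source, ← L.eq_one_add_arr])

end LieTriple2Algebra

/-! ### The equivalence and its underlying complexes. -/

instance (K : Type u) [Field K] : (lieTriple2AlgebraFunctor.{u, v} K).EssSurj where
  mem_essImage L := ⟨L.toTwoTermLInfTriple, ⟨L.isoToTwoTermLInfTriple⟩⟩

instance (K : Type u) [Field K] : (lieTriple2AlgebraFunctor.{u, v} K).IsEquivalence where

/-- The 2-vector space of a complex determines the complex. -/
def complexOfTwoVectorSpaceOfComplex (K : Type u) [Field K] :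
    twoVectorSpaceOfComplex.{u, v} K ⋙ complexOfTwoVectorSpace K ≅ 𝟭 _ :=
  NatIso.ofComponents
    (fun V => Arrow.isoMk
      (LinearEquiv.toModuleIso
        { toFun := fun w => w.1.2
          map_add' := fun _ _ => rfl
          map_smul' := fun _ _ => rfl
          invFun := fun w => ⟨(0, w), rfl⟩
          left_inv := fun w => Subtype.ext (Prod.ext (LinearMap.mem_ker.1 w.2).symm rfl)
          right_inv := fun _ => rfl })
      (Iso.refl _)
      (by
        ext ⟨⟨x, w⟩, h⟩
        have h : x = 0 := h
        subst h
        exact (zero_add (V.hom.hom w)).symm))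
    (fun _ => rfl)

end

theorem theorem3p1 (K : Type u) [Field K] :
    ∃ e : TwoTermLInfTriple.{u, v} K ≌ LieTriple2Algebra.{u, v} K,
      Nonempty (e.functor ⋙ LieTriple2Algebra.toTwoVect K ≅
        TwoTermLInfTriple.toComplex K ⋙ twoVectorSpaceOfComplex K) ∧
      Nonempty (e.inverse ⋙ TwoTermLInfTriple.toComplex K ≅
        LieTriple2Algebra.toTwoVect K ⋙ complexOfTwoVectorSpace K) := by
  let e := (lieTriple2AlgebraFunctor.{u, v} K).asEquivalence
  -- The two functors agree definitionally: the underlying 2-vector space is `ofLinearMap V.d`, and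
  -- `toFunctor` is the image of the chain map under `twoVectorSpaceOfComplex`.
  let α : e.functor ⋙ LieTriple2Algebra.toTwoVect K ≅
      TwoTermLInfTriple.toComplex K ⋙ twoVectorSpaceOfComplex K := Iso.refl _
  refine ⟨e, ⟨α⟩, ⟨?_⟩⟩
  -- The inverse comes from an abstract choice, so its underlying complex is found formally: a
  -- complex is recovered from its 2-vector space, `α` trades that 2-vector space for the one
  -- underlying the image under `e.functor`, and `e.inverse ⋙ e.functor` is isomorphic to the
  -- identity.
  calc e.inverse ⋙ TwoTermLInfTriple.toComplex K
    _ ≅ (e.inverse ⋙ TwoTermLInfTriple.toComplex K) ⋙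
        twoVectorSpaceOfComplex K ⋙ complexOfTwoVectorSpace K :=
      (Functor.isoWhiskerLeft _ (complexOfTwoVectorSpaceOfComplex K) ≪≫
        Functor.rightUnitor _).symm
    _ ≅ (e.inverse ⋙ e.functor ⋙ LieTriple2Algebra.toTwoVect K) ⋙ complexOfTwoVectorSpace K :=
      Functor.isoWhiskerRight (Functor.isoWhiskerLeft e.inverse α.symm) (complexOfTwoVectorSpace K)
    _ ≅ LieTriple2Algebra.toTwoVect K ⋙ complexOfTwoVectorSpace K :=
      Functor.isoWhiskerRight (e.invFunIdAssoc _) _
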